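/- Let $q$ be a prime power, let $\mathbb{F}_q$ be a field with $q$ elements and $\mathbb{F}_{q^2}$ its quadratic extension. Let $\mathrm{U}(n,\mathbb{F}_q)$ be the group of all $g=(g_{ij})\in \mathrm{GL}(n,\mathbb{F}_{q^2})$ with $g\cdot{}^{\top}(g_{ij}^{\,q})=1$. Let $\mathrm{SL}(n,\mathbb{F}_q)$ and $\mathrm{SU}(n,\mathbb{F}_q)$ be the subgroups of elements of determinant $1$ in $\mathrm{GL}(n,\mathbb{F}_q)$ and $\mathrm{U}(n,\mathbb{F}_q)$, respectively, and let $\mathrm{PGL}(n,\mathbb{F}_q)$ and $\mathrm{PGU}(n,\mathbb{F}_q)$ be the quotients of $\mathrm{GL}(n,\mathbb{F}_q)$ and $\mathrm{U}(n,\mathbb{F}_q)$ by their centers. For $n=0$ all these groups are trivial. A conjugacy class of a group is called real if, whenever it contains $g$, it also contains $g^{-1}$. Then for every integer $n\ge 0$ the following four numbers are equal: 1. the number of real conjugacy classes of $\mathrm{PGL}(n,\mathbb{F}_q)$; 2. the number of real conjugacy classes of $\mathrm{GL}(n,\mathbb{F}_q)$ that are contained in $\mathrm{SL}(n,\mathbb{F}_q)$;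 3. the number of real conjugacy classes of $\mathrm{PGU}(n,\mathbb{F}_q)$; 4. the number of real conjugacy classes of $\mathrm{U}(n,\mathbb{F}_q)$ that are contained in $\mathrm{SU}(n,\mathbb{F}_q)$. Moreover, let $a_n$ be this common number and let $e=\gcd(q-1,2)$. Then, as formal power series over $\mathbb{Q}$ (with both infinite products convergent), $$\sum_{n\ge 0} a_n u^n=\frac12\left(\prod_{i=1}^{\infty}\frac{(1+u^i)^e}{1-qu^{2i}}+\prod_{i=1}^{\infty}\frac{1+u^{ei}}{1-qu^{2i}}\right).$$ -/

import Mathlib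

open scoped PowerSeries.WithPiTopology

/-- The real conjugacy classes of a group `G`: whenever `g` is in the class, so is `g⁻¹`. -/
def realClasses (G : Type*) [Group G] : Set (ConjClasses G) :=
  {c | ∀ g ∈ c.carrier, g⁻¹ ∈ c.carrier}

/-- The real conjugacy classes of a group `G` that are contained in the subgroup `H`
(both conjugacy and reality are taken in `G`). -/
def realClassesIn {G : Type*} [Group G] (H : Subgroup G) : Set (ConjClasses G) :=
  {c | c ∈ realClasses G ∧ c.carrier ⊆ (H : Set G)}

/-- `SL(n, F)` as the subgroup of elements of determinant `1` of `GL(n, F)`. -/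
def specialLinear (n : ℕ) (F : Type*) [Field F] : Subgroup (GL (Fin n) F) :=
  (Matrix.GeneralLinearGroup.det : GL (Fin n) F →* Fˣ).ker

/-- The unitary group `U(n, 𝔽_q)`, where `F` is a field with `q` elements and `E` is its quadratic
extension: the invertible matrices `g` over `E` that are equal to the inverse of the transpose of
the matrix obtained from `g` by raising every entry to the power `q`. -/
def finiteUnitary (n : ℕ) (F E : Type*) [Field F] [Fintype F] [Field E] [Algebra F E] :
    Subgroup (GL (Fin n) E) where
  carrier := {g | (g : Matrix (Fin n) (Fin n) E) *
    ((g : Matrix (Fin n) (Fin n) E).map (fun x => x ^ Fintype.card F)).transpose = 1}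
  one_mem' := by
    have h : (1 : Matrix (Fin n) (Fin n) E).map (FiniteField.frobeniusAlgHom F E) = 1 :=
      Matrix.map_one _ (map_zero _) (map_one _)
    have h' : (1 : Matrix (Fin n) (Fin n) E).map (fun x => x ^ Fintype.card F) = 1 := h
    simp [h']
  mul_mem' := by
    intro a b ha hb
    have h : ((a * b : GL (Fin n) E) : Matrix (Fin n) (Fin n) E).map
        (fun x => x ^ Fintype.card F) =
        (a : Matrix (Fin n) (Fin n) E).map (fun x => x ^ Fintype.card F) *
        (b : Matrix (Fin n) (Fin n) E).map (fun x => x ^ Fintype.card F) := by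
      rw [Units.val_mul]
      exact Matrix.map_mul (f := FiniteField.frobeniusAlgHom F E)
    simp only [Set.mem_ofPred_eq] at ha hb ⊢
    rw [h, Matrix.transpose_mul, Units.val_mul, Matrix.mul_assoc, ← Matrix.mul_assoc _ _
      (Matrix.transpose _), hb, Matrix.one_mul, ha]
  inv_mem' := by
    intro a ha
    have h : ((a : Matrix (Fin n) (Fin n) E) * ((a⁻¹ : GL (Fin n) E) :
        Matrix (Fin n) (Fin n) E)).map (FiniteField.frobeniusAlgHom F E) = 1 := by
      rw [Units.mul_inv]
      exact Matrix.map_one _ (map_zero _) (map_one _)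
    rw [Matrix.map_mul] at h
    have h2 := congrArg Matrix.transpose h
    rw [Matrix.transpose_mul, Matrix.transpose_one] at h2
    simp only [Set.mem_ofPred_eq] at ha ⊢
    have ha' : ((a : Matrix (Fin n) (Fin n) E).map
        (FiniteField.frobeniusAlgHom F E)).transpose =
        ((a⁻¹ : GL (Fin n) E) : Matrix (Fin n) (Fin n) E) :=
      (Units.inv_eq_of_mul_eq_one_right ha).symm
    rw [ha'] at h2
    have h3 := mul_eq_one_comm.mp h2
    exact h3

/-- `SU(n, 𝔽_q)` as the subgroup of elements of determinant `1` of `U(n, 𝔽_q)`. -/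
def finiteSpecialUnitary (n : ℕ) (F E : Type*) [Field F] [Fintype F] [Field E] [Algebra F E] :
    Subgroup (finiteUnitary n F E) :=
  (specialLinear n E).subgroupOf (finiteUnitary n F E)

/-- `PGU(n, 𝔽_q)`: the unitary group modulo its center. -/
abbrev ProjFiniteUnitary (n : ℕ) (F E : Type*) [Field F] [Fintype F] [Field E] [Algebra F E] :
    Type _ :=
  finiteUnitary n F E ⧸ Subgroup.center (finiteUnitary n F E)

/-!
The conjugacy classes of `GL(n, F)` are parametrized by sequences of monic polynomials
`d₁, d₂, …` with nonzero constant terms and `∑ i * deg dᵢ = n`, where `dᵢ` collects the irreducible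
polynomials `p` for which `p ^ i` is an elementary divisor (`HasElemDiv`, `ConjClasses.elemDiv`).
For `α` in `Fˣ`, the class of `g` contains `α g⁻¹` if and only if every `dᵢ` is equal to its
`α`-twisted reciprocal, the monic polynomial whose roots are the quotients of `α` by the roots of
`dᵢ` (`ncard_twistedReal_scalar`). Let `N_α(n)` be the number of these classes. Its generating
function is the product over `i` of the generating functions, in `u ^ i`, of the numbers of
self-reciprocal polynomials. These numbers are found by looking at coefficients, and the result is
the first product of the theorem if `α` is a square, and the second if it is not
(`hasProd_twistedRealSeries_of_isSquare`, `hasProd_twistedRealSeries_of_not_isSquare`). A real class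
has determinant `1` or `-1`; if real classes are weighted by the sign of their determinants, the
same method, together with Euler's identity for partitions into odd and distinct parts, gives the
second product once more (`hasProd_signedRealSeries`). So the sum of the two products is twice the
generating function of the real classes in `SL(n, F)`.

For a finite group `G` with center `Z`, counting the pairs `(g, x)` for which `x g x⁻¹ g` is central
shows that `|Z|` times the number of real classes of `G / Z` is the sum over `z` in `Z` of the
number of classes of `G` stable under `g ↦ z g⁻¹` (`card_center_mul_ncard_realClasses`), and this
number depends only on `z` modulo squares in `Z`. For `G = GL(n, F)` with `n ≥ 1` the center is
`Fˣ`. If `q` is odd, half of its elements are squares, and twice the number of real classes of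
`PGL(n, F)` is `N_1(n) + N_α(n)` for a nonsquare `α`. If `q` is even, all of its elements are
squares, and the two products of the theorem coincide.

The unitary group is reduced to `GL(n, F)` inside `GL(n, E)`, where `ḡ` denotes the matrix with
entries raised to the power `q`. By Hilbert 90 and the surjectivity of norms in finite commutative
algebras with involution, the classes of `GL(n, F)` and of `U(n, F)` are the classes of `GL(n, E)`
that are stable under `g ↦ ḡ` and under `g ↦ (gᴴ)⁻¹`, respectively (`ncard_linear_eq`,
`ncard_unitary_eq`). As a matrix is similar to its transpose, `gᴴ` is similar to `ḡ`, and the two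
conditions agree on real classes. This matches the real classes in `SL(n, F)` with those in
`SU(n, F)`. The center of `U(n, F)` consists of the scalars `ζ` of norm `1`; writing `ζ = γ / γ̄`
and `z = (γ γ̄)⁻¹`, multiplication by `γ` matches the classes of `GL(n, F)` stable under `g ↦ z g⁻¹`
with the classes of `U(n, F)` stable under `g ↦ ζ g⁻¹` (`ncard_twistedReal_unitary`), and `ζ` is a
square of an element of norm `1` if `z` is a square in `F`. So the real classes of `PGU(n, F)` are
counted by the same formula as those of `PGL(n, F)`.
-/

/-! ### Hilbert 90 and norms for an involution of a finite commutative ring -/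

section FiniteInvolution

variable {R : Type*} [CommRing R] [Finite R]

theorem exists_idempotent_pow_of_finite {M : Type*} [Monoid M] [Finite M] (y : M) :
    ∃ N : ℕ, 0 < N ∧ IsIdempotentElem (y ^ N) := by
  obtain ⟨a, b, hab, h⟩ := Finite.exists_ne_map_eq_of_infinite (fun k : ℕ => y ^ k)
  wlog hlt : a < b generalizing a b
  · exact this b a hab.symm h.symm (lt_of_le_of_ne (not_lt.mp hlt) hab.symm)
  obtain ⟨d, hd, rfl⟩ : ∃ d, 0 < d ∧ b = a + d := ⟨b - a, by omega, by omega⟩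
  have key : ∀ m, a ≤ m → y ^ (m + d) = y ^ m := by
    intro m hm
    obtain ⟨k, rfl⟩ := Nat.exists_eq_add_of_le hm
    have h' : y ^ a = y ^ (a + d) := h
    rw [show a + k + d = (a + d) + k by ring, pow_add y (a + d) k, ← h', pow_add]
  have key2 : ∀ k m, a ≤ m → y ^ (m + k * d) = y ^ m := by
    intro k
    induction k with
    | zero => intro m _; simp
    | succ k ih =>
      intro m hm
      rw [show m + (k + 1) * d = (m + k * d) + d by ring, key _ (by omega), ih m hm]
  refine ⟨(a + 1) * d, by positivity, ?_⟩
  rw [IsIdempotentElem, ← pow_add]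
  exact key2 (a + 1) _ (by nlinarith)

/-- Hilbert 90 for an involution of a finite commutative ring. The idempotent power `f` of `1 + c`
splits the ring into a part where `1 + c` is invertible, on which `1 + c * σ 1` is a solution, and
a part where it is nilpotent, on which the solution `l + c * σ l` differs from the unit `l - σ l`
by a nilpotent element. -/
theorem exists_unit_mul_apply_eq (σ : R →+* R) (hσ : ∀ x, σ (σ x) = x) (l : R)
    (hl : IsUnit (l - σ l)) (c : R) (hc : c * σ c = 1) : ∃ a : R, IsUnit a ∧ c * σ a = a := by
  obtain ⟨N, hN, hf⟩ := exists_idempotent_pow_of_finite (1 + c)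
  set f := (1 + c) ^ N with hfdef
  have h1 : c * σ (1 + c) = 1 + c := by rw [map_add, map_one, mul_add, hc]; ring
  have h2 : c ^ N * σ f = f := by
    rw [hfdef, map_pow, ← mul_pow, h1]
  have hσf' : IsIdempotentElem (σ f) := by
    rw [IsIdempotentElem, ← map_mul, hf.eq]
  have h3 : σ f = (σ c) ^ N * f := by
    conv_rhs => rw [← h2, ← mul_assoc, ← mul_pow, mul_comm (σ c), hc, one_pow, one_mul]
  have h4 : f * σ f = f := by
    calc f * σ f = c ^ N * (σ f * σ f) := by rw [← mul_assoc, h2]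
      _ = f := by rw [hσf'.eq, h2]
  have h5 : σ f * f = σ f := by
    calc σ f * f = σ c ^ N * (f * f) := by rw [← mul_assoc, ← h3]
      _ = σ f := by rw [hf.eq, ← h3]
  have hσf : σ f = f := by rw [← h5, mul_comm, h4]
  refine ⟨f + l * (1 - f) + c * σ (f + l * (1 - f)), ?_, ?_⟩
  · have hval : f + l * (1 - f) + c * σ (f + l * (1 - f)) =
        ((1 + c) * f + (l - σ l) * (1 - f)) + σ l * ((1 + c) * (1 - f)) := by
      simp only [map_add, map_mul, map_sub, map_one, hσf]
      ring
    rw [hval]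
    have hnil : IsNilpotent (σ l * ((1 + c) * (1 - f))) := by
      refine ⟨N, ?_⟩
      have : (1 - f) ^ N = 1 - f := IsIdempotentElem.pow_eq hf.one_sub hN.ne'
      rw [mul_pow, mul_pow, this, ← hfdef, mul_sub, hf.eq]
      ring
    refine hnil.isUnit_add_left_of_commute ?_ (Commute.all _ _)
    obtain ⟨u, hu⟩ := hl
    refine IsUnit.of_mul_eq_one ((1 + c) ^ (N - 1) * f + (↑u⁻¹ : R) * (1 - f)) ?_
    have e1 : (1 + c) * (1 + c) ^ (N - 1) = f := by
      rw [← pow_succ', Nat.sub_add_cancel hN]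
    have e2 : (u : R) * (↑u⁻¹ : R) = 1 := u.mul_inv
    have e3 : f * f = f := hf
    rw [← hu]
    linear_combination (f * f) * e1 + (1 - f) ^ 2 * e2 +
      ((1 + c) * ↑u⁻¹ * (-1) + u * (1 + c) ^ (N - 1) * (-1) + f + 2) * e3
  · simp only [map_add, map_mul, hσ]
    linear_combination (f + l * (1 - f)) * hc

/-- Units fixed by `σ` are norms. By Hilbert 90 the quotients `u / σ u` are the elements of norm
`1`, so there are as many norms as fixed units. -/
theorem exists_mul_apply_eq (σ : R →+* R) (hσ : ∀ x, σ (σ x) = x) (l : R)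
    (hl : IsUnit (l - σ l)) (c : R) (hc : IsUnit c) (hσc : σ c = c) : ∃ a : R, a * σ a = c := by
  let s : Rˣ →* Rˣ := Units.map (σ : R →* R)
  have hs : ∀ u, s (s u) = u := fun u => Units.ext (hσ _)
  let Nm : Rˣ →* Rˣ := MonoidHom.id _ * s
  let D : Rˣ →* Rˣ := MonoidHom.id _ / s
  have hDker : ∀ u, u ∈ D.ker ↔ s u = u := by
    intro u
    rw [MonoidHom.mem_ker, MonoidHom.div_apply, MonoidHom.id_apply, div_eq_one, eq_comm]
  have hDran : D.range = Nm.ker := by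
    ext u
    constructor
    · rintro ⟨v, rfl⟩
      simp [D, Nm, MonoidHom.mem_ker, hs]
    · intro hu
      have hu' : (u : R) * σ u = 1 := congrArg Units.val (MonoidHom.mem_ker.mp hu)
      obtain ⟨a, ha, hca⟩ := exists_unit_mul_apply_eq σ hσ l hl u hu'
      obtain ⟨v, rfl⟩ := ha
      refine ⟨v, ?_⟩
      have : u * s v = v := Units.ext hca
      simp only [D, MonoidHom.div_apply, MonoidHom.id_apply]
      rw [div_eq_iff_eq_mul, this]
  -- the norms are fixed units, and there are at least as many of them
  have hle : Nm.range ≤ D.ker := by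
    rintro _ ⟨v, rfl⟩
    rw [hDker]
    simp only [Nm, MonoidHom.mul_apply, MonoidHom.id_apply, map_mul, hs, mul_comm]
  have hcard : Nat.card D.ker ≤ Nat.card Nm.range := by
    have e1 := Subgroup.card_mul_index D.ker
    have e2 := Subgroup.card_mul_index Nm.ker
    rw [Subgroup.index_ker] at e1 e2
    rw [hDran] at e1
    have : 0 < Nat.card Nm.ker := Nat.card_pos
    rw [← e2, mul_comm] at e1
    exact (Nat.eq_of_mul_eq_mul_left this e1).le
  have heq := Subgroup.eq_of_le_of_card_ge hle hcard
  obtain ⟨u, rfl⟩ := hc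
  have : u ∈ Nm.range := by
    rw [heq, hDker]
    exact Units.ext hσc
  obtain ⟨v, hv⟩ := this
  exact ⟨v, congrArg Units.val hv⟩

end FiniteInvolution

/-! ### Frobenius-semilinear maps on finite algebras -/

section FiniteAlgebra

/-- An additive map `τ` of an `E`-algebra that is semilinear for `x ↦ x ^ q` and multiplicative on
commuting pairs. The last condition covers ring endomorphisms and anti-endomorphisms alike. -/
structure IsFrobeniusTwisted (q : ℕ) (E : Type*) {A : Type*} [Field E] [Ring A] [Algebra E A]
    (τ : A →+ A) : Prop where
  map_smul : ∀ (x : E) (a : A), τ (x • a) = x ^ q • τ a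
  map_one : τ 1 = 1
  map_mul : ∀ a b : A, Commute a b → τ (a * b) = τ a * τ b

variable {E A : Type*} [Field E] [Ring A] [Algebra E A] {q : ℕ} {τ : A →+ A}

theorem commute_of_mem_adjoin_singleton {c x y : A} (hx : x ∈ Algebra.adjoin E {c})
    (hy : y ∈ Algebra.adjoin E {c}) : Commute x y :=
  Algebra.commute_of_mem_adjoin_singleton_of_commute hy (Algebra.commute_of_mem_adjoin_self hx).symm

theorem IsFrobeniusTwisted.map_mem_adjoin (h : IsFrobeniusTwisted q E τ) {c : A}
    (hc : τ c ∈ Algebra.adjoin E {c}) {a : A} (ha : a ∈ Algebra.adjoin E {c}) :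
    τ a ∈ Algebra.adjoin E {c} := by
  induction ha using Algebra.adjoin_induction with
  | mem x hx => rw [Set.mem_singleton_iff.mp hx]; exact hc
  | algebraMap r =>
    rw [Algebra.algebraMap_eq_smul_one, h.map_smul, h.map_one]
    exact Subalgebra.smul_mem _ (one_mem _) _
  | add x y _ _ hx hy => rw [map_add]; exact add_mem hx hy
  | mul x y hx' hy' hx hy =>
    rw [h.map_mul x y (commute_of_mem_adjoin_singleton hx' hy')]; exact mul_mem hx hy

theorem IsFrobeniusTwisted.apply_apply (h : IsFrobeniusTwisted q E τ)
    (hE : ∀ x : E, (x ^ q) ^ q = x) {c : A}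
    (hc : τ c ∈ Algebra.adjoin E {c}) (hcc : τ (τ c) = c) {a : A} (ha : a ∈ Algebra.adjoin E {c}) :
    τ (τ a) = a := by
  induction ha using Algebra.adjoin_induction with
  | mem x hx => rw [Set.mem_singleton_iff.mp hx]; exact hcc
  | algebraMap r =>
    rw [Algebra.algebraMap_eq_smul_one, h.map_smul, h.map_one, h.map_smul, h.map_one, hE]
  | add x y _ _ hx hy => rw [map_add, map_add, hx, hy]
  | mul x y hx' hy' hx hy =>
    rw [h.map_mul x y (commute_of_mem_adjoin_singleton hx' hy'),
      h.map_mul _ _ (commute_of_mem_adjoin_singleton (h.map_mem_adjoin hc hx')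
        (h.map_mem_adjoin hc hy')), hx, hy]

/-- The restriction of `τ` to the commutative subalgebra generated by `c`. -/
noncomputable def IsFrobeniusTwisted.restrict (h : IsFrobeniusTwisted q E τ) {c : A}
    (hc : τ c ∈ Algebra.adjoin E {c}) : Algebra.adjoin E {c} →+* Algebra.adjoin E {c} where
  toFun a := ⟨τ a, h.map_mem_adjoin hc a.2⟩
  map_one' := Subtype.ext h.map_one
  map_zero' := Subtype.ext (map_zero τ)
  map_add' _ _ := Subtype.ext (map_add τ _ _)
  map_mul' a b := Subtype.ext (h.map_mul _ _ (commute_of_mem_adjoin_singleton a.2 b.2))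

theorem IsFrobeniusTwisted.isUnit_sub (h : IsFrobeniusTwisted q E τ) {c : A}
    (hc : τ c ∈ Algebra.adjoin E {c}) {l : E} (hl : l ^ q ≠ l) :
    IsUnit (algebraMap E (Algebra.adjoin E {c}) l - h.restrict hc (algebraMap E _ l)) := by
  have : h.restrict hc (algebraMap E _ l) = algebraMap E _ (l ^ q) := by
    apply Subtype.ext
    change τ (algebraMap E A l) = algebraMap E A (l ^ q)
    rw [Algebra.algebraMap_eq_smul_one, h.map_smul, h.map_one, Algebra.algebraMap_eq_smul_one]
  rw [this, ← map_sub]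
  exact (IsUnit.mk0 _ (sub_ne_zero.mpr hl.symm)).map _

/-- Hilbert 90 in a noncommutative finite algebra. The solution is found in the commutative
subalgebra generated by `c`, which `τ` preserves because `τ c = c⁻¹` is a power of `c`. -/
theorem IsFrobeniusTwisted.exists_mul_apply_eq_self [Finite A] (h : IsFrobeniusTwisted q E τ)
    (hE : ∀ x : E, (x ^ q) ^ q = x) {l : E} (hl : l ^ q ≠ l) {c : A} (hc : c * τ c = 1) :
    ∃ a ∈ Algebra.adjoin E {c}, IsUnit a ∧ c * τ a = a := by
  have hc' : τ c * c = 1 := mul_eq_one_symm hc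
  have hmem : τ c ∈ Algebra.adjoin E {c} := by
    obtain ⟨u, hu⟩ : IsUnit c := ⟨⟨c, τ c, hc, hc'⟩, rfl⟩
    obtain ⟨N, hN, hN1⟩ := isOfFinOrder_iff_pow_eq_one.mp (isOfFinOrder_of_finite u)
    have : τ c = c ^ (N - 1) := by
      have h1 : c ^ (N - 1) * c = 1 := by
        rw [← pow_succ, Nat.sub_add_cancel hN, ← hu, ← Units.val_pow_eq_pow_val, hN1, Units.val_one]
      calc τ c = (c ^ (N - 1) * c) * τ c := by rw [h1, one_mul]
        _ = c ^ (N - 1) := by rw [mul_assoc, hc, mul_one]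
    rw [this]
    exact pow_mem (Algebra.self_mem_adjoin_singleton E c) _
  have hcc : τ (τ c) = c := by
    have h1 : τ c * τ (τ c) = 1 := by
      rw [← h.map_mul _ _ (show Commute c (τ c) from hc.trans hc'.symm), hc, h.map_one]
    calc τ (τ c) = (c * τ c) * τ (τ c) := by rw [hc, one_mul]
      _ = c := by rw [mul_assoc, h1, mul_one]
  let _ : CommRing (Algebra.adjoin E {c}) :=
    { (inferInstance : Ring (Algebra.adjoin E {c})) with
      mul_comm := fun x y => Subtype.ext (commute_of_mem_adjoin_singleton x.2 y.2) }
  obtain ⟨a, ha, hca⟩ := exists_unit_mul_apply_eq (h.restrict hmem)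
    (fun x => Subtype.ext (h.apply_apply hE hmem hcc x.2)) _ (h.isUnit_sub hmem hl)
    ⟨c, Algebra.self_mem_adjoin_singleton E c⟩ (Subtype.ext hc)
  exact ⟨a, a.2, ha.map (Subalgebra.val _), congrArg Subtype.val hca⟩

theorem IsFrobeniusTwisted.exists_mul_apply_eq [Finite A] (h : IsFrobeniusTwisted q E τ)
    (hE : ∀ x : E, (x ^ q) ^ q = x) {l : E} (hl : l ^ q ≠ l) {c : A} (hc : IsUnit c)
    (hcτ : τ c = c) : ∃ a ∈ Algebra.adjoin E {c}, a * τ a = c := by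
  have hself := Algebra.self_mem_adjoin_singleton E c
  have hmem : τ c ∈ Algebra.adjoin E {c} := by rwa [hcτ]
  let _ : CommRing (Algebra.adjoin E {c}) :=
    { (inferInstance : Ring (Algebra.adjoin E {c})) with
      mul_comm := fun x y => Subtype.ext (commute_of_mem_adjoin_singleton x.2 y.2) }
  have hu : IsUnit (⟨c, hself⟩ : Algebra.adjoin E {c}) := by
    obtain ⟨u, hu⟩ := hc
    obtain ⟨N, hN, hN1⟩ := isOfFinOrder_iff_pow_eq_one.mp (isOfFinOrder_of_finite u)
    refine IsUnit.of_pow_eq_one (n := N) (Subtype.ext ?_) hN.ne'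
    change c ^ N = 1
    rw [← hu, ← Units.val_pow_eq_pow_val, hN1, Units.val_one]
  obtain ⟨a, hca⟩ := _root_.exists_mul_apply_eq (h.restrict hmem)
    (fun x => Subtype.ext (h.apply_apply hE hmem (by rw [hcτ, hcτ]) x.2)) _ (h.isUnit_sub hmem hl)
    ⟨c, hself⟩ hu (Subtype.ext hcτ)
  exact ⟨a, a.2, congrArg Subtype.val hca⟩

end FiniteAlgebra

/-! ### Galois and unitary descent of conjugacy classes -/

section Descent

theorem IsFrobeniusTwisted.exists_unit_mul_apply_eq_self {n : ℕ} {E : Type*} [Field E] {q : ℕ}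
    [Finite E]
    {τ : Matrix (Fin n) (Fin n) E →+ Matrix (Fin n) (Fin n) E}
    (h : IsFrobeniusTwisted q E τ) (hE : ∀ x : E, (x ^ q) ^ q = x) {l : E} (hl : l ^ q ≠ l)
    {c : GL (Fin n) E} (hc : c * τ c = 1) :
    ∃ a : GL (Fin n) E, (∀ g, Commute c g → Commute a g) ∧
      c * τ a = (a : Matrix (Fin n) (Fin n) E) := by
  obtain ⟨a, ha, ⟨u, rfl⟩, hca⟩ := h.exists_mul_apply_eq_self hE hl hc
  refine ⟨u, fun g hg => ?_, hca⟩
  have hg' : Commute (g : Matrix (Fin n) (Fin n) E) (c : Matrix (Fin n) (Fin n) E) :=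
    (congrArg Units.val hg.eq).symm
  have := Algebra.commute_of_mem_adjoin_singleton_of_commute ha hg'
  exact Units.ext this.eq.symm

theorem IsFrobeniusTwisted.exists_unit_mul_apply_eq {n : ℕ} {E : Type*} [Field E] {q : ℕ} [Finite E]
    {τ : Matrix (Fin n) (Fin n) E →+ Matrix (Fin n) (Fin n) E}
    (h : IsFrobeniusTwisted q E τ) (hE : ∀ x : E, (x ^ q) ^ q = x) {l : E} (hl : l ^ q ≠ l)
    {c : GL (Fin n) E} (hc : τ c = c) :
    ∃ a : GL (Fin n) E, (∀ g, Commute c g → Commute a g) ∧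
      a * τ a = (c : Matrix (Fin n) (Fin n) E) := by
  obtain ⟨a, ha, hca⟩ := h.exists_mul_apply_eq hE hl c.isUnit hc
  have hu : IsUnit a := by
    rw [Matrix.isUnit_iff_isUnit_det]
    refine isUnit_of_mul_isUnit_left (y := (τ a).det) ?_
    rw [← Matrix.det_mul, hca, ← Matrix.isUnit_iff_isUnit_det]
    exact c.isUnit
  obtain ⟨u, rfl⟩ := hu
  refine ⟨u, fun g hg => ?_, hca⟩
  have hg' : Commute (g : Matrix (Fin n) (Fin n) E) (c : Matrix (Fin n) (Fin n) E) :=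
    (congrArg Units.val hg.eq).symm
  have := Algebra.commute_of_mem_adjoin_singleton_of_commute ha hg'
  exact Units.ext this.eq.symm

variable {n : ℕ} {E : Type*} [Field E] [StarRing E] {q : ℕ}

/-- The automorphism of `GL(n, E)` that applies the involution of `E` to every entry. -/
noncomputable def frobGL (n : ℕ) (E : Type*) [Field E] [StarRing E] :
    GL (Fin n) E →* GL (Fin n) E :=
  Matrix.GeneralLinearGroup.map (starRingEnd E)

theorem frobGL_frobGL (g : GL (Fin n) E) : frobGL n E (frobGL n E g) = g := by
  ext i j
  simp [frobGL]

/-- Entrywise involution, conjugated by an invertible matrix `x`. -/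
noncomputable def twistedFrob (x : GL (Fin n) E) :
    Matrix (Fin n) (Fin n) E →+ Matrix (Fin n) (Fin n) E where
  toFun a := (↑x⁻¹ : Matrix (Fin n) (Fin n) E) * a.map (starRingEnd E) * x
  map_zero' := by simp
  map_add' a b := by
    rw [Matrix.map_add _ (map_add _), mul_add, add_mul]

/-- Conjugate transpose, conjugated by an invertible matrix `h`. -/
noncomputable def twistedStar (h : GL (Fin n) E) :
    Matrix (Fin n) (Fin n) E →+ Matrix (Fin n) (Fin n) E where
  toFun a := (↑h⁻¹ : Matrix (Fin n) (Fin n) E) * star a * h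
  map_zero' := by simp
  map_add' a b := by
    rw [star_add, mul_add, add_mul]

theorem isFrobeniusTwisted_twistedFrob (hq : ∀ x : E, star x = x ^ q) (x : GL (Fin n) E) :
    IsFrobeniusTwisted q E (twistedFrob x) where
  map_smul l a := by
    have : (l • a).map (starRingEnd E) = l ^ q • a.map (starRingEnd E) := by
      ext i j; simp [← hq, starRingEnd_apply]
    simp [twistedFrob, this]
  map_one := by
    have : (1 : Matrix (Fin n) (Fin n) E).map (starRingEnd E) = 1 :=
      Matrix.map_one _ (map_zero _) (map_one _)
    simp [twistedFrob, this]
  map_mul a b _ := by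
    simp only [twistedFrob, AddMonoidHom.coe_mk, ZeroHom.coe_mk, Matrix.map_mul, mul_assoc,
      Units.mul_inv_cancel_left]

theorem isFrobeniusTwisted_twistedStar (hq : ∀ x : E, star x = x ^ q) (x : GL (Fin n) E) :
    IsFrobeniusTwisted q E (twistedStar x) where
  map_smul l a := by
    simp [twistedStar, star_smul, hq]
  map_one := by simp [twistedStar]
  map_mul a b hab := by
    rw [hab.eq]
    simp only [twistedStar, AddMonoidHom.coe_mk, ZeroHom.coe_mk, star_mul, mul_assoc,
      Units.mul_inv_cancel_left]

theorem pow_pow_eq_of_star_eq (hq : ∀ x : E, star x = x ^ q) (x : E) : (x ^ q) ^ q = x := by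
  rw [← hq, ← hq, star_star]

/-- Matrices over the fixed field that are conjugate over `E` are conjugate over the fixed field.
If `x` conjugates `g₁` to `g₂`, then `x⁻¹ x̄` centralizes `g₁`; Hilbert 90 in the algebra that it
generates corrects `x` to a fixed matrix. -/
theorem exists_fixed_conj_of_isConj [Finite E] (hq : ∀ x : E, star x = x ^ q) {l : E}
    (hl : l ^ q ≠ l) {g₁ g₂ : GL (Fin n) E} (h₁ : frobGL n E g₁ = g₁)
    (h₂ : frobGL n E g₂ = g₂) (h : IsConj g₁ g₂) :
    ∃ y, frobGL n E y = y ∧ y * g₁ * y⁻¹ = g₂ := by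
  obtain ⟨x, hx⟩ := isConj_iff.mp h
  have hx' : frobGL n E x * g₁ * (frobGL n E x)⁻¹ = g₂ := by
    rw [← h₂, ← hx, map_mul, map_mul, map_inv, h₁]
  have hc : (x⁻¹ * frobGL n E x) * (1⁻¹ * frobGL n E (x⁻¹ * frobGL n E x) * 1) = 1 := by
    simp [frobGL_frobGL]
  obtain ⟨a, ha, hca⟩ := (isFrobeniusTwisted_twistedFrob hq 1).exists_unit_mul_apply_eq_self
    (pow_pow_eq_of_star_eq hq) hl (congrArg Units.val hc)
  have hca' : x⁻¹ * frobGL n E x * (1⁻¹ * frobGL n E a * 1) = a := Units.ext hca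
  rw [inv_one, one_mul, mul_one, mul_assoc, inv_mul_eq_iff_eq_mul] at hca'
  have hcomm : Commute (x⁻¹ * frobGL n E x) g₁ := by
    have h3 := hx.trans hx'.symm
    generalize frobGL n E x = X at h3
    have h4 : g₁ = x⁻¹ * (X * g₁ * X⁻¹) * x := by rw [← h3]; group
    change x⁻¹ * X * g₁ = g₁ * (x⁻¹ * X)
    conv_rhs => rw [h4]
    group
  refine ⟨x * a, by rw [map_mul, hca'], ?_⟩
  rw [mul_assoc x, (ha g₁ hcomm).eq, ← hx]
  group

/-- A conjugacy class of `GL(n, E)` that is stable under the involution of `E` contains a matrix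
over the fixed field. -/
theorem exists_fixed_of_isConj_frobGL [Finite E] (hq : ∀ x : E, star x = x ^ q) {l : E}
    (hl : l ^ q ≠ l) {g : GL (Fin n) E} (h : IsConj g (frobGL n E g)) :
    ∃ g₀, frobGL n E g₀ = g₀ ∧ IsConj g g₀ := by
  obtain ⟨x, hx⟩ := isConj_iff.mp h
  have hx1 : x * g = frobGL n E g * x := mul_inv_eq_iff_eq_mul.mp hx
  have hx2 : frobGL n E x * frobGL n E g = g * frobGL n E x := by
    rw [← map_mul, hx1, map_mul, frobGL_frobGL]
  have hcomm : Commute (frobGL n E x * x) g := by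
    change frobGL n E x * x * g = g * (frobGL n E x * x)
    rw [mul_assoc, hx1, ← mul_assoc, hx2, mul_assoc]
  have hc : x⁻¹ * frobGL n E (frobGL n E x * x)⁻¹ * x = (frobGL n E x * x)⁻¹ := by
    rw [map_inv, map_mul, frobGL_frobGL]; group
  -- `x̄ x` centralizes `g`; writing its inverse as a norm, `x` is corrected to satisfy `x̄ x = 1`
  obtain ⟨a, ha, hca⟩ := (isFrobeniusTwisted_twistedFrob hq x).exists_unit_mul_apply_eq
    (pow_pow_eq_of_star_eq hq) hl (congrArg Units.val hc)
  have hca' : a * (x⁻¹ * frobGL n E a * x) = (frobGL n E x * x)⁻¹ := Units.ext hca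
  have hag := ha g hcomm.inv_left
  have hac := (ha _ (Commute.refl _)).inv_right
  rw [inv_inv] at hac
  have hx' : frobGL n E (x * a) * (x * a) = 1 := by
    rw [map_mul]
    generalize frobGL n E x = X at *
    generalize frobGL n E a = A at *
    have hA : A = x * a⁻¹ * (X * x)⁻¹ * x⁻¹ := by rw [← hca']; group
    have h1 : X * A * (x * a) = (X * x) * a⁻¹ * (X * x)⁻¹ * a := by rw [hA]; group
    rw [h1, ← hac.inv_left.eq]
    group
  have hxg : x * a * g * (x * a)⁻¹ = frobGL n E g := by
    rw [mul_assoc x, hag.eq, ← hx]; group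
  generalize x * a = y at hx' hxg
  -- now `y ȳ = 1`, so that `y` is a coboundary
  have hc' : frobGL n E y * (1⁻¹ * frobGL n E (frobGL n E y) * 1) = 1 := by
    simp [frobGL_frobGL, hx']
  obtain ⟨b, -, hcb⟩ := (isFrobeniusTwisted_twistedFrob hq 1).exists_unit_mul_apply_eq_self
    (pow_pow_eq_of_star_eq hq) hl (congrArg Units.val hc')
  have hcb' : frobGL n E y * (1⁻¹ * frobGL n E b * 1) = b := Units.ext hcb
  rw [inv_one, one_mul, mul_one, eq_inv_of_mul_eq_one_left hx', inv_mul_eq_iff_eq_mul] at hcb'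
  refine ⟨b⁻¹ * g * b, ?_, isConj_iff.mpr ⟨b⁻¹, by group⟩⟩
  rw [map_mul, map_mul, map_inv, hcb', ← hxg]
  group

/-- Unitary matrices that are conjugate in `GL(n, E)` are conjugate in the unitary group. If `x`
conjugates `u₁` to `u₂`, then the hermitian matrix `xᴴ x` centralizes `u₁`, and it is a norm from
the algebra that it generates. -/
theorem exists_unitary_conj_of_isConj [Finite E] (hq : ∀ x : E, star x = x ^ q) {l : E}
    (hl : l ^ q ≠ l) {u₁ u₂ : GL (Fin n) E} (h₁ : star u₁ * u₁ = 1) (h₂ : star u₂ * u₂ = 1)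
    (h : IsConj u₁ u₂) : ∃ y : GL (Fin n) E, star y * y = 1 ∧ y * u₁ * y⁻¹ = u₂ := by
  obtain ⟨x, hx⟩ := isConj_iff.mp h
  have h₁' := eq_inv_of_mul_eq_one_left h₁
  have h₂' := eq_inv_of_mul_eq_one_left h₂
  have hx' : star x⁻¹ * u₁⁻¹ * star x = u₂⁻¹ := by
    rw [← h₂', ← hx, star_mul, star_mul, h₁', mul_assoc]
  have hcomm : Commute (star x * x) u₁ := by
    change star x * x * u₁ = u₁ * (star x * x)
    rw [← hx, star_inv] at hx'
    generalize star x = X at hx'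
    have h3 : u₁ = X * (x * u₁ * x⁻¹) * X⁻¹ := by
      rw [← inv_inv (x * u₁ * x⁻¹), ← hx']; group
    conv_rhs => rw [h3]
    group
  have hc : (1⁻¹ * star (star x * x) * 1) = star x * x := by simp
  obtain ⟨a, ha, hca⟩ := (isFrobeniusTwisted_twistedStar hq 1).exists_unit_mul_apply_eq
    (pow_pow_eq_of_star_eq hq) hl (congrArg Units.val hc)
  have hca' : a * (1⁻¹ * star a * 1) = star x * x := Units.ext hca
  rw [inv_one, one_mul, mul_one] at hca'
  have hac := ha _ (Commute.refl _)
  refine ⟨x * a⁻¹, ?_, ?_⟩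
  · rw [star_mul, star_inv]
    generalize star x = X at *
    generalize star a = A at *
    have hA : A = a⁻¹ * (X * x) := by rw [← hca']; group
    have h3 : A⁻¹ * X * (x * a⁻¹) = (X * x)⁻¹ * a * (X * x) * a⁻¹ := by rw [hA]; group
    rw [mul_assoc _ a, hac.eq] at h3
    rw [h3]
    group
  · have := (ha u₁ hcomm).inv_left
    rw [mul_assoc x, this.eq, ← hx]
    group

/-- A conjugacy class of `GL(n, E)` that is stable under `g ↦ (gᴴ)⁻¹` contains a unitary matrix:
`g` preserves a nondegenerate sesquilinear form, which Hilbert 90 makes hermitian, and which is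
then brought to the standard form. -/
theorem exists_unitary_of_isConj_star_inv [Finite E] (hq : ∀ x : E, star x = x ^ q) {l : E}
    (hl : l ^ q ≠ l) {g : GL (Fin n) E} (h : IsConj g (star g)⁻¹) :
    ∃ u : GL (Fin n) E, star u * u = 1 ∧ IsConj g u := by
  obtain ⟨x, hx⟩ := isConj_iff.mp h
  have hx1 : star g * x * g = x := by
    rw [mul_assoc, mul_inv_eq_iff_eq_mul.mp hx]; group
  have hx2 : star g * star x * g = star x := by
    conv_rhs => rw [← hx1]
    rw [star_mul, star_mul, star_star, mul_assoc]
  have hcomm : Commute (x⁻¹ * star x) g := by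
    change x⁻¹ * star x * g = g * (x⁻¹ * star x)
    have h3 : g⁻¹ * x⁻¹ * (star g)⁻¹ = x⁻¹ := by
      conv_rhs => rw [← hx1]
      group
    have h4 : star x * g = (star g)⁻¹ * star x := by
      conv_rhs => rw [← hx2]
      group
    conv_rhs => rw [← h3]
    rw [mul_assoc, h4]
    group
  have hc : x⁻¹ * star x * (x⁻¹ * star (x⁻¹ * star x) * x) = 1 := by
    rw [star_mul, star_star, star_inv]; group
  obtain ⟨a, ha, hca⟩ := (isFrobeniusTwisted_twistedStar hq x).exists_unit_mul_apply_eq_self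
    (pow_pow_eq_of_star_eq hq) hl (congrArg Units.val hc)
  have hca' : x⁻¹ * star x * (x⁻¹ * star a * x) = a := Units.ext hca
  have hag := ha g hcomm
  have hac := ha _ (Commute.refl _)
  -- the form preserved by `g` is now hermitian
  have hk : star (x * a) = x * a := by
    rw [star_mul]
    generalize star x = X at *
    generalize star a = A at *
    have hA : A = x * (x⁻¹ * X)⁻¹ * a * x⁻¹ := by rw [← hca']; group
    have h3 : A * X = x * ((x⁻¹ * X)⁻¹ * a * (x⁻¹ * X)) := by rw [hA]; group
    rw [h3, ← hac.inv_right.eq]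
    group
  have hkg : star g * (x * a) * g = x * a := by
    conv_rhs => rw [← hx1]
    rw [mul_assoc, mul_assoc x, hag.eq]
    group
  generalize x * a = k at hk hkg
  -- a hermitian matrix is of the form `bᴴ b`
  have hc' : (1⁻¹ * star k * 1) = k := by simp [hk]
  obtain ⟨b, hb, hcb⟩ := (isFrobeniusTwisted_twistedStar hq 1).exists_unit_mul_apply_eq
    (pow_pow_eq_of_star_eq hq) hl (congrArg Units.val hc')
  have hcb' : b * (1⁻¹ * star b * 1) = k := Units.ext hcb
  rw [inv_one, one_mul, mul_one] at hcb'
  have hbk := hb _ (Commute.refl _)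
  have hbb : star b * b = k := by
    have h3 : star b = b⁻¹ * k := by rw [← hcb']; group
    rw [h3, mul_assoc, ← hbk.eq]; group
  refine ⟨b * g * b⁻¹, ?_, isConj_iff.mpr ⟨b, rfl⟩⟩
  rw [star_mul, star_mul, star_inv]
  calc (star b)⁻¹ * (star g * star b) * (b * g * b⁻¹)
      = (star b)⁻¹ * (star g * (star b * b) * g) * b⁻¹ := by group
    _ = 1 := by rw [hbb, hkg, ← hbb]; group

end Descent

/-! ### The module of a matrix as a sum of cyclic modules -/

section CyclicModules

open Polynomial

variable {K : Type*} [Field K]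

/-- The direct sum of the cyclic modules `K[X] / (g i)`. -/
abbrev CyclicSum {ι : Type*} (g : ι → K[X]) : Type _ := ∀ i, K[X] ⧸ Ideal.span {g i}

theorem finrank_cyclicSum {m : ℕ} (g : Fin m → K[X]) (hg : ∀ i, g i ≠ 0) :
    Module.finrank K (CyclicSum g) = ∑ i, (g i).natDegree := by
  have : ∀ i, FiniteDimensional K (K[X] ⧸ Ideal.span {g i}) := fun i =>
    (AdjoinRoot.powerBasis (hg i)).finite
  rw [Module.finrank_pi_fintype]
  exact Finset.sum_congr rfl fun i _ => finrank_quotient_span_eq_natDegree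

/-- Multiplication by `f` on a `K[X]`-module, as a `K`-linear map. -/
noncomputable abbrev polyMul (K : Type*) [Field K] (M : Type*) [AddCommGroup M] [Module K M]
    [Module K[X] M] [IsScalarTower K K[X] M] (f : K[X]) : M →ₗ[K] M :=
  Algebra.lsmul K K M f

theorem polyMul_mk (f g y : K[X]) : polyMul K (K[X] ⧸ Ideal.span {g}) f
    (Ideal.Quotient.mk _ y) = Ideal.Quotient.mk _ (f * y) := rfl

theorem finrank_range_polyMul_mul {a b : K[X]} (ha : a ≠ 0) :
    Module.finrank K (LinearMap.range (polyMul K (K[X] ⧸ Ideal.span {a * b}) a)) =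
      Module.finrank K (K[X] ⧸ Ideal.span {b}) := by
  let L : K[X] →ₗ[K[X]] (K[X] ⧸ Ideal.span {a * b}) :=
    a • (Ideal.span {a * b}).mkQ
  have hker : LinearMap.ker L = Ideal.span {b} := by
    ext x
    simp only [L, LinearMap.mem_ker, LinearMap.smul_apply]
    rw [← map_smul, Submodule.mkQ_apply, Submodule.Quotient.mk_eq_zero, smul_eq_mul,
      Ideal.mem_span_singleton, Ideal.mem_span_singleton, mul_dvd_mul_iff_left ha]
  have hran : (LinearMap.range L).restrictScalars K =
      LinearMap.range (polyMul K (K[X] ⧸ Ideal.span {a * b}) a) := by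
    ext y
    constructor
    · rintro ⟨x, rfl⟩
      exact ⟨Submodule.mkQ _ x, rfl⟩
    · rintro ⟨x, rfl⟩
      obtain ⟨x, rfl⟩ := Submodule.mkQ_surjective _ x
      exact ⟨x, rfl⟩
  rw [← hran, ← hker]
  exact ((L.quotKerEquivRange).restrictScalars K).finrank_eq.symm

/-- The rank of `p ^ k` on `K[X] / (p' ^ e)`: its kernel has dimension `deg p * min k e` for `p' =
p`, and vanishes otherwise. -/
theorem finrank_range_polyMul_prime_pow {p p' : K[X]} (hp : p.Monic) (hpi : Irreducible p)
    (hp' : p'.Monic) (hpi' : Irreducible p') (k e : ℕ) [Decidable (p' = p)] :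
    Module.finrank K (LinearMap.range (polyMul K (K[X] ⧸ Ideal.span {p' ^ e}) (p ^ k))) +
      p.natDegree * (if p' = p then min k e else 0) = (p' ^ e).natDegree := by
  split_ifs with h
  · subst h
    rcases le_total k e with hke | hke
    · obtain ⟨j, rfl⟩ := Nat.exists_eq_add_of_le hke
      rw [pow_add, finrank_range_polyMul_mul (pow_ne_zero _ hp.ne_zero),
        finrank_quotient_span_eq_natDegree, ← pow_add, natDegree_pow, natDegree_pow,
        min_eq_left hke]
      ring
    · have : polyMul K (K[X] ⧸ Ideal.span {p' ^ e}) (p' ^ k) = 0 := by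
        refine LinearMap.ext fun x => ?_
        obtain ⟨x, rfl⟩ := Ideal.Quotient.mk_surjective x
        rw [polyMul_mk, LinearMap.zero_apply, Ideal.Quotient.eq_zero_iff_mem,
          Ideal.mem_span_singleton]
        exact (pow_dvd_pow _ hke).mul_right _
      rw [this, LinearMap.range_zero, finrank_bot, natDegree_pow, min_eq_right hke]
      ring
  · have hcop : IsCoprime (p ^ k) (p' ^ e) := by
      apply IsCoprime.pow
      rw [hpi.coprime_iff_not_dvd]
      intro hd
      have := (hpi.dvd_irreducible_iff_associated hpi').mp hd
      exact h (eq_of_monic_of_associated hp hp' this).symm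
    have : LinearMap.range (polyMul K (K[X] ⧸ Ideal.span {p' ^ e}) (p ^ k)) = ⊤ := by
      rw [LinearMap.range_eq_top]
      intro y
      obtain ⟨y, rfl⟩ := Ideal.Quotient.mk_surjective y
      obtain ⟨u, v, huv⟩ := hcop
      refine ⟨Ideal.Quotient.mk _ (u * y), ?_⟩
      rw [polyMul_mk, Ideal.Quotient.eq, Ideal.mem_span_singleton]
      exact ⟨-v * y, by linear_combination (y * huv)⟩
    rw [this, finrank_top, finrank_quotient_span_eq_natDegree]
    ring

theorem det_polyMul_X {f : K[X]} (hf : f.Monic) :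
    LinearMap.det (polyMul K (K[X] ⧸ Ideal.span {f}) X) = (-1) ^ f.natDegree * f.coeff 0 := by
  have h := Algebra.PowerBasis.norm_gen_eq_coeff_zero_minpoly (AdjoinRoot.powerBasis hf.ne_zero)
  rw [AdjoinRoot.powerBasis_gen, AdjoinRoot.minpoly_root hf.ne_zero, hf.leadingCoeff, inv_one,
    map_one, mul_one, AdjoinRoot.powerBasis_dim, Algebra.norm_apply] at h
  rw [← h]
  rfl

theorem LinearMap.det_pi_fin {m : ℕ} {M : Fin m → Type*} [∀ i, AddCommGroup (M i)]
    [∀ i, Module K (M i)] [∀ i, FiniteDimensional K (M i)] (f : ∀ i, M i →ₗ[K] M i) :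
    LinearMap.det (LinearMap.pi fun i => f i ∘ₗ LinearMap.proj i) = ∏ i, LinearMap.det (f i) := by
  induction m with
  | zero =>
    rw [Fin.prod_univ_zero, LinearMap.det_eq_one_of_subsingleton]
  | succ m ih =>
    rw [Fin.prod_univ_succ, ← ih, ← LinearMap.det_prodMap,
      ← LinearMap.det_conj _ (Fin.consLinearEquiv K M)]
    congr 1
    refine LinearMap.ext fun v => funext fun i => ?_
    exact Fin.cases (by simp) (fun i => by simp [Fin.tail]) i

theorem LinearMap.finrank_range_pi_fin {m : ℕ} {M : Fin m → Type*} [∀ i, AddCommGroup (M i)]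
    [∀ i, Module K (M i)] [∀ i, FiniteDimensional K (M i)] (f : ∀ i, M i →ₗ[K] M i) :
    Module.finrank K (LinearMap.range (LinearMap.pi fun i => f i ∘ₗ LinearMap.proj i)) =
      ∑ i, Module.finrank K (LinearMap.range (f i)) := by
  rw [← Module.finrank_pi_fintype]
  let ψ : (∀ i, LinearMap.range (f i)) →ₗ[K] (∀ i, M i) :=
    LinearMap.pi fun i => (LinearMap.range (f i)).subtype ∘ₗ LinearMap.proj i
  have hψ : Function.Injective ψ := fun v w hvw => funext fun i => Subtype.ext (congrFun hvw i)
  rw [← LinearMap.finrank_range_of_inj hψ]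
  have : LinearMap.range (LinearMap.pi fun i => f i ∘ₗ LinearMap.proj i) = LinearMap.range ψ := by
    ext v
    constructor
    · rintro ⟨w, rfl⟩
      exact ⟨fun i => ⟨f i (w i), w i, rfl⟩, rfl⟩
    · rintro ⟨w, rfl⟩
      choose u hu using fun i => (w i).2
      exact ⟨u, funext hu⟩
  rw [this]

/-- The `K[X]`-module defined by the matrix `A` is isomorphic to the direct sum of the cyclic
modules `K[X] / (g i)`. -/
def IsModel {n m : ℕ} (A : Matrix (Fin n) (Fin n) K) (g : Fin m → K[X]) : Prop :=
  ∃ φ : (Fin n → K) ≃ₗ[K] CyclicSum g, ∀ v, φ (A.mulVec v) = (X : K[X]) • φ v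

variable {n m : ℕ} {A : Matrix (Fin n) (Fin n) K} {g : Fin m → K[X]}

/-- An isomorphism that turns `A` into multiplication by `X` turns `f(A)` into multiplication by
`f`. -/
theorem apply_aeval_mulVec {M : Type*} [AddCommGroup M] [Module K M] [Module K[X] M]
    [IsScalarTower K K[X] M] {φ : (Fin n → K) ≃ₗ[K] M}
    (hφ : ∀ v, φ (A.mulVec v) = (X : K[X]) • φ v) (f : K[X]) (v : Fin n → K) :
    φ ((aeval A f).mulVec v) = f • φ v := by
  induction f using Polynomial.induction_on' generalizing v with
  | add p q hp hq => rw [map_add, Matrix.add_mulVec, map_add, hp, hq, add_smul]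
  | monomial k a =>
    induction k generalizing v with
    | zero =>
      rw [monomial_zero_left, aeval_C, Algebra.algebraMap_eq_smul_one, Matrix.smul_mulVec,
        Matrix.one_mulVec, map_smul, ← algebraMap_smul K[X] a (φ v)]
      rfl
    | succ k ih =>
      rw [← monomial_mul_X, map_mul, aeval_X, ← Matrix.mulVec_mulVec, ih, hφ, mul_smul]

theorem finiteDimensional_quotient_span {f : K[X]} (hf : f ≠ 0) :
    FiniteDimensional K (K[X] ⧸ Ideal.span {f}) :=
  (AdjoinRoot.powerBasis hf).finite

theorem IsModel.sum_natDegree (h : IsModel A g) (hg : ∀ i, g i ≠ 0) :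
    ∑ i, (g i).natDegree = n := by
  obtain ⟨φ, -⟩ := h
  rw [← finrank_cyclicSum g hg, ← φ.finrank_eq, Module.finrank_fin_fun]

theorem IsModel.rank_aeval (h : IsModel A g) (hg : ∀ i, g i ≠ 0) (f : K[X]) :
    (aeval A f).rank =
      ∑ i, Module.finrank K (LinearMap.range (polyMul K (K[X] ⧸ Ideal.span {g i}) f)) := by
  have := fun i => finiteDimensional_quotient_span (hg i)
  obtain ⟨φ, hφ⟩ := h
  rw [← LinearMap.finrank_range_pi_fin, Matrix.rank]
  have : LinearMap.range (LinearMap.pi fun i =>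
      polyMul K (K[X] ⧸ Ideal.span {g i}) f ∘ₗ LinearMap.proj i) =
      (LinearMap.range (aeval A f).mulVecLin).map (φ : (Fin n → K) →ₗ[K] CyclicSum g) := by
    ext v
    constructor
    · rintro ⟨w, rfl⟩
      refine ⟨(aeval A f).mulVec (φ.symm w), ⟨_, rfl⟩, ?_⟩
      have := apply_aeval_mulVec (M := CyclicSum g) hφ f (φ.symm w)
      rw [φ.apply_symm_apply] at this
      exact this
    · rintro ⟨_, ⟨w, rfl⟩, rfl⟩
      exact ⟨φ w, (apply_aeval_mulVec (M := CyclicSum g) hφ f w).symm⟩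
  rw [this, LinearEquiv.finrank_map_eq]

theorem IsModel.det (h : IsModel A g) (hg : ∀ i, (g i).Monic) :
    A.det = ∏ i, ((-1) ^ (g i).natDegree * (g i).coeff 0) := by
  have := fun i => finiteDimensional_quotient_span (hg i).ne_zero
  obtain ⟨φ, hφ⟩ := h
  simp_rw [← det_polyMul_X (hg _)]
  rw [← LinearMap.det_pi_fin, ← LinearMap.det_toLin', ← LinearMap.det_conj _ φ]
  congr 1
  refine LinearMap.ext fun v => ?_
  simp only [LinearMap.comp_apply, LinearEquiv.coe_coe, Matrix.toLin'_apply]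
  rw [hφ, φ.apply_symm_apply]
  rfl

theorem IsModel.exists_conj {m' : ℕ} {B : Matrix (Fin n) (Fin n) K} {g' : Fin m' → K[X]}
    (h : IsModel A g) (h' : IsModel B g') (σ : Fin m ≃ Fin m') (hσ : ∀ i, g' (σ i) = g i) :
    ∃ P : GL (Fin n) K, P * A = B * P := by
  obtain rfl : g = fun i => g' (σ i) := funext fun i => (hσ i).symm
  obtain ⟨φ, hφ⟩ := h
  obtain ⟨ψ, hψ⟩ := h'
  let e : CyclicSum (fun i => g' (σ i)) ≃ₗ[K[X]] CyclicSum g' :=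
    LinearEquiv.piCongrLeft K[X] (fun i => K[X] ⧸ Ideal.span {g' i}) σ
  let θ : (Fin n → K) ≃ₗ[K] (Fin n → K) := φ ≪≫ₗ (e.restrictScalars K) ≪≫ₗ ψ.symm
  have hθ : ∀ v, θ (A.mulVec v) = B.mulVec (θ v) := by
    intro v
    apply ψ.injective
    simp only [θ, LinearEquiv.trans_apply, LinearEquiv.apply_symm_apply, hφ, hψ,
      LinearEquiv.restrictScalars_apply, map_smul]
  refine ⟨⟨LinearMap.toMatrix' θ.toLinearMap, LinearMap.toMatrix' θ.symm.toLinearMap, ?_, ?_⟩, ?_⟩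
  · rw [← LinearMap.toMatrix'_comp]; simp
  · rw [← LinearMap.toMatrix'_comp]; simp
  · apply Matrix.toLin'.injective
    refine LinearMap.ext fun v => ?_
    simp only [Matrix.toLin'_mul, Matrix.toLin'_toMatrix', LinearMap.comp_apply,
      Matrix.toLin'_apply, LinearEquiv.coe_coe, hθ]

theorem exists_isModel (hg : ∀ i, g i ≠ 0) (hn : ∑ i, (g i).natDegree = n) :
    ∃ A : Matrix (Fin n) (Fin n) K, IsModel A g := by
  have := fun i => finiteDimensional_quotient_span (hg i)
  have φ : (Fin n → K) ≃ₗ[K] CyclicSum g :=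
    LinearEquiv.ofFinrankEq _ _ (by rw [finrank_cyclicSum g hg, hn, Module.finrank_fin_fun])
  refine ⟨LinearMap.toMatrix' (φ.symm.toLinearMap ∘ₗ polyMul K (CyclicSum g) X ∘ₗ φ.toLinearMap),
    φ, fun v => ?_⟩
  rw [← Matrix.toLin'_apply, Matrix.toLin'_toMatrix']
  simp

theorem exists_isModel_prime_pow (A : Matrix (Fin n) (Fin n) K) :
    ∃ (m : ℕ) (p : Fin m → K[X]) (e : Fin m → ℕ), (∀ i, (p i).Monic ∧ Irreducible (p i)) ∧
      (∀ i, 0 < e i) ∧ IsModel A fun i => p i ^ e i := by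
  classical
  let T := Matrix.toLin' A
  have htor : Module.IsTorsion K[X] (Module.AEval' T) :=
    Module.AEval.isTorsion_of_finiteDimensional K (Fin n → K) T
  obtain ⟨ι, _, p, hp, e, ⟨Φ⟩⟩ := Module.equiv_directSum_of_isTorsion htor
  -- summands with exponent `0` are zero modules and are dropped
  let σ := (Fintype.equivFin {i : ι // 0 < e i}).symm
  let Φ₂ : (DirectSum ι fun i => K[X] ⧸ Submodule.span K[X] {p i ^ e i}) ≃ₗ[K[X]]
      ∀ i, K[X] ⧸ Submodule.span K[X] {p i ^ e i} := DirectSum.linearEquivFunOnFintype K[X] ι _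
  let L : (∀ i, K[X] ⧸ Submodule.span K[X] {p i ^ e i}) →ₗ[K[X]]
      ∀ j, K[X] ⧸ Submodule.span K[X] {p (σ j).1 ^ e (σ j).1} :=
    LinearMap.pi fun j => LinearMap.proj (σ j).1
  have hsub : ∀ i, ¬ 0 < e i → Subsingleton (K[X] ⧸ Submodule.span K[X] {p i ^ e i}) := by
    intro i hi
    rw [Nat.eq_zero_of_not_pos hi, pow_zero]
    exact Ideal.Quotient.subsingleton_iff.mpr Ideal.span_singleton_one
  have hL : Function.Bijective L := by
    constructor
    · intro v w hvw
      funext i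
      by_cases hi : 0 < e i
      · have := congrFun hvw (σ.symm ⟨i, hi⟩)
        simp only [L, LinearMap.pi_apply, LinearMap.proj_apply] at this
        rwa [σ.apply_symm_apply] at this
      · exact (hsub i hi).elim _ _
    · intro w
      refine ⟨fun i => if hi : 0 < e i then
        cast (by rw [σ.apply_symm_apply]) (w (σ.symm ⟨i, hi⟩)) else 0, ?_⟩
      funext j
      simp only [L, LinearMap.pi_apply, LinearMap.proj_apply, (σ j).2, dif_pos]
      have : ∀ k (hk : k = j) h, cast h (w k) = w j := by
        rintro k rfl h; rfl
      exact this _ (σ.symm_apply_apply j) _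
  let Φ₃ := LinearEquiv.ofBijective L hL
  have hspan : ∀ i, Submodule.span K[X] {p i ^ e i} = Ideal.span {normalize (p i) ^ e i} := by
    intro i
    exact Ideal.span_singleton_eq_span_singleton.mpr
      ((normalize_associated (p i)).symm.pow_pow)
  let Φ₄ : (∀ j, K[X] ⧸ Submodule.span K[X] {p (σ j).1 ^ e (σ j).1}) ≃ₗ[K[X]]
      CyclicSum fun j => normalize (p (σ j).1) ^ e (σ j).1 :=
    LinearEquiv.piCongrRight fun j => Submodule.quotEquivOfEq _ _ (hspan _)
  let Ψ := Φ ≪≫ₗ Φ₂ ≪≫ₗ Φ₃ ≪≫ₗ Φ₄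
  refine ⟨_, fun j => normalize (p (σ j).1), fun j => e (σ j).1, fun j => ⟨?_, ?_⟩,
    fun j => (σ j).2, Module.AEval'.of T ≪≫ₗ Ψ.restrictScalars K, fun v => ?_⟩
  · exact monic_normalize (hp _).ne_zero
  · exact (normalize_associated _).symm.irreducible (hp _)
  · simp only [LinearEquiv.trans_apply, LinearEquiv.restrictScalars_apply]
    rw [← map_smul, Module.AEval'.X_smul_of, Matrix.toLin'_apply]

end CyclicModules

/-! ### Elementary divisors and conjugacy -/

section ElementaryDivisors

open Polynomial UniqueFactorizationMonoid

variable {K : Type*} [Field K] {n : ℕ}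

/-- The multiplicity of the monic irreducible polynomial `p` as a factor of `d`. -/
noncomputable def factorMult (p d : K[X]) : ℕ := by
  classical exact (normalizedFactors d).count p

theorem factorMult_prod {ι : Type*} {s : Finset ι} {p : ι → K[X]}
    (hp : ∀ x ∈ s, (p x).Monic ∧ Irreducible (p x)) (p₀ : K[X]) [DecidablePred fun x => p x = p₀] :
    factorMult p₀ (∏ x ∈ s, p x) = (s.filter fun x => p x = p₀).card := by
  classical
  rw [factorMult, Finset.prod_eq_multiset_prod, normalizedFactors_prod_eq]
  · rw [Multiset.map_map, Multiset.map_congr (g := p) rfl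
      (fun x hx => by exact (hp x hx).1.normalize_eq_self), Multiset.count_map]
    rw [Finset.card_def, Finset.filter_val]
    congr 1
    refine Multiset.filter_congr fun x _ => eq_comm
  · intro a ha
    obtain ⟨x, hx, rfl⟩ := Multiset.mem_map.mp ha
    exact (hp x hx).2

theorem Polynomial.Monic.eq_of_factorMult {f g : K[X]} (hf : f.Monic) (hg : g.Monic)
    (h : ∀ p : K[X], p.Monic → Irreducible p → factorMult p f = factorMult p g) : f = g := by
  classical
  have : normalizedFactors f = normalizedFactors g := by
    ext p
    by_cases hp : p.Monic ∧ Irreducible p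
    · exact h p hp.1 hp.2
    · have : ∀ d : K[X], d ≠ 0 → p ∉ normalizedFactors d := by
        intro d hd hpd
        refine hp ⟨?_, irreducible_of_normalized_factor p hpd⟩
        rw [← normalize_normalized_factor p hpd]
        exact monic_normalize (irreducible_of_normalized_factor p hpd).ne_zero
      rw [Multiset.count_eq_zero_of_notMem (this f hf.ne_zero),
        Multiset.count_eq_zero_of_notMem (this g hg.ne_zero)]
  rw [← hf.normalize_eq_self, ← hg.normalize_eq_self, ← prod_normalizedFactors_eq hf.ne_zero,
    ← prod_normalizedFactors_eq hg.ne_zero, this]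

/-- `d i` is the product of the monic irreducible polynomials `p`, with multiplicity, such that
`p ^ (i + 1)` is an elementary divisor of `A`. The exponents of the elementary divisors are at
most `n`, so the index set `Fin n` suffices. -/
def HasElemDiv (A : Matrix (Fin n) (Fin n) K) (d : Fin n → K[X]) : Prop :=
  ∃ (m : ℕ) (p : Fin m → K[X]) (e : Fin m → Fin n), (∀ x, (p x).Monic ∧ Irreducible (p x)) ∧
    IsModel A (fun x => p x ^ ((e x : ℕ) + 1)) ∧ ∀ i, d i = ∏ x with e x = i, p x

theorem exists_hasElemDiv (A : Matrix (Fin n) (Fin n) K) : ∃ d, HasElemDiv A d := by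
  obtain ⟨m, p, e, hp, he, h⟩ := exists_isModel_prime_pow A
  have hsum := h.sum_natDegree fun x => pow_ne_zero _ (hp x).1.ne_zero
  have hle : ∀ x, e x - 1 < n := by
    intro x
    have h1 : (p x ^ e x).natDegree ≤ n := by
      rw [← hsum]
      exact Finset.single_le_sum (f := fun x => (p x ^ e x).natDegree) (fun _ _ => Nat.zero_le _)
        (Finset.mem_univ x)
    rw [natDegree_pow] at h1
    have := (hp x).2.natDegree_pos
    have := he x
    nlinarith [Nat.sub_add_cancel (he x)]
  refine ⟨_, m, p, fun x => ⟨e x - 1, hle x⟩, hp, ?_, fun i => rfl⟩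
  simpa only [Nat.sub_add_cancel (he _)] using h

theorem HasElemDiv.monic {A : Matrix (Fin n) (Fin n) K} {d : Fin n → K[X]} (h : HasElemDiv A d)
    (i : Fin n) : (d i).Monic := by
  obtain ⟨m, p, e, hp, -, hd⟩ := h
  rw [hd]
  exact monic_prod_of_monic _ _ fun x _ => (hp x).1

theorem HasElemDiv.sum_natDegree {A : Matrix (Fin n) (Fin n) K} {d : Fin n → K[X]}
    (h : HasElemDiv A d) : ∑ i : Fin n, ((i : ℕ) + 1) * (d i).natDegree = n := by
  obtain ⟨m, p, e, hp, h, hd⟩ := h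
  have hsum := h.sum_natDegree fun x => pow_ne_zero _ (hp x).1.ne_zero
  conv_rhs => rw [← hsum, ← Finset.sum_fiberwise Finset.univ e]
  refine Finset.sum_congr rfl fun i _ => ?_
  rw [hd, natDegree_prod_of_monic _ _ fun x _ => (hp x).1, Finset.mul_sum]
  refine Finset.sum_congr rfl fun x hx => ?_
  rw [natDegree_pow, (Finset.mem_filter.mp hx).2]

/-- The ranks of the powers of `p₀(A)` in terms of the elementary divisors of `A`. -/
theorem HasElemDiv.rank_add {A : Matrix (Fin n) (Fin n) K} {d : Fin n → K[X]}
    (h : HasElemDiv A d) {p₀ : K[X]} (hp₀ : p₀.Monic) (hpi₀ : Irreducible p₀) (k : ℕ) :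
    (aeval A (p₀ ^ k)).rank +
      p₀.natDegree * ∑ i : Fin n, min k (i + 1) * factorMult p₀ (d i) = n := by
  classical
  obtain ⟨m, p, e, hp, h, hd⟩ := h
  have hne : ∀ x, p x ^ ((e x : ℕ) + 1) ≠ 0 := fun x => pow_ne_zero _ (hp x).1.ne_zero
  have hsum := h.sum_natDegree hne
  conv_rhs => rw [← hsum]
  simp_rw [← finrank_range_polyMul_prime_pow hp₀ hpi₀ (hp _).1 (hp _).2 k]
  rw [Finset.sum_add_distrib, ← h.rank_aeval hne, ← Finset.mul_sum,
    ← Finset.sum_fiberwise Finset.univ e]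
  congr 2
  refine Finset.sum_congr rfl fun i _ => ?_
  rw [hd, factorMult_prod fun x _ => hp x, mul_comm, ← smul_eq_mul, ← Finset.sum_const,
    Finset.sum_filter]
  refine Finset.sum_congr rfl fun x hx => ?_
  rw [(Finset.mem_filter.mp hx).2]

/-- The numbers `c i` are the second differences, up to sign, of `k ↦ ∑ i, min k (i + 1) * c i`. -/
theorem eq_of_forall_sum_min_mul_eq {c c' : Fin n → ℕ}
    (h : ∀ k, ∑ i : Fin n, min k ((i : ℕ) + 1) * c i =
      ∑ i : Fin n, min k ((i : ℕ) + 1) * c' i) : c = c' := by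
  have h1 : ∀ k : ℕ, ∑ i : Fin n, (if k ≤ i then c i else 0) =
      ∑ i : Fin n, (if k ≤ i then c' i else 0) := by
    intro k
    have hstep : ∀ c : Fin n → ℕ, ∑ i : Fin n, min (k + 1) (i + 1) * c i =
        ∑ i : Fin n, min k (i + 1) * c i + ∑ i : Fin n, (if k ≤ i then c i else 0) := by
      intro c
      rw [← Finset.sum_add_distrib]
      refine Finset.sum_congr rfl fun i _ => ?_
      split_ifs with hi
      · rw [min_eq_left (by omega), min_eq_left (by omega)]; ring
      · rw [min_eq_right (by omega), min_eq_right (by omega)]; ring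
    have := hstep c
    rw [h, h, hstep c'] at this
    omega
  funext j
  have hstep : ∀ c : Fin n → ℕ, ∑ i : Fin n, (if (j : ℕ) ≤ i then c i else 0) =
      ∑ i : Fin n, (if (j : ℕ) + 1 ≤ i then c i else 0) + c j := by
    intro c
    have hj : c j = ∑ i : Fin n, if j = i then c i else 0 := by simp
    rw [hj, ← Finset.sum_add_distrib]
    refine Finset.sum_congr rfl fun i _ => ?_
    simp only [Fin.ext_iff]
    split_ifs <;> omega
  have := hstep c
  rw [h1, h1, hstep c'] at this
  omega

theorem HasElemDiv.factorMult_eq {A B : Matrix (Fin n) (Fin n) K} {d d' : Fin n → K[X]}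
    (h : HasElemDiv A d) (h' : HasElemDiv B d') {p p' : K[X]} (hp : p.Monic) (hpi : Irreducible p)
    (hp' : p'.Monic) (hpi' : Irreducible p') (hdeg : p.natDegree = p'.natDegree)
    (hrank : ∀ k, (aeval A (p ^ k)).rank = (aeval B (p' ^ k)).rank) (i : Fin n) :
    factorMult p (d i) = factorMult p' (d' i) := by
  refine congrFun (eq_of_forall_sum_min_mul_eq (c := fun i => factorMult p (d i))
    (c' := fun i => factorMult p' (d' i)) fun k => ?_) i
  have h1 := (h.rank_add hp hpi k).trans (h'.rank_add hp' hpi' k).symm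
  rw [hrank, hdeg] at h1
  exact Nat.eq_of_mul_eq_mul_left hpi'.natDegree_pos (Nat.add_left_cancel h1)

/-- The elementary divisors of `A` are determined by the ranks of the matrices `f(A)`. -/
theorem HasElemDiv.eq_of_rank_eq {A B : Matrix (Fin n) (Fin n) K} {d d' : Fin n → K[X]}
    (h : HasElemDiv A d) (h' : HasElemDiv B d')
    (hrank : ∀ f : K[X], (aeval A f).rank = (aeval B f).rank) : d = d' :=
  funext fun i => (h.monic i).eq_of_factorMult (h'.monic i) fun _ hp hpi =>
    h.factorMult_eq h' hp hpi hp hpi rfl (fun _ => hrank _) i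

theorem HasElemDiv.exists_conj {A B : Matrix (Fin n) (Fin n) K} {d : Fin n → K[X]}
    (h : HasElemDiv A d) (h' : HasElemDiv B d) : ∃ P : GL (Fin n) K, P * A = B * P := by
  classical
  obtain ⟨m, p, e, hp, h, hd⟩ := h
  obtain ⟨m', p', e', hp', h', hd'⟩ := h'
  have hcard : ∀ c : K[X] × Fin n, Fintype.card {x // (p x, e x) = c} =
      Fintype.card {x // (p' x, e' x) = c} := by
    rintro ⟨p₀, i⟩
    have := hd i
    rw [hd'] at this
    have := congrArg (factorMult p₀) this
    rw [factorMult_prod fun x _ => hp x, factorMult_prod fun x _ => hp' x,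
      Finset.filter_filter, Finset.filter_filter] at this
    rw [Fintype.card_subtype, Fintype.card_subtype]
    simp only [Prod.mk.injEq, and_comm (b := _ = i)]
    exact this.symm
  let σ := Equiv.ofFiberEquiv fun c => Fintype.equivOfCardEq (hcard c)
  refine h.exists_conj h' σ fun x => ?_
  have : (p' (σ x), e' (σ x)) = (p x, e x) :=
    Equiv.ofFiberEquiv_map (g := fun x => (p' x, e' x)) (fun c => Fintype.equivOfCardEq (hcard c)) x
  rw [Prod.mk.injEq] at this
  rw [this.1, this.2]

theorem exists_hasElemDiv_eq {d : Fin n → K[X]} (hd : ∀ i, (d i).Monic)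
    (hn : ∑ i : Fin n, ((i : ℕ) + 1) * (d i).natDegree = n) :
    ∃ A : Matrix (Fin n) (Fin n) K, HasElemDiv A d := by
  classical
  let ι := Σ i : Fin n, Fin (normalizedFactors (d i)).toList.length
  let P : ι → K[X] := fun x => (normalizedFactors (d x.1)).toList.get x.2
  have hP : ∀ x, (P x).Monic ∧ Irreducible (P x) := by
    intro x
    have hx : P x ∈ normalizedFactors (d x.1) := Multiset.mem_toList.mp (List.get_mem _ _)
    have hirr := irreducible_of_normalized_factor _ hx
    refine ⟨?_, hirr⟩
    rw [← normalize_normalized_factor _ hx]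
    exact monic_normalize hirr.ne_zero
  have hprod : ∀ i, d i = ∏ x : ι with x.1 = i, P x := by
    intro i
    rw [Finset.prod_filter, Fintype.prod_sigma, Finset.prod_eq_single i]
    · simp only [if_true, P]
      have hl : ∀ l : List K[X], ∏ j : Fin l.length, l.get j = l.prod := fun l => by
        rw [← List.prod_ofFn, List.ofFn_get]
      rw [hl, Multiset.prod_toList, prod_normalizedFactors_eq (hd i).ne_zero,
        (hd i).normalize_eq_self]
    · intro j _ hj
      simp [hj]
    · simp
  let σ := (Fintype.equivFin ι).symm
  have hprod' : ∀ i, d i = ∏ x with (σ x).1 = i, P (σ x) := by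
    intro i
    rw [hprod]
    refine (Finset.prod_equiv σ ?_ ?_).symm <;> simp
  have hdeg : ∑ x, (P (σ x) ^ (((σ x).1 : ℕ) + 1)).natDegree = n := by
    refine Eq.trans ?_ hn
    rw [← Finset.sum_fiberwise Finset.univ fun x => (σ x).1]
    refine Finset.sum_congr rfl fun i _ => ?_
    rw [hprod', natDegree_prod_of_monic _ _ fun x _ => (hP _).1, Finset.mul_sum]
    refine Finset.sum_congr rfl fun x hx => ?_
    rw [natDegree_pow, (Finset.mem_filter.mp hx).2]
  obtain ⟨A, hA⟩ := exists_isModel (g := fun x => P (σ x) ^ (((σ x).1 : ℕ) + 1))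
    (fun x => pow_ne_zero _ (hP _).1.ne_zero) hdeg
  exact ⟨A, _, fun x => P (σ x), fun x => (σ x).1, fun x => hP _, hA, hprod'⟩

/-- The determinant of multiplication by `X` on `K[X] / (f)`, for monic `f`. -/
noncomputable def signedConst (f : K[X]) : K := (-1) ^ f.natDegree * f.coeff 0

theorem signedConst_mul {f g : K[X]} (hf : f ≠ 0) (hg : g ≠ 0) :
    signedConst (f * g) = signedConst f * signedConst g := by
  rw [signedConst, signedConst, signedConst, natDegree_mul hf hg, mul_coeff_zero, pow_add]
  ring

theorem signedConst_prod {ι : Type*} (s : Finset ι) (f : ι → K[X]) (hf : ∀ x, f x ≠ 0) :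
    signedConst (∏ x ∈ s, f x) = ∏ x ∈ s, signedConst (f x) := by
  classical
  induction s using Finset.induction_on with
  | empty => simp [signedConst]
  | insert a s ha ih =>
    rw [Finset.prod_insert ha, Finset.prod_insert ha,
      signedConst_mul (hf a) (Finset.prod_ne_zero_iff.mpr fun x _ => hf x), ih]

theorem HasElemDiv.det {A : Matrix (Fin n) (Fin n) K} {d : Fin n → K[X]}
    (h : HasElemDiv A d) : A.det = ∏ i : Fin n, signedConst (d i) ^ ((i : ℕ) + 1) := by
  obtain ⟨m, p, e, hp, h, hd⟩ := h
  rw [h.det fun x => (hp x).1.pow _, ← Finset.prod_fiberwise Finset.univ e]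
  refine Finset.prod_congr rfl fun i _ => ?_
  rw [hd, signedConst_prod _ _ fun x => (hp x).1.ne_zero, ← Finset.prod_pow]
  refine Finset.prod_congr rfl fun x hx => ?_
  rw [(Finset.mem_filter.mp hx).2, signedConst, natDegree_pow, coeff_zero_eq_eval_zero, eval_pow,
    ← coeff_zero_eq_eval_zero, mul_pow, pow_mul]
  ring

theorem aeval_transpose (A : Matrix (Fin n) (Fin n) K) (f : K[X]) :
    aeval A.transpose f = (aeval A f).transpose := by
  induction f using Polynomial.induction_on' with
  | add p q hp hq => rw [map_add, map_add, hp, hq, Matrix.transpose_add]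
  | monomial k a =>
    rw [aeval_monomial, aeval_monomial, Matrix.transpose_mul, Matrix.transpose_pow,
      (Algebra.commutes a _), Algebra.algebraMap_eq_smul_one, Matrix.transpose_smul,
      Matrix.transpose_one]

/-- Every matrix is similar to its transpose. -/
theorem exists_conj_transpose (A : Matrix (Fin n) (Fin n) K) :
    ∃ P : GL (Fin n) K, P * A = A.transpose * P := by
  obtain ⟨d, hd⟩ := exists_hasElemDiv A
  obtain ⟨d', hd'⟩ := exists_hasElemDiv A.transpose
  have : d = d' := by
    refine hd.eq_of_rank_eq hd' fun f => ?_
    rw [aeval_transpose, Matrix.rank_transpose]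
  subst this
  exact hd.exists_conj hd'

end ElementaryDivisors

/-! ### Twisted reciprocal polynomials and inversion -/

section TwistedReciprocal

open Polynomial UniqueFactorizationMonoid

variable {K : Type*} [Field K]

/-- The polynomial `p(0)⁻¹ X ^ deg p * p(α / X)`. For monic `p` with `p(0) ≠ 0` it is the monic
polynomial whose roots are the `α / r`, where `r` runs over the roots of `p`. -/
noncomputable def twistedRecip (α : Kˣ) (p : K[X]) : K[X] :=
  C (p.coeff 0)⁻¹ * (p.comp (C (α : K) * X)).reverse

variable {α : Kˣ} {p f g : K[X]}

theorem natDegree_comp_C_mul_X_unit (α : Kˣ) (p : K[X]) :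
    (p.comp (C (α : K) * X)).natDegree = p.natDegree := by
  rw [natDegree_comp, natDegree_C_mul_X _ α.ne_zero, mul_one]

theorem natDegree_twistedRecip (hp : p.coeff 0 ≠ 0) :
    (twistedRecip α p).natDegree = p.natDegree := by
  have h : (p.comp (C (α : K) * X)).coeff 0 ≠ 0 := by
    rw [comp_C_mul_X_coeff]; simpa using hp
  rw [twistedRecip, natDegree_C_mul (inv_ne_zero hp), reverse_natDegree,
    natDegree_comp_C_mul_X_unit, natTrailingDegree_eq_zero.mpr (Or.inr h), Nat.sub_zero]

theorem coeff_twistedRecip {j : ℕ} (hj : j ≤ p.natDegree) :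
    (twistedRecip α p).coeff j =
      (p.coeff 0)⁻¹ * (p.coeff (p.natDegree - j) * (α : K) ^ (p.natDegree - j)) := by
  rw [twistedRecip, coeff_C_mul, coeff_reverse, natDegree_comp_C_mul_X_unit, revAt_le hj,
    comp_C_mul_X_coeff]

theorem monic_twistedRecip (hp : p.coeff 0 ≠ 0) : (twistedRecip α p).Monic := by
  rw [Monic, leadingCoeff, natDegree_twistedRecip hp, coeff_twistedRecip le_rfl]
  simp [hp]

theorem coeff_zero_twistedRecip (hp : p.Monic) :
    (twistedRecip α p).coeff 0 = (p.coeff 0)⁻¹ * (α : K) ^ p.natDegree := by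
  rw [coeff_twistedRecip (Nat.zero_le _), Nat.sub_zero, hp.coeff_natDegree, one_mul]

theorem coeff_zero_twistedRecip_ne_zero (hp : p.Monic) (h0 : p.coeff 0 ≠ 0) :
    (twistedRecip α p).coeff 0 ≠ 0 := by
  rw [coeff_zero_twistedRecip hp]
  exact mul_ne_zero (inv_ne_zero h0) (pow_ne_zero _ α.ne_zero)

theorem twistedRecip_mul (f g : K[X]) :
    twistedRecip α (f * g) = twistedRecip α f * twistedRecip α g := by
  rw [twistedRecip, twistedRecip, twistedRecip, mul_comp, reverse_mul_of_domain, mul_coeff_zero,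
    mul_inv, C_mul]
  ring

theorem twistedRecip_one : twistedRecip α (1 : K[X]) = 1 := by
  have : reverse (1 : K[X]) = 1 := by rw [← C_1, reverse_C]
  simp [twistedRecip, this]

theorem twistedRecip_pow (f : K[X]) (k : ℕ) : twistedRecip α (f ^ k) = twistedRecip α f ^ k := by
  induction k with
  | zero => simp [twistedRecip_one]
  | succ k ih => rw [pow_succ, twistedRecip_mul, ih, pow_succ]

/-- The twisted reciprocal is an involution on monic polynomials with nonzero constant term. -/
theorem twistedRecip_twistedRecip (hp : p.Monic) (h0 : p.coeff 0 ≠ 0) :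
    twistedRecip α (twistedRecip α p) = p := by
  have h0' := coeff_zero_twistedRecip_ne_zero (α := α) hp h0
  have hd := natDegree_twistedRecip (α := α) h0
  ext j
  rcases le_or_gt j p.natDegree with hj | hj
  · rw [coeff_twistedRecip (by rwa [hd]), hd, coeff_twistedRecip (Nat.sub_le _ _),
      coeff_zero_twistedRecip hp, Nat.sub_sub_self hj]
    have : (α : K) ^ p.natDegree = (α : K) ^ j * (α : K) ^ (p.natDegree - j) := by
      rw [← pow_add, Nat.add_sub_cancel' hj]
    rw [this]
    have := pow_ne_zero j α.ne_zero
    have := pow_ne_zero (p.natDegree - j) α.ne_zero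
    field_simp
  · rw [coeff_eq_zero_of_natDegree_lt hj, coeff_eq_zero_of_natDegree_lt]
    rwa [natDegree_twistedRecip h0', hd]

theorem coeff_zero_ne_zero_of_mul (h : (f * g).coeff 0 ≠ 0) : f.coeff 0 ≠ 0 ∧ g.coeff 0 ≠ 0 := by
  rw [mul_coeff_zero] at h
  exact mul_ne_zero_iff.mp h

theorem irreducible_twistedRecip (hp : p.Monic) (h0 : p.coeff 0 ≠ 0) (hpi : Irreducible p) :
    Irreducible (twistedRecip α p) := by
  have hunit : ∀ f : K[X], f.coeff 0 ≠ 0 → IsUnit (twistedRecip α f) → IsUnit f := by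
    intro f hf hu
    have hd := natDegree_eq_zero_of_isUnit hu
    rw [natDegree_twistedRecip hf] at hd
    rw [eq_C_of_natDegree_eq_zero hd]
    exact isUnit_C.mpr (isUnit_iff_ne_zero.mpr hf)
  refine ⟨fun hu => hpi.not_isUnit (hunit p h0 hu), fun a b hab => ?_⟩
  have h0' := coeff_zero_twistedRecip_ne_zero (α := α) hp h0
  rw [hab] at h0'
  obtain ⟨ha, hb⟩ := coeff_zero_ne_zero_of_mul h0'
  have h2 : p = twistedRecip α a * twistedRecip α b := by
    rw [← twistedRecip_mul, ← hab, twistedRecip_twistedRecip hp h0]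
  exact (hpi.isUnit_or_isUnit h2).imp (hunit a ha) (hunit b hb)

theorem twistedRecip_dvd (h : f ∣ g) : twistedRecip α f ∣ twistedRecip α g := by
  obtain ⟨c, rfl⟩ := h
  exact ⟨_, twistedRecip_mul f c⟩

theorem factorMult_eq_of_dvd {p p' f f' : K[X]} (hp : p.Monic) (hpi : Irreducible p)
    (hp' : p'.Monic) (hpi' : Irreducible p') (hf : f ≠ 0) (hf' : f' ≠ 0)
    (h : ∀ k, p ^ k ∣ f ↔ p' ^ k ∣ f') : factorMult p f = factorMult p' f' := by
  classical
  have h1 := emultiplicity_eq_emultiplicity_iff.mpr h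
  rw [emultiplicity_eq_count_normalizedFactors hpi hf,
    emultiplicity_eq_count_normalizedFactors hpi' hf', hp.normalize_eq_self,
    hp'.normalize_eq_self] at h1
  exact_mod_cast h1

theorem factorMult_twistedRecip (hp : p.Monic) (h0 : p.coeff 0 ≠ 0) (hpi : Irreducible p)
    (hf : f.Monic) (hf0 : f.coeff 0 ≠ 0) :
    factorMult (twistedRecip α p) f = factorMult p (twistedRecip α f) := by
  refine factorMult_eq_of_dvd (monic_twistedRecip h0) (irreducible_twistedRecip hp h0 hpi) hp hpi
    hf.ne_zero (monic_twistedRecip hf0).ne_zero fun k => ?_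
  rw [← twistedRecip_pow]
  constructor <;> intro h
  · have := twistedRecip_dvd (α := α) h
    rwa [twistedRecip_twistedRecip (hp.pow k)] at this
    rw [coeff_zero_eq_eval_zero, eval_pow, ← coeff_zero_eq_eval_zero]
    exact pow_ne_zero k h0
  · have := twistedRecip_dvd (α := α) h
    rwa [twistedRecip_twistedRecip hf hf0] at this

theorem factorMult_X_eq_zero (hf : f.coeff 0 ≠ 0) : factorMult X f = 0 := by
  classical
  refine Multiset.count_eq_zero_of_notMem fun h => hf ?_
  exact X_dvd_iff.mp (dvd_of_mem_normalizedFactors h)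

theorem coeff_zero_ne_zero_of_irreducible (hp : p.Monic) (hpi : Irreducible p) (hX : p ≠ X) :
    p.coeff 0 ≠ 0 := by
  intro h
  have := (irreducible_X.dvd_irreducible_iff_associated hpi).mp (X_dvd_iff.mpr h)
  exact hX (eq_of_monic_of_associated monic_X hp this).symm

variable {n : ℕ} {A B : Matrix (Fin n) (Fin n) K}

theorem aeval_twistedRecip (hAB : A * B = (α : K) • (1 : Matrix (Fin n) (Fin n) K))
    (h0 : p.coeff 0 ≠ 0) :
    aeval A (twistedRecip α p) = ((p.coeff 0)⁻¹ • A ^ p.natDegree) * aeval B p := by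
  have hpow : ∀ j k : ℕ, A ^ (j + k) * B ^ j = (α : K) ^ j • A ^ k := by
    intro j
    induction j with
    | zero => simp
    | succ j ih =>
      intro k
      rw [pow_succ', ← mul_assoc, show j + 1 + k = (j + k) + 1 by ring, pow_succ,
        mul_assoc _ A, hAB,
        mul_smul_comm, mul_one, smul_mul_assoc, ih, smul_smul, pow_succ']
  rw [aeval_eq_sum_range, aeval_eq_sum_range, natDegree_twistedRecip h0, ← Finset.sum_range_reflect,
    Finset.mul_sum]
  refine Finset.sum_congr rfl fun j hj => ?_
  have hj' : j ≤ p.natDegree := Nat.lt_succ_iff.mp (Finset.mem_range.mp hj)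
  have h1 := hpow j (p.natDegree - j)
  rw [Nat.add_sub_cancel' hj'] at h1
  rw [show p.natDegree + 1 - 1 - j = p.natDegree - j by omega, coeff_twistedRecip (Nat.sub_le _ _),
    Nat.sub_sub_self hj', smul_mul_smul_comm, h1, smul_smul, mul_assoc]

theorem rank_aeval_twistedRecip (hAB : A * B = (α : K) • (1 : Matrix (Fin n) (Fin n) K))
    (h0 : p.coeff 0 ≠ 0) : (aeval A (twistedRecip α p)).rank = (aeval B p).rank := by
  rw [aeval_twistedRecip hAB h0]
  refine Matrix.rank_mul_eq_right_of_isUnit_det _ _ ?_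
  have hA : IsUnit A.det := by
    have := congrArg Matrix.det hAB
    rw [Matrix.det_mul, Matrix.det_smul, Matrix.det_one, mul_one] at this
    refine isUnit_of_mul_isUnit_left (y := B.det) ?_
    rw [this]
    exact (α.isUnit).pow _
  rw [Matrix.det_smul, Matrix.det_pow]
  exact ((isUnit_iff_ne_zero.mpr (inv_ne_zero h0)).pow _).mul (hA.pow _)

theorem HasElemDiv.coeff_zero_ne_zero {d : Fin n → K[X]} (h : HasElemDiv A d) (hA : A.det ≠ 0)
    (i : Fin n) : (d i).coeff 0 ≠ 0 := by
  rw [h.det] at hA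
  have := (Finset.prod_ne_zero_iff.mp hA) i (Finset.mem_univ i)
  exact right_ne_zero_of_mul (ne_zero_pow (Nat.succ_ne_zero _) this)

/-- Passing from `A` to `α A⁻¹` replaces the elementary divisors by their `α`-twisted reciprocals.
-/
theorem HasElemDiv.twistedRecip {d : Fin n → K[X]} (h : HasElemDiv A d)
    (hAB : A * B = (α : K) • (1 : Matrix (Fin n) (Fin n) K)) :
    HasElemDiv B fun i => twistedRecip α (d i) := by
  have hdet : A.det * B.det ≠ 0 := by
    rw [← Matrix.det_mul, hAB, Matrix.det_smul, Matrix.det_one, mul_one]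
    exact pow_ne_zero _ α.ne_zero
  have h0 := h.coeff_zero_ne_zero (left_ne_zero_of_mul hdet)
  obtain ⟨d', h'⟩ := exists_hasElemDiv B
  have h0' := h'.coeff_zero_ne_zero (right_ne_zero_of_mul hdet)
  have : (fun i => _root_.twistedRecip α (d i)) = d' := by
    funext i
    refine (monic_twistedRecip (h0 i)).eq_of_factorMult (h'.monic i) fun p hp hpi => ?_
    -- `X` has no twisted reciprocal of its own degree, but it divides no elementary divisor
    by_cases hX : p = X
    · rw [hX, factorMult_X_eq_zero (h0' i), factorMult_X_eq_zero
        (coeff_zero_twistedRecip_ne_zero (h.monic i) (h0 i))]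
    · have hp0 := coeff_zero_ne_zero_of_irreducible hp hpi hX
      rw [← factorMult_twistedRecip hp hp0 hpi (h.monic i) (h0 i)]
      refine h.factorMult_eq h' (monic_twistedRecip hp0) (irreducible_twistedRecip hp hp0 hpi)
        hp hpi (natDegree_twistedRecip hp0) (fun k => ?_) i
      rw [← twistedRecip_pow, rank_aeval_twistedRecip hAB]
      rw [coeff_zero_eq_eval_zero, eval_pow, ← coeff_zero_eq_eval_zero]
      exact pow_ne_zero k hp0
  rw [this]
  exact h'

end TwistedReciprocal

/-! ### Twisted real classes -/

section TwistedReal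

/-- The conjugacy classes of `G` that are stable under `g ↦ z * g⁻¹`. -/
def twistedReal {G : Type*} [Group G] (z : G) : Set (ConjClasses G) :=
  {c | ∀ g ∈ c.carrier, z * g⁻¹ ∈ c.carrier}

theorem realClasses_eq_twistedReal (G : Type*) [Group G] :
    realClasses G = twistedReal (1 : G) := by
  simp [realClasses, twistedReal]

theorem mem_carrier_mk {G : Type*} [Group G] {g h : G} :
    h ∈ (ConjClasses.mk g).carrier ↔ IsConj g h := by
  rw [ConjClasses.mem_carrier_iff_mk_eq, ConjClasses.mk_eq_mk_iff_isConj, isConj_comm]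

theorem mk_mem_twistedReal {G : Type*} [Group G] {z : G} (hz : z ∈ Subgroup.center G) {g : G} :
    ConjClasses.mk g ∈ twistedReal z ↔ IsConj g (z * g⁻¹) := by
  constructor
  · intro h
    exact mem_carrier_mk.mp (h g ConjClasses.mem_carrier_mk)
  · intro h k hk
    rw [mem_carrier_mk] at hk ⊢
    refine h.trans ?_
    obtain ⟨x, rfl⟩ := isConj_iff.mp hk
    refine isConj_iff.mpr ⟨x, ?_⟩
    rw [← mul_assoc, Subgroup.mem_center_iff.mp hz x]
    group

end TwistedReal

/-! ### Classes of the general linear group by elementary divisors -/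

section Parametrization

open Polynomial

variable {K : Type*} [Field K] {n : ℕ}

/-- The sequences of monic polynomials that occur as elementary divisors, in the sense of
`HasElemDiv`, of an invertible matrix of size `n`. -/
def elemDivSet (n : ℕ) (K : Type*) [Field K] : Set (Fin n → K[X]) :=
  {d | (∀ i, (d i).Monic ∧ (d i).coeff 0 ≠ 0) ∧ ∑ i : Fin n, ((i : ℕ) + 1) * (d i).natDegree = n}

theorem SemiconjBy.aeval_right {R : Type*} [Ring R] [Algebra K R] {x a b : R}
    (h : SemiconjBy x a b) (f : K[X]) : SemiconjBy x (aeval a f) (aeval b f) := by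
  induction f using Polynomial.induction_on' with
  | add p q hp hq => rw [map_add, map_add]; exact hp.add_right hq
  | monomial k c =>
    rw [aeval_monomial, aeval_monomial]
    exact SemiconjBy.mul_right (Algebra.commutes c x).symm (h.pow_right k)

theorem isConj_iff_of_hasElemDiv {g h : GL (Fin n) K} {d d' : Fin n → K[X]}
    (hd : HasElemDiv (g : Matrix (Fin n) (Fin n) K) d)
    (hd' : HasElemDiv (h : Matrix (Fin n) (Fin n) K) d') : IsConj g h ↔ d = d' := by
  constructor
  · intro hc
    obtain ⟨x, hx⟩ := isConj_iff.mp hc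
    have hx' : SemiconjBy (x : Matrix (Fin n) (Fin n) K) g h :=
      congrArg Units.val (mul_inv_eq_iff_eq_mul.mp hx)
    have hdet : IsUnit (x : Matrix (Fin n) (Fin n) K).det :=
      (Matrix.isUnit_iff_isUnit_det _).mp x.isUnit
    refine hd.eq_of_rank_eq hd' fun f => ?_
    rw [← Matrix.rank_mul_eq_right_of_isUnit_det _ _ hdet, (hx'.aeval_right f).eq,
      Matrix.rank_mul_eq_left_of_isUnit_det _ _ hdet]
  · rintro rfl
    obtain ⟨P, hP⟩ := hd.exists_conj hd'
    exact isConj_iff.mpr ⟨P, by rw [mul_inv_eq_iff_eq_mul]; exact Units.ext hP⟩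

/-- The sequence of products of elementary divisors of a conjugacy class of `GL(n, K)`. -/
noncomputable def ConjClasses.elemDiv : ConjClasses (GL (Fin n) K) → Fin n → K[X] :=
  Quotient.lift (fun g => (exists_hasElemDiv (g : Matrix (Fin n) (Fin n) K)).choose)
    fun _ _ h => (isConj_iff_of_hasElemDiv (exists_hasElemDiv _).choose_spec
      (exists_hasElemDiv _).choose_spec).mp h

theorem ConjClasses.elemDiv_mk {g : GL (Fin n) K} {d : Fin n → K[X]}
    (hd : HasElemDiv (g : Matrix (Fin n) (Fin n) K) d) : (ConjClasses.mk g).elemDiv = d :=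
  (isConj_iff_of_hasElemDiv (exists_hasElemDiv _).choose_spec hd).mp (IsConj.refl g)

theorem ConjClasses.elemDiv_injective :
    Function.Injective (elemDiv : ConjClasses (GL (Fin n) K) → Fin n → K[X]) := by
  intro c c' h
  obtain ⟨g, rfl⟩ := ConjClasses.exists_rep c
  obtain ⟨g', rfl⟩ := ConjClasses.exists_rep c'
  obtain ⟨d, hd⟩ := exists_hasElemDiv (g : Matrix (Fin n) (Fin n) K)
  obtain ⟨d', hd'⟩ := exists_hasElemDiv (g' : Matrix (Fin n) (Fin n) K)
  rw [elemDiv_mk hd, elemDiv_mk hd'] at h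
  exact ConjClasses.mk_eq_mk_iff_isConj.mpr ((isConj_iff_of_hasElemDiv hd hd').mpr h)

theorem HasElemDiv.mem_elemDivSet {g : GL (Fin n) K} {d : Fin n → K[X]}
    (hd : HasElemDiv (g : Matrix (Fin n) (Fin n) K) d) : d ∈ elemDivSet n K :=
  ⟨fun i => ⟨hd.monic i, hd.coeff_zero_ne_zero
    (by simpa using (Matrix.GeneralLinearGroup.det g).ne_zero) i⟩, hd.sum_natDegree⟩

theorem exists_GL_hasElemDiv {d : Fin n → K[X]} (hd : d ∈ elemDivSet n K) :
    ∃ g : GL (Fin n) K, HasElemDiv (g : Matrix (Fin n) (Fin n) K) d := by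
  obtain ⟨A, hA⟩ := exists_hasElemDiv_eq (fun i => (hd.1 i).1) hd.2
  have : A.det ≠ 0 := by
    rw [hA.det]
    refine Finset.prod_ne_zero_iff.mpr fun i _ => pow_ne_zero _ (mul_ne_zero ?_ (hd.1 i).2)
    exact pow_ne_zero _ (neg_ne_zero.mpr one_ne_zero)
  exact ⟨Matrix.GeneralLinearGroup.mkOfDetNeZero A this, hA⟩

theorem mk_mem_twistedReal_scalar {α : Kˣ} {g : GL (Fin n) K} {d : Fin n → K[X]}
    (hd : HasElemDiv (g : Matrix (Fin n) (Fin n) K) d) :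
    ConjClasses.mk g ∈ twistedReal (Matrix.GeneralLinearGroup.scalar (Fin n) α) ↔
      ∀ i, twistedRecip α (d i) = d i := by
  rw [mk_mem_twistedReal (by rw [Matrix.GeneralLinearGroup.center_eq_range_scalar]; exact ⟨α, rfl⟩),
    isConj_iff_of_hasElemDiv hd (hd.twistedRecip (α := α) ?_), funext_iff]
  · exact forall_congr' fun i => eq_comm
  · rw [← Units.val_mul, ← mul_assoc, ← Matrix.GeneralLinearGroup.scalar_commute, mul_assoc,
      mul_inv_cancel, mul_one, Matrix.GeneralLinearGroup.coe_scalar, Matrix.scalar_apply,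
      Matrix.smul_one_eq_diagonal]

/-- The classes of `GL(n, K)` that are stable under `g ↦ α g⁻¹` correspond to the sequences of
polynomials that are equal to their `α`-twisted reciprocals. -/
theorem ncard_twistedReal_scalar (α : Kˣ) :
    (twistedReal (Matrix.GeneralLinearGroup.scalar (Fin n) α)).ncard =
      {d | d ∈ elemDivSet n K ∧ ∀ i, twistedRecip α (d i) = d i}.ncard := by
  rw [← Set.ncard_image_of_injective _ ConjClasses.elemDiv_injective]
  congr 1
  ext d
  constructor
  · rintro ⟨c, hc, rfl⟩
    obtain ⟨g, rfl⟩ := ConjClasses.exists_rep c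
    obtain ⟨d, hd⟩ := exists_hasElemDiv (g : Matrix (Fin n) (Fin n) K)
    rw [ConjClasses.elemDiv_mk hd]
    exact ⟨hd.mem_elemDivSet, (mk_mem_twistedReal_scalar hd).mp hc⟩
  · rintro ⟨hd, hα⟩
    obtain ⟨g, hg⟩ := exists_GL_hasElemDiv hd
    exact ⟨ConjClasses.mk g, (mk_mem_twistedReal_scalar hg).mpr hα, ConjClasses.elemDiv_mk hg⟩

theorem mk_carrier_subset_specialLinear {g : GL (Fin n) K} :
    (ConjClasses.mk g).carrier ⊆ (specialLinear n K : Set (GL (Fin n) K)) ↔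
      Matrix.GeneralLinearGroup.det g = 1 := by
  constructor
  · intro h
    exact h ConjClasses.mem_carrier_mk
  · intro h k hk
    obtain ⟨x, rfl⟩ := isConj_iff.mp (mem_carrier_mk.mp hk)
    change Matrix.GeneralLinearGroup.det _ = 1
    rw [map_mul, map_mul, h, map_inv]
    simp

theorem ncard_realClassesIn_specialLinear :
    (realClassesIn (specialLinear n K)).ncard =
      {d | (d ∈ elemDivSet n K ∧ ∀ i, twistedRecip 1 (d i) = d i) ∧
        ∏ i : Fin n, signedConst (d i) ^ ((i : ℕ) + 1) = 1}.ncard := by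
  rw [← Set.ncard_image_of_injective _ ConjClasses.elemDiv_injective]
  congr 1
  have h1 : realClasses (GL (Fin n) K) =
      twistedReal (Matrix.GeneralLinearGroup.scalar (Fin n) 1) := by
    rw [map_one, realClasses_eq_twistedReal]
  have hdet : ∀ (g : GL (Fin n) K) d, HasElemDiv (g : Matrix (Fin n) (Fin n) K) d →
      (Matrix.GeneralLinearGroup.det g = 1 ↔
        ∏ i : Fin n, signedConst (d i) ^ ((i : ℕ) + 1) = 1) := by
    intro g d hd
    rw [← hd.det, Units.ext_iff]
    rfl
  ext d
  constructor
  · rintro ⟨c, ⟨hc, hc'⟩, rfl⟩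
    obtain ⟨g, rfl⟩ := ConjClasses.exists_rep c
    obtain ⟨d, hd⟩ := exists_hasElemDiv (g : Matrix (Fin n) (Fin n) K)
    rw [ConjClasses.elemDiv_mk hd]
    rw [h1] at hc
    rw [mk_carrier_subset_specialLinear, hdet g d hd] at hc'
    exact ⟨⟨hd.mem_elemDivSet, (mk_mem_twistedReal_scalar hd).mp hc⟩, hc'⟩
  · rintro ⟨⟨hd, hα⟩, hdet'⟩
    obtain ⟨g, hg⟩ := exists_GL_hasElemDiv hd
    refine ⟨ConjClasses.mk g, ⟨?_, ?_⟩, ConjClasses.elemDiv_mk hg⟩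
    · rw [h1]; exact (mk_mem_twistedReal_scalar hg).mpr hα
    · rw [mk_carrier_subset_specialLinear, hdet g d hg]; exact hdet'

end Parametrization

/-! ### Counting self-reciprocal polynomials -/

section SelfReciprocal

open Polynomial

variable {F : Type*} [Field F]

/-- The monic polynomials of degree `m` with nonzero constant term that are equal to their
`α`-twisted reciprocal. -/
def selfRecip (α : Fˣ) (m : ℕ) : Set F[X] :=
  {f | f.Monic ∧ f.coeff 0 ≠ 0 ∧ f.natDegree = m ∧ twistedRecip α f = f}

theorem selfRecip_zero (α : Fˣ) : selfRecip α 0 = {1} := by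
  ext f
  constructor
  · rintro ⟨h1, -, h2, -⟩
    exact h1.natDegree_eq_zero.mp h2
  · rintro rfl
    exact ⟨monic_one, by simp, natDegree_one, twistedRecip_one⟩

/-- Self-reciprocality in terms of coefficients: the coefficients of index at most `m / 2`
determine the others, and only the middle one is constrained. -/
theorem mem_selfRecip_iff {α : Fˣ} {m : ℕ} {f : F[X]} :
    f ∈ selfRecip α m ↔ f.coeff m = 1 ∧ f.coeff 0 ≠ 0 ∧ (∀ j, m < j → f.coeff j = 0) ∧
      ∀ j ≤ m, f.coeff 0 * f.coeff j = f.coeff (m - j) * (α : F) ^ (m - j) := by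
  constructor
  · rintro ⟨h1, h0, rfl, h3⟩
    refine ⟨h1.coeff_natDegree, h0, fun j => coeff_eq_zero_of_natDegree_lt, fun j hj => ?_⟩
    conv_lhs => rw [← h3]
    rw [coeff_twistedRecip hj, h3, mul_inv_cancel_left₀ h0]
  · rintro ⟨h1, h0, h2, h3⟩
    have hm : f.Monic := monic_of_natDegree_le_of_coeff_eq_one m
      (natDegree_le_iff_coeff_eq_zero.mpr h2) h1
    have hd : f.natDegree = m := le_antisymm (natDegree_le_iff_coeff_eq_zero.mpr h2)
      (le_natDegree_of_ne_zero (by rw [h1]; exact one_ne_zero))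
    refine ⟨hm, h0, hd, ?_⟩
    subst hd
    ext j
    rcases le_or_gt j f.natDegree with hj | hj
    · rw [coeff_twistedRecip hj, ← h3 j hj, inv_mul_cancel_left₀ h0]
    · rw [h2 j hj, coeff_eq_zero_of_natDegree_lt]
      rwa [natDegree_twistedRecip h0]

theorem sq_coeff_zero_of_mem_selfRecip {α : Fˣ} {m : ℕ} {f : F[X]} (hf : f ∈ selfRecip α m) :
    f.coeff 0 ^ 2 = (α : F) ^ m := by
  rw [mem_selfRecip_iff] at hf
  have := hf.2.2.2 0 (Nat.zero_le _)
  rw [Nat.sub_zero, hf.1, one_mul] at this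
  rw [sq, this]

/-- The possible values of the middle coefficient of a polynomial in `selfRecip α m` with constant
term `ε`. For odd `m` there is no middle coefficient, and the set is the singleton `{0}`. -/
def middleCoeff (α : Fˣ) (m : ℕ) (ε : F) : Set F :=
  {x | m % 2 = 0 ∧ ε * x = x * (α : F) ^ (m / 2) ∨ m % 2 = 1 ∧ x = 0}

/-- A self-reciprocal polynomial of degree `m` with constant term `ε` is determined by its
coefficients of index `1, …, (m - 1) / 2`, which are arbitrary, and by its middle coefficient if
`m` is even. -/
theorem ncard_selfRecip_fiber [Fintype F] {α : Fˣ} {m : ℕ} (hm : 0 < m) {ε : F}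
    (hε : ε ^ 2 = (α : F) ^ m) :
    {f | f ∈ selfRecip α m ∧ f.coeff 0 = ε}.ncard =
      Fintype.card F ^ ((m - 1) / 2) * (middleCoeff α m ε).ncard := by
  classical
  have hε0 : ε ≠ 0 := by
    rintro rfl
    exact pow_ne_zero m α.ne_zero (by rw [← hε]; simp)
  have hα : ∀ j, (α : F) ^ j ≠ 0 := fun j => pow_ne_zero j α.ne_zero
  let k := (m - 1) / 2
  -- the lower half of the coefficients, and the middle one, which is `0` by convention for odd `m`
  let φ : F[X] → (Fin k → F) × F := fun f =>
    (fun j => f.coeff (j + 1), if m % 2 = 0 then f.coeff (m / 2) else 0)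
  have hbij : Set.BijOn φ {f | f ∈ selfRecip α m ∧ f.coeff 0 = ε}
      (Set.univ ×ˢ middleCoeff α m ε) := by
    refine ⟨?_, ?_, ?_⟩
    · rintro f ⟨hf, rfl⟩
      rw [mem_selfRecip_iff] at hf
      refine ⟨trivial, ?_⟩
      simp only [φ]
      rcases Nat.mod_two_eq_zero_or_one m with h | h
      · rw [if_pos h]
        refine Or.inl ⟨h, ?_⟩
        have := hf.2.2.2 (m / 2) (Nat.div_le_self _ _)
        rwa [show m - m / 2 = m / 2 by omega] at this
      · rw [if_neg (by omega)]
        exact Or.inr ⟨h, rfl⟩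
    · rintro f ⟨hf, hf0⟩ g ⟨hg, hg0⟩ hfg
      rw [mem_selfRecip_iff] at hf hg
      obtain ⟨h1, h2⟩ := Prod.mk.inj hfg
      have hlow : ∀ j, 2 * j ≤ m → f.coeff j = g.coeff j := by
        intro j hj
        rcases Nat.eq_zero_or_pos j with rfl | hj0
        · rw [hf0, hg0]
        · rcases lt_or_eq_of_le hj with hlt | heq
          · have := congrFun h1 ⟨j - 1, by simp only [k]; omega⟩
            simpa [Nat.sub_add_cancel hj0] using this
          · rw [if_pos (by omega), if_pos (by omega), show m / 2 = j by omega] at h2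
            exact h2
      ext j
      rcases le_or_gt (2 * j) m with hj | hj
      · exact hlow j hj
      rcases le_or_gt j m with hjm | hjm
      · have e1 := hf.2.2.2 j hjm
        have e2 := hg.2.2.2 j hjm
        rw [hf0, hlow (m - j) (by omega)] at e1
        rw [hg0, ← e1] at e2
        exact (mul_left_cancel₀ hε0 e2).symm
      · rw [hf.2.2.1 j hjm, hg.2.2.1 j hjm]
    · rintro ⟨h, x⟩ ⟨-, hx⟩
      let c : ℕ → F := fun j => if hj0 : j = 0 then ε else
        if hj : 2 * j < m then h ⟨j - 1, by simp only [k]; omega⟩ else x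
      let f : F[X] := ∑ j ∈ Finset.range (m + 1),
        C (if 2 * j ≤ m then c j else ε⁻¹ * (c (m - j) * (α : F) ^ (m - j))) * X ^ j
      have hf : ∀ j, f.coeff j = if j ≤ m then
          (if 2 * j ≤ m then c j else ε⁻¹ * (c (m - j) * (α : F) ^ (m - j))) else 0 := by
        intro j
        simp only [f, finsetSum_coeff, coeff_C_mul_X_pow, Finset.sum_ite_eq, Finset.mem_range,
          Nat.lt_succ_iff]
      have hf0 : f.coeff 0 = ε := by rw [hf]; simp [c]
      have hcmid : m % 2 = 0 → c (m / 2) = x := by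
        intro h2
        simp only [c]
        rw [dif_neg (by omega), dif_neg (by omega)]
      refine ⟨f, ⟨mem_selfRecip_iff.mpr ⟨?_, ?_, ?_, ?_⟩, hf0⟩, ?_⟩
      · rw [hf, if_pos le_rfl, if_neg (by omega), Nat.sub_self]
        simp [c, hε0]
      · rwa [hf0]
      · intro j hj
        rw [hf, if_neg (by omega)]
      · intro j hj
        rw [hf0, hf j, hf (m - j), if_pos hj, if_pos (Nat.sub_le _ _), Nat.sub_sub_self hj]
        rcases lt_trichotomy (2 * j) m with h2 | h2 | h2
        · rw [if_pos h2.le, if_neg (by omega)]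
          have : ε ^ 2 = (α : F) ^ j * (α : F) ^ (m - j) := by
            rw [hε, ← pow_add, Nat.add_sub_cancel' hj]
          field_simp
          linear_combination c j * this
        · rw [if_pos h2.le, if_pos (by omega), show m - j = m / 2 by omega,
            show j = m / 2 by omega, hcmid (by omega)]
          rcases hx with ⟨-, hx⟩ | ⟨h3, -⟩
          · exact hx
          · omega
        · rw [if_neg (by omega), if_pos (by omega), mul_inv_cancel_left₀ hε0]
      · refine Prod.ext (funext fun j => ?_) ?_
        · have hj := j.2
          simp only [k] at hj
          change f.coeff (j + 1) = h j
          rw [hf, if_pos (by omega), if_pos (by omega)]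
          simp only [c]
          rw [dif_neg (by omega), dif_pos (by omega)]
          rfl
        · change (if m % 2 = 0 then f.coeff (m / 2) else 0) = x
          split_ifs with h2
          · rw [hf, if_pos (by omega), if_pos (by omega), hcmid h2]
          · rcases hx with ⟨h3, -⟩ | ⟨-, h3⟩
            · exact absurd h3 h2
            · exact h3.symm
  rw [← hbij.injOn.ncard_image, hbij.image_eq, Set.ncard_prod, Set.ncard_univ,
    Nat.card_eq_fintype_card, Fintype.card_fun, Fintype.card_fin]

theorem ncard_middleCoeff_odd {α : Fˣ} {m : ℕ} (hm : m % 2 = 1) (ε : F) :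
    (middleCoeff α m ε).ncard = 1 := by
  have : middleCoeff α m ε = {0} := by
    ext x
    simp [middleCoeff, hm]
  rw [this, Set.ncard_singleton]

theorem ncard_middleCoeff_even [Fintype F] {α : Fˣ} {m : ℕ} (hm : m % 2 = 0) (ε : F)
    [Decidable (ε = (α : F) ^ (m / 2))] : (middleCoeff α m ε).ncard =
      if ε = (α : F) ^ (m / 2) then Fintype.card F else 1 := by
  split_ifs with h
  · have : middleCoeff α m ε = Set.univ := by
      ext x
      simp [middleCoeff, hm, h, mul_comm]
    rw [this, Set.ncard_univ, Nat.card_eq_fintype_card]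
  · have : middleCoeff α m ε = {0} := by
      ext x
      simp only [middleCoeff, hm, true_and, Set.mem_ofPred_eq, Set.mem_singleton_iff]
      rw [mul_comm ε, mul_eq_mul_left_iff]
      simp [h]
    rw [this, Set.ncard_singleton]

theorem finite_selfRecip [Finite F] (α : Fˣ) (m : ℕ) : (selfRecip α m).Finite := by
  have : Finite (degreeLT F (m + 1)) := Module.finite_of_finite F
  refine Set.Finite.subset (Set.toFinite (degreeLT F (m + 1) : Set F[X])) ?_
  rintro f ⟨hf, -, rfl, -⟩
  exact mem_degreeLT.mpr (by rw [degree_eq_natDegree hf.ne_zero]; exact_mod_cast Nat.lt_succ_self _)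

/-- `selfRecip α m` as a finset. -/
noncomputable def selfRecipFinset [Finite F] (α : Fˣ) (m : ℕ) : Finset F[X] :=
  (finite_selfRecip α m).toFinset

theorem mem_selfRecipFinset [Finite F] {α : Fˣ} {m : ℕ} {f : F[X]} :
    f ∈ selfRecipFinset α m ↔ f ∈ selfRecip α m := Set.Finite.mem_toFinset _

theorem sum_selfRecipFinset [Fintype F] [DecidableEq F] (α : Fˣ) {m : ℕ} (hm : 0 < m) (w : F → ℚ) :
    ∑ f ∈ selfRecipFinset α m, w (f.coeff 0) = ∑ ε : F with ε ^ 2 = (α : F) ^ m,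
      ((Fintype.card F ^ ((m - 1) / 2) * (middleCoeff α m ε).ncard : ℕ) : ℚ) * w ε := by
  rw [← Finset.sum_fiberwise_of_maps_to (t := Finset.univ.filter fun ε : F => ε ^ 2 = (α : F) ^ m)
    (g := fun f : F[X] => f.coeff 0)]
  · refine Finset.sum_congr rfl fun ε hε => ?_
    rw [← ncard_selfRecip_fiber hm (Finset.mem_filter.mp hε).2, Finset.sum_congr rfl
      (g := fun _ => w ε) (fun f hf => by rw [(Finset.mem_filter.mp hf).2]), Finset.sum_const,
      nsmul_eq_mul, ← Set.ncard_coe_finset]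
    congr 3
    ext f
    simp [mem_selfRecipFinset]
  · intro f hf
    rw [mem_selfRecipFinset] at hf
    simpa using sq_coeff_zero_of_mem_selfRecip hf

theorem sum_selfRecipFinset_odd [Fintype F] [DecidableEq F] (α : Fˣ) (k : ℕ) (w : F → ℚ) :
    ∑ f ∈ selfRecipFinset α (2 * k + 1), w (f.coeff 0) =
      (∑ ε : F with ε ^ 2 = (α : F) ^ (2 * k + 1), w ε) * (Fintype.card F : ℚ) ^ k := by
  rw [sum_selfRecipFinset α (Nat.succ_pos _), Finset.sum_mul]
  refine Finset.sum_congr rfl fun ε _ => ?_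
  rw [ncard_middleCoeff_odd (by omega), show (2 * k + 1 - 1) / 2 = k by omega]
  push_cast
  ring

theorem sum_selfRecipFinset_even [Fintype F] [DecidableEq F] (α : Fˣ) (k : ℕ) (w : F → ℚ) :
    ∑ f ∈ selfRecipFinset α (2 * k + 2), w (f.coeff 0) =
      w ((α : F) ^ (k + 1)) * (Fintype.card F : ℚ) ^ (k + 1) +
        (∑ ε : F with ε ^ 2 = (α : F) ^ (2 * k + 2) ∧ ε ≠ (α : F) ^ (k + 1), w ε) *
          (Fintype.card F : ℚ) ^ k := by
  rw [sum_selfRecipFinset α (Nat.succ_pos _), ← Finset.filter_filter,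
    ← Finset.sum_filter_add_sum_filter_not _ fun ε : F => ε = (α : F) ^ (k + 1)]
  congr 1
  · rw [Finset.filter_filter, Finset.sum_eq_single_of_mem ((α : F) ^ (k + 1))]
    · rw [ncard_middleCoeff_even (by omega), show (2 * k + 2) / 2 = k + 1 by omega, if_pos rfl,
        show (2 * k + 2 - 1) / 2 = k by omega]
      push_cast
      ring
    · simp only [Finset.mem_filter, Finset.mem_univ, true_and, and_true]
      rw [← pow_mul, show (k + 1) * 2 = (2 * k + 1).succ by omega]
    · intro b hb hb'
      exact absurd (Finset.mem_filter.mp hb).2.2 hb'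
  · rw [Finset.sum_mul]
    refine Finset.sum_congr rfl fun ε hε => ?_
    rw [ncard_middleCoeff_even (by omega), show (2 * k + 2) / 2 = k + 1 by omega,
      if_neg (Finset.mem_filter.mp hε).2, show (2 * k + 2 - 1) / 2 = k by omega]
    push_cast
    ring

end SelfReciprocal

/-! ### Sums over self-dual elementary divisors -/

section Profiles

open Polynomial

variable {F : Type*} [Field F] [Fintype F] {n : ℕ}

/-- The partition with `m i` parts equal to `i + 1`. -/
def partitionOfMult (m : Fin n → ℕ) (hm : ∑ i : Fin n, ((i : ℕ) + 1) * m i = n) : n.Partition where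
  parts := ∑ i : Fin n, Multiset.replicate (m i) ((i : ℕ) + 1)
  parts_pos := by
    intro j hj
    obtain ⟨i, -, hi⟩ := Multiset.mem_sum.mp hj
    rw [Multiset.eq_of_mem_replicate hi]
    exact Nat.succ_pos _
  parts_sum := by
    conv_rhs => rw [← hm]
    rw [Multiset.sum_sum]
    exact Finset.sum_congr rfl fun i _ => by rw [Multiset.sum_replicate, smul_eq_mul, mul_comm]

theorem count_partitionOfMult {m : Fin n → ℕ} (hm : ∑ i : Fin n, ((i : ℕ) + 1) * m i = n)
    (i : Fin n) : (partitionOfMult m hm).parts.count ((i : ℕ) + 1) = m i := by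
  rw [partitionOfMult, Multiset.count_sum', Finset.sum_eq_single i]
  · rw [Multiset.count_replicate_self]
  · intro j _ hj
    rw [Multiset.count_replicate, if_neg]
    intro h
    exact hj (Fin.ext (by omega))
  · simp

theorem Nat.Partition.sum_mul_count (p : n.Partition) :
    ∑ i : Fin n, ((i : ℕ) + 1) * p.parts.count ((i : ℕ) + 1) = n := by
  have hsub : p.parts.toFinset ⊆ Finset.Ico 1 (n + 1) := by
    intro j hj
    rw [Multiset.mem_toFinset] at hj
    rw [Finset.mem_Ico]
    exact ⟨p.parts_pos hj, Nat.lt_succ_of_le (p.le_of_mem_parts hj)⟩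
  conv_rhs => rw [← p.parts_sum]
  rw [Finset.sum_multiset_count_of_subset _ _ hsub, Finset.sum_Ico_eq_sum_range, Finset.sum_range]
  simp [add_comm, mul_comm]

theorem Nat.Partition.prod_toFinsupp_eq (p : n.Partition) (f : ℕ → ℕ → ℚ) (hf : ∀ i, f i 0 = 1) :
    p.parts.toFinsupp.prod f = ∏ i : Fin n, f ((i : ℕ) + 1) (p.parts.count ((i : ℕ) + 1)) := by
  have hsub : p.parts.toFinsupp.support ⊆ Finset.Ico 1 (n + 1) := by
    intro j hj
    rw [Multiset.toFinsupp_support, Multiset.mem_toFinset] at hj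
    rw [Finset.mem_Ico]
    exact ⟨p.parts_pos hj, Nat.lt_succ_of_le (p.le_of_mem_parts hj)⟩
  rw [Finsupp.prod_of_support_subset _ hsub _ fun i _ => hf i, Finset.prod_Ico_eq_prod_range,
    Finset.prod_range]
  simp [add_comm]

theorem Nat.Partition.ext_count {p p' : n.Partition}
    (h : ∀ i : Fin n, p.parts.count ((i : ℕ) + 1) = p'.parts.count ((i : ℕ) + 1)) : p = p' := by
  apply Nat.Partition.ext
  ext j
  have h0 : ∀ p : n.Partition, ¬ (1 ≤ j ∧ j ≤ n) → p.parts.count j = 0 := by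
    intro p hj
    exact Multiset.count_eq_zero_of_notMem fun hmem =>
      hj ⟨p.parts_pos hmem, p.le_of_mem_parts hmem⟩
  by_cases hj : 1 ≤ j ∧ j ≤ n
  · have := h ⟨j - 1, by omega⟩
    simpa [Nat.sub_add_cancel hj.1] using this
  · rw [h0 p hj, h0 p' hj]

theorem finite_selfDual (α : Fˣ) (n : ℕ) :
    {d | d ∈ elemDivSet n F ∧ ∀ i, twistedRecip α (d i) = d i}.Finite := by
  classical
  refine Set.Finite.subset (Finset.finite_toSet ((Finset.univ : Finset n.Partition).biUnion fun p =>
    Fintype.piFinset fun i : Fin n => selfRecipFinset α (p.parts.count ((i : ℕ) + 1)))) ?_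
  rintro d ⟨hd, hα⟩
  simp only [Finset.coe_biUnion, Set.mem_iUnion, Finset.mem_coe, Fintype.mem_piFinset,
    mem_selfRecipFinset]
  refine ⟨partitionOfMult _ hd.2, Finset.mem_univ _, fun i => ?_⟩
  rw [count_partitionOfMult]
  exact ⟨(hd.1 i).1, (hd.1 i).2, rfl, hα i⟩

/-- A sum over self-dual sequences `d` with `∑ i, (i + 1) * deg (d i) = n` is grouped by the
degrees of the `d i`, that is, by the partition of `n` with `deg (d i)` parts equal to `i + 1`. -/
theorem sum_selfDual_eq_coeff_genFun (α : Fˣ) (w : ℕ → F[X] → ℚ) (hw : ∀ i, w i 1 = 1) (n : ℕ) :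
    ∑ d ∈ (finite_selfDual α n).toFinset, ∏ i : Fin n, w (i + 1) (d i) =
      PowerSeries.coeff n (Nat.Partition.genFun
        fun i m => ∑ f ∈ selfRecipFinset α m, w i f) := by
  classical
  have hD : (finite_selfDual α n).toFinset = (Finset.univ : Finset n.Partition).biUnion fun p =>
      Fintype.piFinset fun i : Fin n => selfRecipFinset α (p.parts.count ((i : ℕ) + 1)) := by
    ext d
    simp only [Set.Finite.mem_toFinset, Finset.mem_biUnion, Finset.mem_univ, true_and,
      Fintype.mem_piFinset, mem_selfRecipFinset]
    constructor
    · rintro ⟨hd, hα⟩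
      refine ⟨partitionOfMult _ hd.2, fun i => ?_⟩
      rw [count_partitionOfMult]
      exact ⟨(hd.1 i).1, (hd.1 i).2, rfl, hα i⟩
    · rintro ⟨p, hp⟩
      refine ⟨⟨fun i => ⟨(hp i).1, (hp i).2.1⟩, ?_⟩, fun i => (hp i).2.2.2⟩
      rw [Finset.sum_congr rfl fun i _ => by rw [(hp i).2.2.1]]
      exact p.sum_mul_count
  rw [hD, Finset.sum_biUnion, Nat.Partition.coeff_genFun]
  · refine Finset.sum_congr rfl fun p _ => ?_
    rw [Nat.Partition.prod_toFinsupp_eq, Finset.prod_univ_sum]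
    intro i
    have : selfRecipFinset α 0 = {1} := by
      ext f; rw [mem_selfRecipFinset, selfRecip_zero]; simp
    rw [this, Finset.sum_singleton, hw]
  · intro p _ p' _ hpp
    refine Finset.disjoint_left.mpr fun d hd hd' => hpp (Nat.Partition.ext_count fun i => ?_)
    rw [Fintype.mem_piFinset] at hd hd'
    rw [← (mem_selfRecipFinset.mp (hd i)).2.2.1, ← (mem_selfRecipFinset.mp (hd' i)).2.2.1]

end Profiles

/-! ### Infinite products of power series -/

section GeneratingFunctions

open PowerSeries

theorem hasProd_of_forall_eq {α β : Type*} [CommMonoid α] [TopologicalSpace α] {f g : β → α} {a : α}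
    (h : HasProd f a) (hfg : ∀ b, f b = g b) : HasProd g a :=
  funext hfg ▸ h

/-- The factor of part size `i`: the numbers `S m` satisfy the recursion `S (m + 2) = Q * S m` for
`m ≥ 1`, so their generating function in `X ^ i` is rational. -/
theorem one_add_tsum_eq_mul_inv {S : ℕ → ℚ} {a b Q : ℚ} (h₁ : ∀ k, S (2 * k + 1) = a * Q ^ k)
    (h₂ : ∀ k, S (2 * k + 2) = Q ^ (k + 1) + b * Q ^ k) {i : ℕ} (hi : i ≠ 0) :
    (1 + ∑' j, S (j + 1) • (X : ℚ⟦X⟧) ^ (i * (j + 1))) =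
      (1 + C a * X ^ i + C b * X ^ (2 * i)) * (1 - C Q * X ^ (2 * i))⁻¹ := by
  have hsum := Nat.Partition.summable_genFun_term' (fun _ m => S m) hi
  set T := ∑' j, S (j + 1) • (X : ℚ⟦X⟧) ^ (i * (j + 1)) with hT
  have hstep : ∀ m, S (m + 2 + 1) = Q * S (m + 1) := by
    intro m
    obtain ⟨k, rfl | rfl⟩ := Nat.even_or_odd' m
    · rw [show 2 * k + 2 + 1 = 2 * (k + 1) + 1 by ring, h₁, h₁]; ring
    · rw [show 2 * k + 1 + 2 + 1 = 2 * (k + 1) + 2 by ring, show 2 * k + 1 + 1 = 2 * k + 2 by ring,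
        h₂, h₂]; ring
  have hrec : T = C a * X ^ i + C (Q + b) * X ^ (2 * i) + C Q * X ^ (2 * i) * T := by
    conv_lhs => rw [hT, ← hsum.sum_add_tsum_nat_add 2]
    rw [Finset.sum_range_succ, Finset.sum_range_one, hT, ← hsum.tsum_mul_left]
    congr 1
    · have e1 := h₁ 0
      have e2 := h₂ 0
      simp only [mul_zero, zero_add, pow_zero, mul_one, pow_one] at e1 e2
      rw [zero_add, mul_one, e1, e2, smul_eq_C_mul, smul_eq_C_mul, mul_comm 2]
    · refine tsum_congr fun j => ?_
      rw [hstep, smul_eq_C_mul, smul_eq_C_mul, map_mul]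
      ring
  have hc : constantCoeff (1 - C Q * X ^ (2 * i) : ℚ⟦X⟧) ≠ 0 := by
    simp [hi]
  rw [PowerSeries.eq_mul_inv_iff_mul_eq hc]
  rw [map_add] at hrec
  linear_combination hrec

theorem multipliable_one_add_of_X_pow_dvd {f : ℕ → ℚ⟦X⟧} (h : ∀ i, X ^ i ∣ f i) :
    Multipliable fun i => 1 + f i := by
  refine WithPiTopology.multipliable_one_add_of_tendsto_order_atTop_nhds_top _
    (ENat.tendsto_nhds_top_iff_natCast_lt.mpr fun n => Filter.eventually_atTop.mpr
      ⟨n + 1, fun i hi => ?_⟩)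
  obtain ⟨g, hg⟩ := h i
  rw [hg, order_mul, order_X_pow]
  refine lt_of_lt_of_le ?_ le_self_add
  exact_mod_cast hi

theorem multipliable_inv_one_sub (Q : ℚ) :
    Multipliable fun i : ℕ => (1 - C Q * X ^ (2 * (i + 1)) : ℚ⟦X⟧)⁻¹ := by
  have : ∀ i : ℕ, (1 - C Q * X ^ (2 * (i + 1)) : ℚ⟦X⟧)⁻¹ =
      1 + C Q * X ^ (2 * (i + 1)) * (1 - C Q * X ^ (2 * (i + 1)))⁻¹ := by
    intro i
    have := PowerSeries.mul_inv_cancel (1 - C Q * X ^ (2 * (i + 1)) : ℚ⟦X⟧) (by simp)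
    linear_combination this
  rw [funext this]
  refine multipliable_one_add_of_X_pow_dvd fun i => ?_
  exact Dvd.dvd.mul_right (Dvd.dvd.mul_left (pow_dvd_pow _ (by omega)) _) _

theorem multipliable_one_add_X_pow {a : ℕ → ℕ} (ha : ∀ i, i ≤ a i) :
    Multipliable fun i : ℕ => (1 + X ^ a i : ℚ⟦X⟧) :=
  multipliable_one_add_of_X_pow_dvd fun i => pow_dvd_pow _ (ha i)

theorem multipliable_one_sub_X_pow {a : ℕ → ℕ} (ha : ∀ i, i ≤ a i) :
    Multipliable fun i : ℕ => (1 - X ^ a i : ℚ⟦X⟧) := by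
  simp_rw [sub_eq_add_neg]
  exact multipliable_one_add_of_X_pow_dvd fun i => (dvd_neg.mpr (pow_dvd_pow _ (ha i)))

/-- Euler's identity `∏ (1 - y ^ (2 k + 1)) * ∏ (1 + y ^ (k + 1)) = 1`, for `y = X ^ 2`. -/
theorem tprod_one_sub_odd_mul_tprod_one_add :
    (∏' k : ℕ, (1 - X ^ (2 * (2 * k + 1)) : ℚ⟦X⟧)) *
      ∏' k : ℕ, (1 + X ^ (2 * (k + 1)) : ℚ⟦X⟧) = 1 := by
  have hM : Multipliable fun i : ℕ => (1 - X ^ (2 * (i + 1)) : ℚ⟦X⟧) :=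
    multipliable_one_sub_X_pow fun i => by omega
  have hP : Multipliable fun i : ℕ => (1 + X ^ (2 * (i + 1)) : ℚ⟦X⟧) :=
    multipliable_one_add_X_pow fun i => by omega
  have hO : Multipliable fun k : ℕ => (1 - X ^ (2 * (2 * k + 1)) : ℚ⟦X⟧) :=
    multipliable_one_sub_X_pow fun i => by omega
  have hE : Multipliable fun k : ℕ => (1 - X ^ (2 * (2 * k + 1 + 1)) : ℚ⟦X⟧) :=
    multipliable_one_sub_X_pow fun i => by omega
  have hM0 : (∏' i : ℕ, (1 - X ^ (2 * (i + 1)) : ℚ⟦X⟧)) ≠ 0 := by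
    intro h
    have := congrArg constantCoeff h
    rw [hM.map_tprod _ (WithPiTopology.continuous_constantCoeff _)] at this
    simp at this
  have h1 := tprod_even_mul_odd (f := fun i : ℕ => (1 - X ^ (2 * (i + 1)) : ℚ⟦X⟧)) hO hE
  have h2 : ∀ k : ℕ, (1 - X ^ (2 * (2 * k + 1 + 1)) : ℚ⟦X⟧) =
      (1 - X ^ (2 * (k + 1))) * (1 + X ^ (2 * (k + 1))) := by
    intro k; ring
  simp_rw [h2] at h1
  rw [hM.tprod_mul hP] at h1
  refine mul_right_cancel₀ hM0 ?_
  linear_combination h1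

theorem hasProd_euler_twist (Q : ℚ) {c : ℕ → ℚ⟦X⟧}
    (hodd : ∀ k, c (2 * k) = 1 - X ^ (2 * (2 * k + 1)))
    (heven : ∀ k, c (2 * k + 1) = (1 + X ^ (2 * (k + 1))) ^ 2) {s : ℚ⟦X⟧}
    (h : HasProd (fun i => c i * (1 - C Q * X ^ (2 * (i + 1)))⁻¹) s) :
    HasProd (fun i => (1 + X ^ (2 * (i + 1))) * (1 - C Q * X ^ (2 * (i + 1)))⁻¹) s := by
  have hP : Multipliable fun i : ℕ => (1 + X ^ (2 * (i + 1)) : ℚ⟦X⟧) :=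
    multipliable_one_add_X_pow fun i => by omega
  have hO : Multipliable fun k : ℕ => c (2 * k) := by
    simp_rw [hodd]; exact multipliable_one_sub_X_pow fun i => by omega
  have hE : Multipliable fun k : ℕ => c (2 * k + 1) := by
    simp_rw [heven, sq]; exact hP.mul hP
  have hc : Multipliable c := (hO.hasProd.even_mul_odd hE.hasProd).multipliable
  have hI := multipliable_inv_one_sub Q
  have hcP : ∏' i, c i = ∏' i : ℕ, (1 + X ^ (2 * (i + 1)) : ℚ⟦X⟧) := by
    rw [← tprod_even_mul_odd hO hE]
    simp_rw [hodd, heven, sq]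
    rw [hP.tprod_mul hP, ← mul_assoc, tprod_one_sub_odd_mul_tprod_one_add, one_mul]
  have := (hP.mul hI).hasProd
  rwa [hP.tprod_mul hI, ← hcP, ← hc.tprod_mul hI, h.tprod_eq] at this

end GeneratingFunctions

/-! ### Generating functions of real classes -/

section Counts

open Polynomial

variable {F : Type*} [Field F] [Fintype F]

theorem gcd_card_sub_one_two (F : Type*) [Field F] [Fintype F] :
    (Nat.gcd (Fintype.card F - 1) 2 = 1 ∧ (-1 : F) = 1) ∨
      (Nat.gcd (Fintype.card F - 1) 2 = 2 ∧ (-1 : F) ≠ 1) := by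
  have hpos : 0 < Fintype.card F := Fintype.card_pos
  by_cases h : (-1 : F) = 1
  · refine Or.inl ⟨?_, h⟩
    have h2 := FiniteField.even_card_of_char_two (neg_one_eq_one_iff.mp h)
    rw [Nat.gcd_comm, Nat.gcd_rec, show (Fintype.card F - 1) % 2 = 1 by omega]
    rfl
  · refine Or.inr ⟨?_, h⟩
    have h2 := FiniteField.odd_card_of_char_ne_two fun h' => h (neg_one_eq_one_iff.mpr h')
    rw [Nat.gcd_comm, Nat.gcd_rec, show (Fintype.card F - 1) % 2 = 0 by omega]
    rfl

/-- The square roots of `c ^ 2` other than `c`: there is `-c` if `-1 ≠ 1`, and none otherwise. -/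
theorem sum_sq_eq_ne [DecidableEq F] {c : F} (hc : c ≠ 0) (w : F → ℚ) :
    ∑ ε : F with ε ^ 2 = c ^ 2 ∧ ε ≠ c, w ε = if (-1 : F) = 1 then 0 else w (-c) := by
  split_ifs with h
  · refine Finset.sum_eq_zero fun ε hε => ?_
    obtain ⟨h1, h2⟩ := (Finset.mem_filter.mp hε).2
    rcases sq_eq_sq_iff_eq_or_eq_neg.mp h1 with h3 | h3
    · exact absurd h3 h2
    · rw [← neg_one_mul, h, one_mul] at h3
      exact absurd h3 h2
  · have : (Finset.univ.filter fun ε : F => ε ^ 2 = c ^ 2 ∧ ε ≠ c) = {-c} := by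
      ext ε
      simp only [Finset.mem_filter, Finset.mem_univ, true_and, Finset.mem_singleton,
        sq_eq_sq_iff_eq_or_eq_neg]
      constructor
      · rintro ⟨h1 | h1, h2⟩
        · exact absurd h1 h2
        · exact h1
      · rintro rfl
        refine ⟨Or.inr rfl, fun h2 => h ?_⟩
        rw [← neg_one_mul] at h2
        exact mul_right_cancel₀ hc (h2.trans (one_mul c).symm)
    rw [this, Finset.sum_singleton]

theorem sum_sq_eq [DecidableEq F] {c : F} (hc : c ≠ 0) (w : F → ℚ) :
    ∑ ε : F with ε ^ 2 = c ^ 2, w ε = w c + if (-1 : F) = 1 then 0 else w (-c) := by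
  rw [← sum_sq_eq_ne hc, ← Finset.filter_filter,
    ← Finset.sum_filter_add_sum_filter_not _ fun ε : F => ε = c]
  congr 1
  rw [Finset.filter_filter, Finset.sum_eq_single_of_mem c (by simp)]
  intro b hb hb'
  exact absurd (Finset.mem_filter.mp hb).2.2 hb'

/-- The number of conjugacy classes `c` of `GL(n, F)` with `c = α c⁻¹`, as a generating function. -/
noncomputable def twistedRealSeries (α : Fˣ) : PowerSeries ℚ :=
  PowerSeries.mk fun n =>
    ((twistedReal (Matrix.GeneralLinearGroup.scalar (Fin n) α)).ncard : ℚ)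

theorem twistedRealSeries_eq_genFun (α : Fˣ) : twistedRealSeries α =
    Nat.Partition.genFun fun _ m => ∑ _f ∈ selfRecipFinset α m, (1 : ℚ) := by
  ext n
  have := sum_selfDual_eq_coeff_genFun α (fun _ _ => 1) (fun _ => rfl) n
  rw [← this, twistedRealSeries, PowerSeries.coeff_mk, ncard_twistedReal_scalar,
    Set.ncard_eq_toFinset_card _ (finite_selfDual α n)]
  simp

theorem hasProd_twistedRealSeries_of_isSquare {α : Fˣ} (hα : IsSquare α) :
    HasProd (fun i : ℕ => (1 + PowerSeries.X ^ (i + 1)) ^ Nat.gcd (Fintype.card F - 1) 2 *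
      (1 - PowerSeries.C (Fintype.card F : ℚ) * PowerSeries.X ^ (2 * (i + 1)))⁻¹)
      (twistedRealSeries α) := by
  classical
  obtain ⟨β, rfl⟩ := hα
  rw [twistedRealSeries_eq_genFun]
  have h := Nat.Partition.hasProd_genFun
    (fun _ m => ∑ _f ∈ selfRecipFinset (β * β) m, (1 : ℚ))
  have hodd : ∀ k, ∑ _f ∈ selfRecipFinset (β * β) (2 * k + 1), (1 : ℚ) =
      (1 + if (-1 : F) = 1 then 0 else 1) * (Fintype.card F : ℚ) ^ k := by
    intro k
    have h1 := sum_selfRecipFinset_odd (β * β) k (fun _ => 1)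
    rw [h1, show ((β * β : Fˣ) : F) ^ (2 * k + 1) = ((β : F) ^ (2 * k + 1)) ^ 2 by
      rw [Units.val_mul]; ring, sum_sq_eq (pow_ne_zero _ β.ne_zero)]
  have heven : ∀ k, ∑ _f ∈ selfRecipFinset (β * β) (2 * k + 2), (1 : ℚ) =
      (Fintype.card F : ℚ) ^ (k + 1) + (if (-1 : F) = 1 then 0 else 1) *
        (Fintype.card F : ℚ) ^ k := by
    intro k
    have h1 := sum_selfRecipFinset_even (β * β) k (fun _ => 1)
    rw [h1, show 2 * k + 2 = (k + 1) * 2 by ring, pow_mul,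
      sum_sq_eq_ne (pow_ne_zero _ (β * β).ne_zero), one_mul]
  refine hasProd_of_forall_eq h fun i => ?_
  refine (one_add_tsum_eq_mul_inv
    (S := fun m => ∑ _f ∈ selfRecipFinset (β * β) m, (1 : ℚ)) hodd heven i.add_one_ne_zero).trans ?_
  congr 1
  rcases gcd_card_sub_one_two F with ⟨he, h1⟩ | ⟨he, h1⟩
  · rw [he]; simp [h1]
  · rw [he]; simp only [h1, if_false, map_add, map_one]; ring

theorem hasProd_twistedRealSeries_of_not_isSquare {α : Fˣ} (hα : ¬ IsSquare α) :
    HasProd (fun i : ℕ => (1 + PowerSeries.X ^ (Nat.gcd (Fintype.card F - 1) 2 * (i + 1))) *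
      (1 - PowerSeries.C (Fintype.card F : ℚ) * PowerSeries.X ^ (2 * (i + 1)))⁻¹)
      (twistedRealSeries α) := by
  classical
  rw [twistedRealSeries_eq_genFun]
  have h := Nat.Partition.hasProd_genFun
    (fun _ m => ∑ _f ∈ selfRecipFinset α m, (1 : ℚ))
  have hsq : ∀ (ε : F) (k : ℕ), ε ^ 2 ≠ (α : F) ^ (2 * k + 1) := by
    intro ε k hε
    have hε0 : ε ≠ 0 := by
      rintro rfl
      exact pow_ne_zero _ α.ne_zero (by rw [← hε]; simp)
    refine hα ⟨Units.mk0 ε hε0 * (α ^ k)⁻¹, Units.ext ?_⟩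
    have := pow_ne_zero k α.ne_zero
    simp only [Units.val_mul, Units.val_mk0, Units.val_inv_eq_inv_val, Units.val_pow_eq_pow_val]
    field_simp
    linear_combination -hε
  have hneg : (-1 : F) ≠ 1 := by
    intro h1
    have h2 : ringChar F = 2 := neg_one_eq_one_iff.mp h1
    obtain ⟨ε, hε⟩ := FiniteField.isSquare_of_char_two h2 (α : F)
    refine hsq ε 0 ?_
    rw [hε]; ring
  have hodd : ∀ k, ∑ _f ∈ selfRecipFinset α (2 * k + 1), (1 : ℚ) =
      0 * (Fintype.card F : ℚ) ^ k := by
    intro k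
    have h1 := sum_selfRecipFinset_odd α k (fun _ => 1)
    rw [h1, Finset.filter_false_of_mem fun ε _ => hsq ε k, Finset.sum_empty]
  have heven : ∀ k, ∑ _f ∈ selfRecipFinset α (2 * k + 2), (1 : ℚ) =
      (Fintype.card F : ℚ) ^ (k + 1) + 1 * (Fintype.card F : ℚ) ^ k := by
    intro k
    have h1 := sum_selfRecipFinset_even α k (fun _ => 1)
    rw [h1, show 2 * k + 2 = (k + 1) * 2 by ring, pow_mul,
      sum_sq_eq_ne (pow_ne_zero _ α.ne_zero), one_mul, if_neg hneg]
  refine hasProd_of_forall_eq h fun i => ?_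
  refine (one_add_tsum_eq_mul_inv
    (S := fun m => ∑ _f ∈ selfRecipFinset α m, (1 : ℚ)) hodd heven i.add_one_ne_zero).trans ?_
  congr 1
  rcases gcd_card_sub_one_two F with ⟨he, h1⟩ | ⟨he, h1⟩
  · exact absurd h1 hneg
  · rw [he]; simp

/-- The sign character of `{1, -1} ⊆ F`, extended by the value `-1` to all of `F`. If `-1 = 1`, its
value at this element is `1`. -/
noncomputable def signOfDet {F : Type*} [Field F] (x : F) : ℚ := by
  classical exact if x = 1 then 1 else -1

section Sign

variable {F : Type*} [Field F]

theorem signOfDet_one : signOfDet (1 : F) = 1 := by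
  rw [signOfDet, if_pos rfl]

theorem signOfDet_neg_one (h : (-1 : F) ≠ 1) : signOfDet (-1 : F) = -1 := by
  rw [signOfDet, if_neg h]

theorem signOfDet_sq (x : F) : signOfDet x ^ 2 = 1 := by
  rw [signOfDet]; split_ifs <;> norm_num

theorem signOfDet_mul {x y : F} (hx : x ^ 2 = 1) (hy : y ^ 2 = 1) :
    signOfDet (x * y) = signOfDet x * signOfDet y := by
  by_cases h : (-1 : F) = 1
  · have : ∀ z : F, z ^ 2 = 1 → z = 1 := fun z hz => by
      rcases sq_eq_one_iff.mp hz with h1 | h1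
      · exact h1
      · rw [h1, h]
    rw [this x hx, this y hy, mul_one, signOfDet_one, mul_one]
  · rcases sq_eq_one_iff.mp hx with rfl | rfl
    · rw [one_mul, signOfDet_one, one_mul]
    · rcases sq_eq_one_iff.mp hy with rfl | rfl
      · rw [mul_one, signOfDet_one, mul_one]
      · rw [neg_mul_neg, one_mul, signOfDet_one, signOfDet_neg_one h]; norm_num

theorem signOfDet_pow {x : F} (hx : x ^ 2 = 1) (k : ℕ) : signOfDet (x ^ k) = signOfDet x ^ k := by
  induction k with
  | zero => rw [pow_zero, pow_zero, signOfDet_one]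
  | succ k ih =>
    rw [pow_succ, signOfDet_mul _ hx, ih, pow_succ]
    rw [← pow_mul, mul_comm, pow_mul, hx, one_pow]

theorem signOfDet_prod {ι : Type*} (s : Finset ι) {x : ι → F} (hx : ∀ i, x i ^ 2 = 1) :
    signOfDet (∏ i ∈ s, x i) = ∏ i ∈ s, signOfDet (x i) := by
  classical
  induction s using Finset.induction_on with
  | empty => rw [Finset.prod_empty, Finset.prod_empty, signOfDet_one]
  | insert a s ha ih =>
    rw [Finset.prod_insert ha, Finset.prod_insert ha, signOfDet_mul (hx a), ih]
    rw [← Finset.prod_pow, Finset.prod_eq_one fun i _ => hx i]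

theorem signedConst_sq_of_mem_selfRecip {m : ℕ} {f : F[X]} (hf : f ∈ selfRecip 1 m) :
    signedConst f ^ 2 = 1 := by
  rw [signedConst, mul_pow, sq_coeff_zero_of_mem_selfRecip hf, ← pow_mul, mul_comm _ 2, pow_mul,
    neg_one_sq, one_pow, Units.val_one, one_pow, one_mul]

end Sign

/-- The generating function of the sums of the signs of the determinants of the real conjugacy
classes of `GL(n, F)`. The sum is written over the elementary divisors that parametrize these
classes. -/
noncomputable def signedRealSeries (F : Type*) [Field F] [Fintype F] : PowerSeries ℚ :=
  PowerSeries.mk fun n => ∑ d ∈ (finite_selfDual (1 : Fˣ) n).toFinset,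
    signOfDet (∏ i : Fin n, signedConst (d i) ^ ((i : ℕ) + 1))

/-- Real classes have determinant `1` or `-1`, so those of determinant `1` are counted by half the
sum of `1 + sign (det c)`. -/
theorem two_mul_ncard_realClassesIn_specialLinear (n : ℕ) :
    2 * ((realClassesIn (specialLinear n F)).ncard : ℚ) =
      PowerSeries.coeff n (twistedRealSeries (1 : Fˣ)) +
        PowerSeries.coeff n (signedRealSeries F) := by
  classical
  rw [twistedRealSeries, PowerSeries.coeff_mk, ncard_twistedReal_scalar, signedRealSeries,
    PowerSeries.coeff_mk, ncard_realClassesIn_specialLinear,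
    Set.ncard_eq_toFinset_card _ (finite_selfDual 1 n)]
  have hset : {d | (d ∈ elemDivSet n F ∧ ∀ i, twistedRecip 1 (d i) = d i) ∧
      ∏ i : Fin n, signedConst (d i) ^ ((i : ℕ) + 1) = 1} =
      ((finite_selfDual (1 : Fˣ) n).toFinset.filter fun d =>
        ∏ i : Fin n, signedConst (d i) ^ ((i : ℕ) + 1) = 1 : Finset (Fin n → F[X])) := by
    ext d
    simp
  rw [hset, Set.ncard_coe_finset, Finset.card_filter, Finset.card_eq_sum_ones]
  push_cast
  rw [Finset.mul_sum, ← Finset.sum_add_distrib]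
  refine Finset.sum_congr rfl fun d _ => ?_
  rw [signOfDet]
  split_ifs <;> norm_num

theorem signedRealSeries_eq_genFun : signedRealSeries F =
    Nat.Partition.genFun fun i m =>
      ∑ f ∈ selfRecipFinset (1 : Fˣ) m, signOfDet (signedConst f) ^ i := by
  ext n
  have := sum_selfDual_eq_coeff_genFun (1 : Fˣ) (fun i f => signOfDet (signedConst f) ^ i)
    (fun i => by simp [signedConst, signOfDet_one]) n
  rw [← this, signedRealSeries, PowerSeries.coeff_mk]
  refine Finset.sum_congr rfl fun d hd => ?_
  obtain ⟨hd, hα⟩ := (Set.Finite.mem_toFinset _).mp hd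
  have hsq : ∀ i, signedConst (d i) ^ 2 = 1 := fun i =>
    signedConst_sq_of_mem_selfRecip ⟨(hd.1 i).1, (hd.1 i).2, rfl, hα i⟩
  rw [signOfDet_prod _ fun i => by rw [← pow_mul, mul_comm, pow_mul, hsq, one_pow]]
  exact Finset.prod_congr rfl fun i _ => signOfDet_pow (hsq i) _

theorem sum_signOfDet_pow_even {i : ℕ} (hi : Even i) (m : ℕ) :
    ∑ f ∈ selfRecipFinset (1 : Fˣ) m, signOfDet (signedConst f) ^ i =
      ∑ _f ∈ selfRecipFinset (1 : Fˣ) m, (1 : ℚ) := by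
  obtain ⟨j, rfl⟩ := hi
  refine Finset.sum_congr rfl fun f _ => ?_
  rw [← two_mul, pow_mul, signOfDet_sq, one_pow]

theorem sum_signOfDet_pow_odd [DecidableEq F] {i : ℕ} (hi : Odd i) (m : ℕ) :
    ∑ f ∈ selfRecipFinset (1 : Fˣ) m, signOfDet (signedConst f) ^ i =
      ∑ f ∈ selfRecipFinset (1 : Fˣ) m, signOfDet ((-1) ^ m * f.coeff 0) := by
  obtain ⟨j, rfl⟩ := hi
  refine Finset.sum_congr rfl fun f hf => ?_
  rw [pow_succ, pow_mul, signOfDet_sq, one_pow, one_mul, signedConst,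
    (mem_selfRecipFinset.mp hf).2.2.1]

theorem sum_one_selfRecip_odd [DecidableEq F] (k : ℕ) :
    ∑ _f ∈ selfRecipFinset (1 : Fˣ) (2 * k + 1), (1 : ℚ) =
      (1 + if (-1 : F) = 1 then 0 else 1) * (Fintype.card F : ℚ) ^ k := by
  have h1 := sum_selfRecipFinset_odd (1 : Fˣ) k (fun _ => 1)
  have h3 := sum_sq_eq (one_ne_zero (α := F)) fun _ => 1
  simp only [Units.val_one, one_pow] at h1 h3 ⊢
  rw [h1, h3]

theorem sum_one_selfRecip_even [DecidableEq F] (k : ℕ) :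
    ∑ _f ∈ selfRecipFinset (1 : Fˣ) (2 * k + 2), (1 : ℚ) =
      (Fintype.card F : ℚ) ^ (k + 1) +
        (if (-1 : F) = 1 then 0 else 1) * (Fintype.card F : ℚ) ^ k := by
  have h1 := sum_selfRecipFinset_even (1 : Fˣ) k (fun _ => 1)
  have h3 := sum_sq_eq_ne (one_ne_zero (α := F)) fun _ => 1
  simp only [Units.val_one, one_pow, one_mul] at h1 h3 ⊢
  rw [h1, h3]

theorem sum_sign_selfRecip_odd [DecidableEq F] (k : ℕ) :
    ∑ f ∈ selfRecipFinset (1 : Fˣ) (2 * k + 1), signOfDet ((-1) ^ (2 * k + 1) * f.coeff 0) =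
      (if (-1 : F) = 1 then 1 else 0) * (Fintype.card F : ℚ) ^ k := by
  have h1 := sum_selfRecipFinset_odd (1 : Fˣ) k (fun ε => signOfDet ((-1) ^ (2 * k + 1) * ε))
  have h3 := sum_sq_eq (one_ne_zero (α := F)) fun ε => signOfDet ((-1) ^ (2 * k + 1) * ε)
  simp only [Units.val_one, one_pow] at h1 h3 ⊢
  rw [h1, h3]
  have h2 : (-1 : F) ^ (2 * k + 1) = -1 := by rw [pow_succ, pow_mul, neg_one_sq, one_pow, one_mul]
  rw [h2, neg_mul_neg, one_mul, mul_one, signOfDet_one]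
  split_ifs with h
  · rw [h, signOfDet_one, add_zero]
  · rw [signOfDet_neg_one h, neg_add_cancel]

theorem sum_sign_selfRecip_even [DecidableEq F] (k : ℕ) :
    ∑ f ∈ selfRecipFinset (1 : Fˣ) (2 * k + 2), signOfDet ((-1) ^ (2 * k + 2) * f.coeff 0) =
      (Fintype.card F : ℚ) ^ (k + 1) +
        (if (-1 : F) = 1 then 0 else -1) * (Fintype.card F : ℚ) ^ k := by
  have h1 := sum_selfRecipFinset_even (1 : Fˣ) k (fun ε => signOfDet ((-1) ^ (2 * k + 2) * ε))
  have h2 : (-1 : F) ^ (2 * k + 2) = 1 := by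
    rw [show 2 * k + 2 = 2 * (k + 1) by ring, pow_mul, neg_one_sq, one_pow]
  have h3 := sum_sq_eq_ne (one_ne_zero (α := F)) fun ε => signOfDet ε
  simp only [h2, one_mul] at h1 ⊢
  rw [h1]
  simp only [Units.val_one, one_pow, signOfDet_one, one_mul] at h3 ⊢
  rw [h3]
  split_ifs with h
  · rfl
  · rw [signOfDet_neg_one h]

theorem hasProd_signedRealSeries :
    HasProd (fun i : ℕ => (1 + PowerSeries.X ^ (Nat.gcd (Fintype.card F - 1) 2 * (i + 1))) *
      (1 - PowerSeries.C (Fintype.card F : ℚ) * PowerSeries.X ^ (2 * (i + 1)))⁻¹)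
      (signedRealSeries F) := by
  classical
  rw [signedRealSeries_eq_genFun]
  have h := Nat.Partition.hasProd_genFun
    (fun i m => ∑ f ∈ selfRecipFinset (1 : Fˣ) m, signOfDet (signedConst f) ^ i)
  have heven : ∀ i, i ≠ 0 → Even i → (1 + ∑' j : ℕ, (∑ f ∈ selfRecipFinset (1 : Fˣ) (j + 1),
      signOfDet (signedConst f) ^ i) • (PowerSeries.X : PowerSeries ℚ) ^ (i * (j + 1))) =
      (1 + PowerSeries.C (1 + if (-1 : F) = 1 then 0 else 1) * PowerSeries.X ^ i +
        PowerSeries.C (if (-1 : F) = 1 then 0 else 1) * PowerSeries.X ^ (2 * i)) *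
      (1 - PowerSeries.C (Fintype.card F : ℚ) * PowerSeries.X ^ (2 * i))⁻¹ := by
    intro i hi0 hi
    simp_rw [sum_signOfDet_pow_even hi]
    exact one_add_tsum_eq_mul_inv (S := fun m => ∑ _f ∈ selfRecipFinset (1 : Fˣ) m, (1 : ℚ))
      sum_one_selfRecip_odd sum_one_selfRecip_even hi0
  have hodd : ∀ i, i ≠ 0 → Odd i → (1 + ∑' j : ℕ, (∑ f ∈ selfRecipFinset (1 : Fˣ) (j + 1),
      signOfDet (signedConst f) ^ i) • (PowerSeries.X : PowerSeries ℚ) ^ (i * (j + 1))) =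
      (1 + PowerSeries.C (if (-1 : F) = 1 then 1 else 0) * PowerSeries.X ^ i +
        PowerSeries.C (if (-1 : F) = 1 then 0 else -1) * PowerSeries.X ^ (2 * i)) *
      (1 - PowerSeries.C (Fintype.card F : ℚ) * PowerSeries.X ^ (2 * i))⁻¹ := by
    intro i hi0 hi
    simp_rw [sum_signOfDet_pow_odd hi]
    exact one_add_tsum_eq_mul_inv (S := fun m => ∑ f ∈ selfRecipFinset (1 : Fˣ) m,
      signOfDet ((-1) ^ m * f.coeff 0)) sum_sign_selfRecip_odd sum_sign_selfRecip_even hi0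
  rcases gcd_card_sub_one_two F with ⟨he, h1⟩ | ⟨he, h1⟩
  · refine hasProd_of_forall_eq h fun i => ?_
    rcases Nat.even_or_odd (i + 1) with hi | hi
    · refine (heven _ i.add_one_ne_zero hi).trans ?_
      rw [he]; simp [h1]
    · refine (hodd _ i.add_one_ne_zero hi).trans ?_
      rw [he]; simp [h1]
  -- for `-1 ≠ 1` the factors for odd and even part sizes are `1 - X ^ (2 i)` and `(1 + X ^ i) ^ 2`,
  -- up to the common denominators
  · rw [he]
    refine hasProd_euler_twist (Fintype.card F : ℚ) (c := fun i => if Even (i + 1) then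
      (1 + PowerSeries.X ^ (i + 1)) ^ 2 else 1 - PowerSeries.X ^ (2 * (i + 1))) ?_ ?_ ?_
    · intro k
      rw [if_neg (by rw [Nat.not_even_iff_odd]; exact ⟨k, rfl⟩)]
    · intro k
      rw [if_pos ⟨k + 1, by ring⟩, show 2 * k + 1 + 1 = 2 * (k + 1) by ring]
    · refine hasProd_of_forall_eq h fun i => ?_
      split_ifs with hi
      · refine (heven _ i.add_one_ne_zero hi).trans ?_
        simp only [h1, if_false, map_add, map_one]
        ring
      · refine (hodd _ i.add_one_ne_zero (Nat.not_even_iff_odd.mp hi)).trans ?_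
        simp only [h1, if_false, map_zero, map_neg, map_one]
        ring

end Counts

/-! ### Real classes modulo the center -/

section CountingPairs

variable {G : Type*} [Group G]

theorem card_conj_eq_mul_inv_eq_card_conj_eq [Fintype G] [DecidableEq G] {z g r : G}
    (h : IsConj g (z * g⁻¹)) (hr : IsConj r g) :
    (Finset.univ.filter fun x : G => x * g * x⁻¹ = z * g⁻¹).card =
      (Finset.univ.filter fun x : G => x * r * x⁻¹ = g).card := by
  obtain ⟨b, hb⟩ := isConj_iff.mp h
  obtain ⟨a, ha⟩ := isConj_iff.mp hr
  refine Finset.card_bij' (fun x _ => b⁻¹ * x * a) (fun x _ => b * x * a⁻¹) ?_ ?_ ?_ ?_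
  · intro x hx
    rw [Finset.mem_filter] at hx ⊢
    refine ⟨Finset.mem_univ _, ?_⟩
    calc b⁻¹ * x * a * r * (b⁻¹ * x * a)⁻¹ = b⁻¹ * (x * (a * r * a⁻¹) * x⁻¹) * b := by group
      _ = g := by rw [ha, hx.2, ← hb]; group
  · intro x hx
    rw [Finset.mem_filter] at hx ⊢
    refine ⟨Finset.mem_univ _, ?_⟩
    calc b * x * a⁻¹ * g * (b * x * a⁻¹)⁻¹ = b * (x * (a⁻¹ * g * a) * x⁻¹) * b⁻¹ := by group
      _ = z * g⁻¹ := by rw [← hb, show a⁻¹ * g * a = r by rw [← ha]; group, hx.2]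
  · intro x _; group
  · intro x _; group

/-- Counting pairs: if the class of `g` is stable under `g ↦ z g⁻¹`, then the `x` that conjugate
`g` to `z g⁻¹` form a coset of the centralizer of `g`. -/
theorem ncard_twistedReal_mul_card [Fintype G] [DecidableEq G] {z : G}
    (hz : z ∈ Subgroup.center G) :
    (twistedReal z).ncard * Fintype.card G =
      ∑ g : G, (Finset.univ.filter fun x : G => x * g * x⁻¹ = z * g⁻¹).card := by
  classical
  rw [← Finset.sum_fiberwise_of_maps_to (t := (Finset.univ : Finset (ConjClasses G)))
    (g := ConjClasses.mk) fun _ _ => Finset.mem_univ _]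
  have hc : ∀ c : ConjClasses G, (∑ g : G with ConjClasses.mk g = c,
      (Finset.univ.filter fun x : G => x * g * x⁻¹ = z * g⁻¹).card) =
      if c ∈ twistedReal z then Fintype.card G else 0 := by
    intro c
    obtain ⟨r, rfl⟩ := ConjClasses.mk_surjective c
    split_ifs with hr
    · rw [← Finset.card_univ, Finset.card_eq_sum_card_fiberwise
        (f := fun x : G => x * r * x⁻¹) (t := Finset.univ.filter fun g =>
          ConjClasses.mk g = ConjClasses.mk r)]
      · refine Finset.sum_congr rfl fun g hg => ?_
        have hg' := (Finset.mem_filter.mp hg).2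
        refine card_conj_eq_mul_inv_eq_card_conj_eq ?_ (ConjClasses.mk_eq_mk_iff_isConj.mp hg'.symm)
        rwa [← hg', mk_mem_twistedReal hz] at hr
      · intro x _
        simp only [Finset.coe_filter, Finset.mem_univ, true_and, Set.mem_ofPred_eq]
        exact ConjClasses.mk_eq_mk_iff_isConj.mpr (isConj_iff.mpr ⟨x, rfl⟩).symm
    · refine Finset.sum_eq_zero fun g hg => ?_
      rw [Finset.card_eq_zero, Finset.filter_eq_empty_iff]
      intro x _ hx
      refine hr ?_
      rw [← (Finset.mem_filter.mp hg).2, mk_mem_twistedReal hz]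
      exact isConj_iff.mpr ⟨x, hx⟩
  rw [Finset.sum_congr rfl fun c _ => hc c, ← Finset.sum_filter, Finset.sum_const, smul_eq_mul,
    Set.ncard_eq_toFinset_card' (twistedReal z)]
  congr 2
  ext c
  simp

/-- Multiplication by a central element `β` maps the classes stable under `g ↦ z g⁻¹` to those
stable under `g ↦ β² z g⁻¹`. -/
theorem ncard_twistedReal_sq_mul [Finite G] {z β : G} (hz : z ∈ Subgroup.center G)
    (hβ : β ∈ Subgroup.center G) : (twistedReal (β ^ 2 * z)).ncard = (twistedReal z).ncard := by
  classical
  have := Fintype.ofFinite G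
  refine Nat.eq_of_mul_eq_mul_right (Fintype.card_pos (α := G)) ?_
  rw [ncard_twistedReal_mul_card hz, ncard_twistedReal_mul_card
    (mul_mem (pow_mem hβ 2) hz)]
  refine (Fintype.sum_equiv (Equiv.mulLeft β) _ _ fun g => ?_).symm
  have hβ' : ∀ y, y * β = β * y := Subgroup.mem_center_iff.mp hβ
  refine congrArg Finset.card (Finset.filter_congr fun x _ => ?_)
  have h1 : x * (β * g) * x⁻¹ = β * (x * g * x⁻¹) := by
    rw [← mul_assoc x, hβ' x]
    group
  have h2 : β ^ 2 * z * (β * g)⁻¹ = β * (z * g⁻¹) := by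
    rw [mul_inv_rev, Subgroup.mem_center_iff.mp (inv_mem hβ) g⁻¹, ← mul_assoc _ β⁻¹, mul_assoc _ z,
      Subgroup.mem_center_iff.mp (inv_mem hβ) z]
    group
  rw [Equiv.coe_mulLeft, h1, h2, mul_right_inj]

theorem sum_comp_quotient_mk [Fintype G] (N : Subgroup G) [Fintype (G ⧸ N)] (f : G ⧸ N → ℕ) :
    ∑ g : G, f (g : G ⧸ N) = Nat.card N * ∑ a, f a := by
  classical
  rw [← Finset.sum_fiberwise_of_maps_to (t := (Finset.univ : Finset (G ⧸ N)))
    (g := fun g : G => (g : G ⧸ N)) (fun _ _ => Finset.mem_univ _), Finset.mul_sum]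
  refine Finset.sum_congr rfl fun a _ => ?_
  have hs : ∀ g ∈ Finset.univ.filter fun g : G => (g : G ⧸ N) = a, f (g : G ⧸ N) = f a :=
    fun g hg => by rw [(Finset.mem_filter.mp hg).2]
  rw [Finset.sum_congr rfl hs, Finset.sum_const, smul_eq_mul]
  congr 1
  have h := Nat.card_congr (QuotientGroup.preimageMkEquivSubgroupProdSet N {a})
  rw [Nat.card_prod, Nat.card_coe_set_eq {a}, Set.ncard_singleton, mul_one] at h
  rw [← h, Nat.card_eq_fintype_card, Fintype.card_subtype]
  congr 1
  ext g
  simp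

/-- Reality modulo the center in terms of twisted reality. Both sides count, up to the same factor,
the pairs `(g, x)` for which `x g x⁻¹ g` is central. -/
theorem card_center_mul_ncard_realClasses [Finite G] :
    Nat.card (Subgroup.center G) * (realClasses (G ⧸ Subgroup.center G)).ncard =
      ∑ᶠ z : Subgroup.center G, (twistedReal (z : G)).ncard := by
  classical
  have := Fintype.ofFinite G
  have := Fintype.ofFinite (G ⧸ Subgroup.center G)
  set Z := Subgroup.center G with hZ
  rw [finsum_eq_sum_of_fintype]
  refine Nat.eq_of_mul_eq_mul_right (Fintype.card_pos (α := G)) ?_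
  rw [Finset.sum_mul, Finset.sum_congr rfl fun z _ => ncard_twistedReal_mul_card z.2,
    Finset.sum_comm]
  have h1 : ∀ g : G, (∑ z : Z, (Finset.univ.filter fun x : G => x * g * x⁻¹ = z * g⁻¹).card) =
      Nat.card Z * (Finset.univ.filter fun y : G ⧸ Z =>
        y * (g : G ⧸ Z) * y⁻¹ = 1 * (g : G ⧸ Z)⁻¹).card := by
    intro g
    simp_rw [Finset.card_filter]
    rw [← sum_comp_quotient_mk Z, Finset.sum_comm]
    refine Finset.sum_congr rfl fun x _ => ?_
    have h3 : ((x : G ⧸ Z) * (g : G ⧸ Z) * (x : G ⧸ Z)⁻¹ = 1 * (g : G ⧸ Z)⁻¹) ↔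
        x * g * x⁻¹ * g ∈ Z := by
      rw [one_mul, ← mul_eq_one_iff_eq_inv, ← QuotientGroup.eq_one_iff]
      rfl
    simp only [h3]
    split_ifs with h4
    · rw [Finset.sum_eq_single ⟨_, h4⟩]
      · rw [if_pos]; simp
      · intro b _ hb
        rw [if_neg]
        intro h5
        exact hb (Subtype.ext (eq_mul_inv_iff_mul_eq.mp h5).symm)
      · intro h; exact absurd (Finset.mem_univ _) h
    · refine Finset.sum_eq_zero fun b _ => ?_
      rw [if_neg]
      intro h5
      exact h4 (eq_mul_inv_iff_mul_eq.mp h5 ▸ b.2)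
  rw [Finset.sum_congr rfl fun g _ => h1 g, ← Finset.mul_sum,
    sum_comp_quotient_mk Z fun a => (Finset.univ.filter fun y : G ⧸ Z =>
        y * a * y⁻¹ = 1 * a⁻¹).card, ← ncard_twistedReal_mul_card (one_mem _),
    realClasses_eq_twistedReal, ← Nat.card_eq_fintype_card (α := G),
    Subgroup.card_eq_card_quotient_mul_card_subgroup Z, Nat.card_eq_fintype_card (α := G ⧸ Z)]
  ring

/-- The squaring map of the center of a group. -/
def centerSq (G : Type*) [Group G] : Subgroup.center G →* Subgroup.center G where
  toFun b := b ^ 2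
  map_one' := one_pow 2
  map_mul' a b := Commute.mul_pow (Subtype.ext (Subgroup.mem_center_iff.mp b.2 a)) 2

/-- If the center has no element of order `2`, then all its elements are squares. -/
theorem ncard_realClasses_quotient_center_of_forall_sq [Finite G]
    (h : ∀ z ∈ Subgroup.center G, z ^ 2 = 1 → z = 1) :
    (realClasses (G ⧸ Subgroup.center G)).ncard = (realClasses G).ncard := by
  have := Fintype.ofFinite (Subgroup.center G)
  have hinj : Function.Injective (centerSq G) := by
    rw [injective_iff_map_eq_one]
    intro z hz
    exact Subtype.ext (h z z.2 (congrArg Subtype.val hz))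
  have hsurj := Finite.surjective_of_injective hinj
  have hT : ∀ z : Subgroup.center G, (twistedReal (z : G)).ncard = (twistedReal (1 : G)).ncard := by
    intro z
    obtain ⟨b, rfl⟩ := hsurj z
    rw [← ncard_twistedReal_sq_mul (one_mem _) b.2, mul_one]
    rfl
  have := card_center_mul_ncard_realClasses (G := G)
  rw [finsum_eq_sum_of_fintype, Finset.sum_congr rfl fun z _ => hT z, Finset.sum_const,
    Finset.card_univ, smul_eq_mul, Nat.card_eq_fintype_card] at this
  rw [Nat.eq_of_mul_eq_mul_left Fintype.card_pos this, realClasses_eq_twistedReal]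

/-- If the center has a unique element `t` of order `2`, then half of its elements are squares.
Here `N` is the common number of twisted real classes for the nonsquares. -/
theorem two_mul_ncard_realClasses_quotient_center [Finite G] {t : G} (ht : t ∈ Subgroup.center G)
    (ht1 : t ≠ 1) (ht2 : t ^ 2 = 1) (h : ∀ z ∈ Subgroup.center G, z ^ 2 = 1 → z = 1 ∨ z = t)
    {N : ℕ} (hN : ∀ z ∈ Subgroup.center G, (∀ b ∈ Subgroup.center G, b ^ 2 ≠ z) →
      (twistedReal z).ncard = N) :
    2 * (realClasses (G ⧸ Subgroup.center G)).ncard = (realClasses G).ncard + N := by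
  classical
  have := Fintype.ofFinite (Subgroup.center G)
  set Z := Subgroup.center G
  set φ := centerSq G
  have hker : Nat.card φ.ker = 2 := by
    rw [Nat.card_eq_two_iff]
    refine ⟨1, ⟨⟨t, ht⟩, Subtype.ext ht2⟩, fun h1 => ht1 ?_, ?_⟩
    · exact (congrArg (fun x : φ.ker => ((x : Z) : G)) h1).symm
    · rw [Set.eq_univ_iff_forall]
      rintro ⟨z, hz⟩
      rcases h z z.2 (congrArg Subtype.val hz) with h1 | h1
      · left; exact Subtype.ext (Subtype.ext h1)
      · right; exact Subtype.ext (Subtype.ext h1)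
  have hcard : Nat.card Z = Nat.card φ.range * 2 := by
    rw [← hker, Subgroup.card_eq_card_quotient_mul_card_subgroup φ.ker,
      Nat.card_congr (QuotientGroup.quotientKerEquivRange φ).toEquiv]
  have hf : ∀ z : Z, (twistedReal (z : G)).ncard =
      if z ∈ φ.range then (realClasses G).ncard else N := by
    intro z
    split_ifs with hz
    · obtain ⟨b, rfl⟩ := hz
      rw [realClasses_eq_twistedReal, ← ncard_twistedReal_sq_mul (one_mem _) b.2, mul_one]
      rfl
    · refine hN z z.2 fun b hb hbz => hz ⟨⟨b, hb⟩, Subtype.ext hbz⟩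
  have key := card_center_mul_ncard_realClasses (G := G)
  have hr : (Finset.univ.filter fun z : Z => z ∈ φ.range).card = Nat.card φ.range := by
    rw [Nat.card_eq_fintype_card, Fintype.card_subtype]
  have hr2 := Finset.card_filter_add_card_filter_not (s := (Finset.univ : Finset Z))
    (fun z : Z => z ∈ φ.range)
  rw [Finset.card_univ, ← Nat.card_eq_fintype_card, hcard, hr] at hr2
  rw [finsum_eq_sum_of_fintype, Finset.sum_congr rfl fun z _ => hf z, Finset.sum_ite,
    Finset.sum_const, Finset.sum_const, hr, smul_eq_mul, smul_eq_mul,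
    show (Finset.univ.filter fun z : Z => z ∉ φ.range).card = Nat.card φ.range by omega,
    hcard, mul_assoc, ← mul_add] at key
  exact Nat.eq_of_mul_eq_mul_left Nat.card_pos key

end CountingPairs

/-! ### The projective linear group -/

section ProjectiveLinear

variable {F : Type*} [Field F] [Fintype F]

theorem coeff_twistedRealSeries {F : Type*} [Field F] (α : Fˣ) (n : ℕ) :
    PowerSeries.coeff n (twistedRealSeries α) =
    ((twistedReal (Matrix.GeneralLinearGroup.scalar (Fin n) α)).ncard : ℚ) :=
  PowerSeries.coeff_mk _ _

theorem scalar_injective {n : ℕ} (hn : n ≠ 0) {K : Type*} [Field K] :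
    Function.Injective (Matrix.GeneralLinearGroup.scalar (Fin n) : Kˣ →* GL (Fin n) K) := by
  intro a b h
  have : Nonempty (Fin n) := ⟨⟨0, Nat.pos_of_ne_zero hn⟩⟩
  have := congrArg (fun g : GL (Fin n) K => (g : Matrix (Fin n) (Fin n) K)) h
  exact Units.ext (Matrix.scalar_inj.mp this)

theorem signedRealSeries_eq_of_not_isSquare {α : Fˣ} (hα : ¬ IsSquare α) :
    signedRealSeries F = twistedRealSeries α :=
  HasProd.unique (hasProd_signedRealSeries (F := F)) (hasProd_twistedRealSeries_of_not_isSquare hα)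

theorem signedRealSeries_eq_of_neg_one_eq_one (h : (-1 : F) = 1) :
    signedRealSeries F = twistedRealSeries (1 : Fˣ) := by
  rcases gcd_card_sub_one_two F with ⟨he, -⟩ | ⟨-, h1⟩
  · have h1 := hasProd_signedRealSeries (F := F)
    have h2 := hasProd_twistedRealSeries_of_isSquare (F := F) (α := 1) ⟨1, (mul_one 1).symm⟩
    rw [he] at h1 h2
    simp only [one_mul, pow_one] at h1 h2
    exact h1.unique h2
  · exact absurd h h1

theorem two_mul_ncard_realClasses_projGenLinGroup {n : ℕ} (hn : n ≠ 0) :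
    2 * ((realClasses (Matrix.ProjGenLinGroup (Fin n) F)).ncard : ℚ) =
      PowerSeries.coeff n (twistedRealSeries (1 : Fˣ)) +
        PowerSeries.coeff n (signedRealSeries F) := by
  have hcen := Matrix.GeneralLinearGroup.center_eq_range_scalar (n := Fin n) (R := F)
  have hinj := scalar_injective hn (K := F)
  have hN1 : PowerSeries.coeff n (twistedRealSeries (1 : Fˣ)) =
      ((realClasses (GL (Fin n) F)).ncard : ℚ) := by
    rw [coeff_twistedRealSeries, map_one, realClasses_eq_twistedReal]
  have hsq : ∀ z ∈ Subgroup.center (GL (Fin n) F), z ^ 2 = 1 →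
      z = 1 ∨ z = Matrix.GeneralLinearGroup.scalar (Fin n) (-1) := by
    intro z hz hz2
    rw [hcen] at hz
    obtain ⟨a, rfl⟩ := hz
    rw [← map_pow, ← map_one (Matrix.GeneralLinearGroup.scalar (Fin n))] at hz2
    rcases sq_eq_one_iff.mp (congrArg Units.val (hinj hz2)) with h | h
    · left; rw [show a = 1 from Units.ext h, map_one]
    · right; rw [show a = -1 from Units.ext h]
  by_cases h : (-1 : F) = 1
  · rw [signedRealSeries_eq_of_neg_one_eq_one h, hN1, ← two_mul]
    congr 2
    refine ncard_realClasses_quotient_center_of_forall_sq fun z hz hz2 => ?_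
    rcases hsq z hz hz2 with h1 | h1
    · exact h1
    · rw [h1, show (-1 : Fˣ) = 1 from Units.ext h, map_one]
  · rw [hN1]
    obtain ⟨a, ha⟩ := FiniteField.exists_nonsquare (F := F) fun h2 => h (neg_one_eq_one_iff.mpr h2)
    have ha0 : a ≠ 0 := by rintro rfl; exact ha (IsSquare.zero)
    have hns : ¬ IsSquare (Units.mk0 a ha0) := by
      rintro ⟨b, hb⟩
      exact ha ⟨b, congrArg Units.val hb⟩
    rw [signedRealSeries_eq_of_not_isSquare hns, coeff_twistedRealSeries]
    norm_cast
    refine two_mul_ncard_realClasses_quotient_center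
      (t := Matrix.GeneralLinearGroup.scalar (Fin n) (-1)) ?_ ?_ ?_ hsq ?_
    · rw [hcen]; exact ⟨_, rfl⟩
    · intro h1
      rw [← map_one (Matrix.GeneralLinearGroup.scalar (Fin n))] at h1
      exact h (congrArg Units.val (hinj h1))
    · rw [← map_pow, neg_one_sq, map_one]
    · intro z hz hz2
      rw [hcen] at hz
      obtain ⟨b, rfl⟩ := hz
      have hb : ¬ IsSquare b := by
        rintro ⟨c, rfl⟩
        refine hz2 (Matrix.GeneralLinearGroup.scalar (Fin n) c) (by rw [hcen]; exact ⟨_, rfl⟩) ?_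
        rw [sq, map_mul]
      have h1 := (signedRealSeries_eq_of_not_isSquare hb).symm.trans
        (signedRealSeries_eq_of_not_isSquare hns)
      have h2 := congrArg (PowerSeries.coeff n) h1
      rw [coeff_twistedRealSeries, coeff_twistedRealSeries] at h2
      exact_mod_cast h2

end ProjectiveLinear

/-! ### Transport of conjugacy classes -/

section ClassesByPredicate

variable {G H : Type*} [Group G] [Group H]

/-- The conjugacy classes all of whose elements satisfy `P`. -/
def conjClassesWith (P : G → Prop) : Set (ConjClasses G) :=
  {c | ∀ g ∈ c.carrier, P g}

theorem mk_mem_conjClassesWith {P : G → Prop} (hP : ∀ a b, IsConj a b → P a → P b) {g : G} :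
    ConjClasses.mk g ∈ conjClassesWith P ↔ P g :=
  ⟨fun h => h g ConjClasses.mem_carrier_mk, fun h k hk => hP g k (mem_carrier_mk.mp hk) h⟩

theorem twistedReal_eq_conjClassesWith (z : G) :
    twistedReal z = conjClassesWith fun g => IsConj g (z * g⁻¹) := by
  ext c
  refine forall₂_congr fun g hg => ?_
  rw [← ConjClasses.mem_carrier_iff_mk_eq.mp hg, mem_carrier_mk]

theorem realClassesIn_eq_conjClassesWith (N : Subgroup G) :
    realClassesIn N = conjClassesWith fun g => IsConj g (1 * g⁻¹) ∧ g ∈ N := by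
  ext c
  change c ∈ realClasses G ∧ _ ↔ _
  rw [realClasses_eq_twistedReal, twistedReal_eq_conjClassesWith]
  exact ⟨fun h g hg => ⟨h.1 g hg, h.2 hg⟩, fun h => ⟨fun g hg => (h g hg).1,
    fun g hg => (h g hg).2⟩⟩

theorem ncard_conjClassesWith_congr {φ : H → G} (hφ : ∀ a b, IsConj a b ↔ IsConj (φ a) (φ b))
    {P : H → Prop} {Q : G → Prop} (hPQ : ∀ a, P a ↔ Q (φ a))
    (hQ : ∀ a b, IsConj a b → Q a → Q b) (hsurj : ∀ g, Q g → ∃ a, IsConj g (φ a)) :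
    (conjClassesWith P).ncard = (conjClassesWith Q).ncard := by
  have hP : ∀ a b, IsConj a b → P a → P b := fun a b hab ha =>
    (hPQ b).mpr (hQ _ _ ((hφ a b).mp hab) ((hPQ a).mp ha))
  let f : ConjClasses H → ConjClasses G := Quotient.map φ fun a b hab => (hφ a b).mp hab
  have hf : ∀ a, f (ConjClasses.mk a) = ConjClasses.mk (φ a) := fun a => rfl
  have hinj : Function.Injective f := by
    intro c c' h
    obtain ⟨a, rfl⟩ := ConjClasses.exists_rep c
    obtain ⟨a', rfl⟩ := ConjClasses.exists_rep c'
    exact ConjClasses.mk_eq_mk_iff_isConj.mpr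
      ((hφ a a').mpr (ConjClasses.mk_eq_mk_iff_isConj.mp h))
  rw [← Set.ncard_image_of_injective _ hinj]
  congr 1
  ext c
  constructor
  · rintro ⟨c', hc', rfl⟩
    obtain ⟨a, rfl⟩ := ConjClasses.exists_rep c'
    rw [hf, mk_mem_conjClassesWith hQ, ← hPQ]
    exact (mk_mem_conjClassesWith hP).mp hc'
  · intro hc
    obtain ⟨g, rfl⟩ := ConjClasses.exists_rep c
    obtain ⟨a, ha⟩ := hsurj g ((mk_mem_conjClassesWith hQ).mp hc)
    refine ⟨ConjClasses.mk a, ?_, ?_⟩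
    · rw [mk_mem_conjClassesWith hP, hPQ]
      exact hQ g _ ha ((mk_mem_conjClassesWith hQ).mp hc)
    · rw [hf]
      exact ConjClasses.mk_eq_mk_iff_isConj.mpr ha.symm

theorem isConj_inv_inv {a b : G} (h : IsConj a b) : IsConj a⁻¹ b⁻¹ := by
  obtain ⟨x, rfl⟩ := isConj_iff.mp h
  exact isConj_iff.mpr ⟨x, by group⟩

theorem isConj_center_mul {w : G} (hw : w ∈ Subgroup.center G) {a b : G} (h : IsConj a b) :
    IsConj (w * a) (w * b) := by
  obtain ⟨x, rfl⟩ := isConj_iff.mp h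
  refine isConj_iff.mpr ⟨x, ?_⟩
  rw [← mul_assoc x, Subgroup.mem_center_iff.mp hw x]
  group

theorem isConj_center_mul_iff {w : G} (hw : w ∈ Subgroup.center G) {a b : G} :
    IsConj (w * a) (w * b) ↔ IsConj a b := by
  refine ⟨fun h => ?_, isConj_center_mul hw⟩
  have := isConj_center_mul (inv_mem hw) h
  rwa [inv_mul_cancel_left, inv_mul_cancel_left] at this

theorem isConj_mul_inv_of_isConj {w : G} (hw : w ∈ Subgroup.center G) {a b : G} (h : IsConj a b)
    (ha : IsConj a (w * a⁻¹)) : IsConj b (w * b⁻¹) :=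
  (h.symm.trans ha).trans (isConj_center_mul hw (isConj_inv_inv h))

end ClassesByPredicate

/-! ### Linear and unitary classes inside those over the quadratic extension -/

section UnitaryClasses

variable {n : ℕ} {F E : Type*} [Field F] [Field E] [Algebra F E]

theorem scalar_mem_center (z : Eˣ) :
    Matrix.GeneralLinearGroup.scalar (Fin n) z ∈ Subgroup.center (GL (Fin n) E) := by
  rw [Matrix.GeneralLinearGroup.center_eq_range_scalar]
  exact ⟨z, rfl⟩

variable [StarRing E]

/-- The conjugate transpose of `g` is the transpose of the matrix `ḡ`, hence similar to it. -/
theorem isConj_star_frobGL (g : GL (Fin n) E) : IsConj (star g) (frobGL n E g) := by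
  obtain ⟨P, hP⟩ := exists_conj_transpose (frobGL n E g : Matrix (Fin n) (Fin n) E)
  refine IsConj.symm (isConj_iff.mpr ⟨P, ?_⟩)
  rw [mul_inv_eq_iff_eq_mul]
  exact Units.ext hP

theorem isConj_star_star {a b : GL (Fin n) E} (h : IsConj a b) : IsConj (star a) (star b) := by
  obtain ⟨x, rfl⟩ := isConj_iff.mp h
  refine isConj_iff.mpr ⟨(star x)⁻¹, ?_⟩
  rw [star_mul, star_mul, star_inv]
  group

theorem star_scalar (z : Eˣ) : star (Matrix.GeneralLinearGroup.scalar (Fin n) z) =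
    Matrix.GeneralLinearGroup.scalar (Fin n) (star z) := by
  refine Units.ext ?_
  change (Matrix.scalar (Fin n) (z : E)).conjTranspose = Matrix.scalar (Fin n) (star (z : E))
  simp [Matrix.scalar_apply, Matrix.diagonal_conjTranspose]

theorem isConj_frobGL_of_isConj {a b : GL (Fin n) E} (h : IsConj a b)
    (ha : IsConj a (frobGL n E a)) : IsConj b (frobGL n E b) :=
  (h.symm.trans ha).trans ((frobGL n E).map_isConj h)

theorem isConj_star_inv_of_isConj {a b : GL (Fin n) E} (h : IsConj a b)
    (ha : IsConj a (star a)⁻¹) : IsConj b (star b)⁻¹ :=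
  (h.symm.trans ha).trans (isConj_inv_inv (isConj_star_star h))

/-- Multiplication by `γ` identifies the classes stable under `g ↦ z g⁻¹` and `g ↦ ḡ` with those
stable under `g ↦ γ² z g⁻¹` and `g ↦ (gᴴ)⁻¹`, provided that `γ̄ γ z = 1`. -/
theorem ncard_stable_frobGL_eq_ncard_stable_star_inv {γ z : Eˣ} (h : star γ * γ * z = 1) :
    (conjClassesWith fun g : GL (Fin n) E =>
        IsConj g (Matrix.GeneralLinearGroup.scalar (Fin n) z * g⁻¹) ∧
          IsConj g (frobGL n E g)).ncard =
      (conjClassesWith fun g : GL (Fin n) E =>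
        IsConj g (Matrix.GeneralLinearGroup.scalar (Fin n) (γ ^ 2 * z) * g⁻¹) ∧
          IsConj g (star g)⁻¹).ncard := by
  set s : Eˣ →* GL (Fin n) E := Matrix.GeneralLinearGroup.scalar (Fin n) with hs
  have hc : ∀ w : Eˣ, s w ∈ Subgroup.center (GL (Fin n) E) := scalar_mem_center
  refine ncard_conjClassesWith_congr (φ := fun g => s γ * g)
    (fun a b => (isConj_center_mul_iff (hc γ)).symm) (fun g => ?_)
    (fun a b hab ha => ⟨isConj_mul_inv_of_isConj (hc _) hab ha.1,
      isConj_star_inv_of_isConj hab ha.2⟩)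
    fun g _ => ⟨(s γ)⁻¹ * g, by rw [mul_inv_cancel_left]; exact IsConj.refl g⟩
  have e1 : s (γ ^ 2 * z) * (s γ * g)⁻¹ = s γ * (s z * g⁻¹) := by
    rw [mul_inv_rev, ← map_inv, Subgroup.mem_center_iff.mp (hc γ⁻¹), ← mul_assoc, ← map_mul,
      ← mul_assoc, ← map_mul]
    congr 2
    rw [sq]
    rw [mul_assoc, mul_assoc, mul_comm z, mul_inv_cancel_left]
  have e2 : (star (s γ * g))⁻¹ = s γ * (s z * (star g)⁻¹) := by
    rw [star_mul, hs, star_scalar, ← hs, mul_inv_rev, ← map_inv, ← mul_assoc, ← map_mul]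
    congr 2
    rw [inv_eq_iff_mul_eq_one, ← h, mul_assoc]
  rw [e1, e2, isConj_center_mul_iff (hc γ), isConj_center_mul_iff (hc γ)]
  refine and_congr_right fun h1 => ?_
  have h2 : IsConj (s z * (star g)⁻¹) (s z * (frobGL n E g)⁻¹) :=
    isConj_center_mul (hc z) (isConj_inv_inv (isConj_star_frobGL g))
  constructor
  · intro h3
    exact h1.trans ((isConj_center_mul (hc z) (isConj_inv_inv h3)).trans h2.symm)
  · intro h3
    have h4 := (isConj_center_mul_iff (hc z)).mp (h1.symm.trans (h3.trans h2))
    simpa using isConj_inv_inv h4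

variable [Finite E] {q : ℕ}

/-- The classes of `GL(n, F)` correspond to the classes of `GL(n, E)` that are stable under `g ↦
ḡ`. -/
theorem ncard_linear_eq (hq : ∀ x : E, star x = x ^ q) {l : E} (hl : l ^ q ≠ l)
    (hfix : ∀ x : E, star x = x ↔ x ∈ (algebraMap F E).range) (z : Fˣ)
    {R : GL (Fin n) E → Prop} (hR : ∀ a b, IsConj a b → R a → R b) :
    (conjClassesWith fun g : GL (Fin n) F =>
        IsConj g (Matrix.GeneralLinearGroup.scalar (Fin n) z * g⁻¹) ∧
          R (Matrix.GeneralLinearGroup.map (algebraMap F E) g)).ncard =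
      (conjClassesWith fun g : GL (Fin n) E =>
        (IsConj g (Matrix.GeneralLinearGroup.scalar (Fin n) (Units.map (algebraMap F E) z) * g⁻¹) ∧
          R g) ∧ IsConj g (frobGL n E g)).ncard := by
  set φ : GL (Fin n) F →* GL (Fin n) E := Matrix.GeneralLinearGroup.map (algebraMap F E) with hφ
  have hfr : ∀ a, frobGL n E (φ a) = φ a := by
    intro a
    ext i j
    exact (hfix _).mpr ⟨_, rfl⟩
  have hlift : ∀ g, frobGL n E g = g → ∃ a, φ a = g := by
    intro g hg
    have h1 : ∀ i j, ∃ x, algebraMap F E x = g i j := fun i j =>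
      (hfix _).mp (congrArg (fun x : GL (Fin n) E => (x : Matrix (Fin n) (Fin n) E) i j) hg)
    choose A hA using h1
    have hA' : (Matrix.of A).map (algebraMap F E) = g := Matrix.ext hA
    have hdet : (Matrix.of A).det ≠ 0 := by
      intro h0
      have h2 := (Matrix.GeneralLinearGroup.det g).ne_zero
      rw [Matrix.GeneralLinearGroup.val_det_apply, ← hA', ← RingHom.mapMatrix_apply,
        ← RingHom.map_det, h0, map_zero] at h2
      exact h2 rfl
    exact ⟨Matrix.GeneralLinearGroup.mkOfDetNeZero _ hdet, Units.ext hA'⟩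
  have hinj : Function.Injective φ := by
    intro a b hab
    ext i j
    exact (algebraMap F E).injective
      (congrArg (fun x : GL (Fin n) E => (x : Matrix (Fin n) (Fin n) E) i j) hab)
  have hconj : ∀ a b, IsConj a b ↔ IsConj (φ a) (φ b) := by
    intro a b
    refine ⟨φ.map_isConj, fun h => ?_⟩
    obtain ⟨y, hy, hy'⟩ := exists_fixed_conj_of_isConj hq hl (hfr a) (hfr b) h
    obtain ⟨x, rfl⟩ := hlift y hy
    refine isConj_iff.mpr ⟨x, hinj ?_⟩
    rw [map_mul, map_mul, map_inv, hy']
  refine ncard_conjClassesWith_congr hconj (fun a => ?_)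
    (fun a b hab ha => ⟨⟨isConj_mul_inv_of_isConj (scalar_mem_center _) hab ha.1.1,
      hR a b hab ha.1.2⟩, isConj_frobGL_of_isConj hab ha.2⟩) fun g hg => ?_
  · rw [hconj, map_mul, map_inv, hfr, hφ, Matrix.GeneralLinearGroup.map_scalar]
    exact (and_iff_left (IsConj.refl _)).symm
  · obtain ⟨g₀, hg₀, hgg₀⟩ := exists_fixed_of_isConj_frobGL hq hl hg.2
    obtain ⟨a, rfl⟩ := hlift g₀ hg₀
    exact ⟨a, hgg₀⟩

/-- The classes of the unitary group correspond to the classes of `GL(n, E)` that are stable under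
`g ↦ (gᴴ)⁻¹`. -/
theorem ncard_unitary_eq (hq : ∀ x : E, star x = x ^ q) {l : E} (hl : l ^ q ≠ l)
    {U : Subgroup (GL (Fin n) E)} (hU : ∀ g, g ∈ U ↔ star g * g = 1) {w : U}
    (hw : (w : GL (Fin n) E) ∈ Subgroup.center (GL (Fin n) E))
    {R : GL (Fin n) E → Prop} (hR : ∀ a b, IsConj a b → R a → R b) :
    (conjClassesWith fun u : U => IsConj u (w * u⁻¹) ∧ R u).ncard =
      (conjClassesWith fun g : GL (Fin n) E =>
        (IsConj g (w * g⁻¹) ∧ R g) ∧ IsConj g (star g)⁻¹).ncard := by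
  have hconj : ∀ a b : U, IsConj a b ↔ IsConj (a : GL (Fin n) E) (b : GL (Fin n) E) := by
    intro a b
    refine ⟨U.subtype.map_isConj, fun h => ?_⟩
    obtain ⟨y, hy, hy'⟩ := exists_unitary_conj_of_isConj hq hl ((hU _).mp a.2) ((hU _).mp b.2) h
    exact isConj_iff.mpr ⟨⟨y, (hU y).mpr hy⟩, Subtype.ext hy'⟩
  refine ncard_conjClassesWith_congr hconj (fun a => ?_)
    (fun a b hab ha => ⟨⟨isConj_mul_inv_of_isConj hw hab ha.1.1,
      hR a b hab ha.1.2⟩, isConj_star_inv_of_isConj hab ha.2⟩) fun g hg => ?_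
  · rw [hconj, eq_inv_of_mul_eq_one_left ((hU _).mp a.2), inv_inv]
    exact (and_iff_left (IsConj.refl _)).symm
  · obtain ⟨u, hu, hgu⟩ := exists_unitary_of_isConj_star_inv hq hl hg.2
    exact ⟨⟨u, (hU u).mpr hu⟩, hgu⟩

end UnitaryClasses

/-! ### The center of the unitary group -/

section UnitaryCenter

variable {n : ℕ} {E : Type*} [Field E] [StarRing E]

/-- The diagonal matrix with norm-one diagonal entries `d`, as an element of `GL(n, E)`. -/
def diagonalGL {d : Fin n → E} (hd : ∀ i, star (d i) * d i = 1) : GL (Fin n) E where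
  val := Matrix.diagonal d
  inv := Matrix.diagonal fun i => star (d i)
  val_inv := by
    rw [Matrix.diagonal_mul_diagonal, ← Matrix.diagonal_one]
    exact congrArg _ (funext fun i => by rw [mul_comm, hd])
  inv_val := by
    rw [Matrix.diagonal_mul_diagonal, ← Matrix.diagonal_one]
    exact congrArg _ (funext fun i => hd i)

theorem star_diagonalGL_mul {d : Fin n → E} (hd : ∀ i, star (d i) * d i = 1) :
    star (diagonalGL hd) * diagonalGL hd = 1 := by
  refine Units.ext ?_
  change (Matrix.diagonal d).conjTranspose * Matrix.diagonal d = 1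
  rw [Matrix.diagonal_conjTranspose, Matrix.diagonal_mul_diagonal, ← Matrix.diagonal_one]
  exact congrArg _ (funext fun i => hd i)

/-- The permutation matrix of `σ`, as an element of `GL(n, E)`. -/
def permGL (E : Type*) [Field E] (σ : Equiv.Perm (Fin n)) : GL (Fin n) E where
  val := σ.permMatrix E
  inv := σ⁻¹.permMatrix E
  val_inv := by rw [← Matrix.permMatrix_mul, inv_mul_cancel, Matrix.permMatrix_one]
  inv_val := by rw [← Matrix.permMatrix_mul, mul_inv_cancel, Matrix.permMatrix_one]

theorem star_permGL_mul (σ : Equiv.Perm (Fin n)) : star (permGL E σ) * permGL E σ = 1 := by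
  refine Units.ext ?_
  change (σ.permMatrix E).conjTranspose * σ.permMatrix E = 1
  rw [Matrix.conjTranspose_permMatrix, ← Matrix.permMatrix_mul, mul_inv_cancel,
    Matrix.permMatrix_one]

/-- Central elements of the unitary group are scalar, as they commute with diagonal unitary
matrices and with permutation matrices. -/
theorem exists_scalar_of_mem_center_unitary {U : Subgroup (GL (Fin n) E)}
    (hU : ∀ g, g ∈ U ↔ star g * g = 1) {t : E} (ht : star t * t = 1) (ht1 : t ≠ 1) (hn : n ≠ 0)
    {u : U} (hu : u ∈ Subgroup.center U) :
    ∃ ζ : Eˣ, star ζ * ζ = 1 ∧ (u : GL (Fin n) E) = Matrix.GeneralLinearGroup.scalar (Fin n) ζ := by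
  set A : Matrix (Fin n) (Fin n) E := ((u : GL (Fin n) E) : Matrix (Fin n) (Fin n) E) with hA
  have hcomm : ∀ g : GL (Fin n) E, star g * g = 1 →
      (g : Matrix (Fin n) (Fin n) E) * A = A * (g : Matrix (Fin n) (Fin n) E) := fun g hg =>
    congrArg (fun x : U => ((x : GL (Fin n) E) : Matrix (Fin n) (Fin n) E))
      (Subgroup.mem_center_iff.mp hu ⟨g, (hU g).mpr hg⟩)
  have hoff : ∀ i j, i ≠ j → A i j = 0 := by
    intro i j hij
    have hd : ∀ k, star ((fun k => if k = i then t else 1 : Fin n → E) k) *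
        (fun k => if k = i then t else 1 : Fin n → E) k = 1 := by
      intro k
      dsimp only
      split_ifs
      · exact ht
      · rw [star_one, one_mul]
    have h := hcomm _ (star_diagonalGL_mul hd)
    have h' := congrFun (congrFun h i) j
    simp only [diagonalGL, Matrix.diagonal_mul, Matrix.mul_diagonal, if_true, if_neg hij.symm,
      mul_one] at h'
    have h2 : (t - 1) * A i j = 0 := by linear_combination h'
    exact (mul_eq_zero.mp h2).resolve_left (sub_ne_zero.mpr ht1)
  have hdiag : A = Matrix.diagonal fun i => A i i := by
    ext i j
    by_cases hij : i = j
    · rw [hij, Matrix.diagonal_apply_eq]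
    · rw [Matrix.diagonal_apply_ne _ hij, hoff i j hij]
  have heq : ∀ i j, A i i = A j j := by
    intro i j
    have h := hcomm _ (star_permGL_mul (E := E) (Equiv.swap i j))
    have h' := congrFun (congrFun h i) j
    rw [hdiag] at h'
    simp only [permGL, Matrix.diagonal_mul, Matrix.mul_diagonal] at h'
    simpa using h'.symm
  set i₀ : Fin n := ⟨0, Nat.pos_of_ne_zero hn⟩
  have hscalar : A = Matrix.scalar (Fin n) (A i₀ i₀) := by
    rw [Matrix.scalar_apply]
    conv_lhs => rw [hdiag]
    exact congrArg _ (funext fun i => heq i i₀)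
  have hone : star (A i₀ i₀) * A i₀ i₀ = 1 := by
    have h := congrArg Units.val ((hU _).mp u.2)
    change A.conjTranspose * A = 1 at h
    have h' := congrFun (congrFun h i₀) i₀
    rw [hscalar, Matrix.scalar_apply, Matrix.diagonal_conjTranspose, Matrix.diagonal_mul_diagonal,
      Matrix.diagonal_apply_eq, Matrix.one_apply_eq] at h'
    simpa using h'
  refine ⟨⟨A i₀ i₀, star (A i₀ i₀), by rw [mul_comm, hone], hone⟩, Units.ext hone, Units.ext ?_⟩
  exact hscalar

/-- Hilbert 90 for the field `E`: an element of norm `1` is of the form `γ / γ̄`. -/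
theorem exists_mul_star_eq_of_star_mul_eq_one {l : E} (hl : star l ≠ l) {ζ : Eˣ}
    (hζ : star ζ * ζ = 1) : ∃ γ : Eˣ, ζ * star γ = γ := by
  have hζ' : star (ζ : E) * ζ = 1 := congrArg Units.val hζ
  have key : ∀ x : E, (ζ : E) * star (x + ζ * star x) = x + ζ * star x := by
    intro x
    rw [star_add, star_mul, star_star]
    linear_combination x * hζ'
  have hex : ∃ x : E, x + ζ * star x ≠ 0 := by
    -- vanishing at `1` means `ζ = -1`, and then vanishing at `l` means `l = l̄`
    by_contra! hall
    have h1 := hall 1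
    have h2 := hall l
    rw [star_one, mul_one] at h1
    refine hl ?_
    linear_combination star l * h1 - h2
  obtain ⟨x, hx⟩ := hex
  exact ⟨Units.mk0 _ hx, Units.ext (key x)⟩

end UnitaryCenter

/-! ### Real classes of the unitary groups -/

section UnitaryCounts

variable {n : ℕ} {F E : Type*} [Field F] [Field E] [Algebra F E] [StarRing E] [Finite E]
  {q : ℕ}

/-- The twisted real classes of the unitary group for the central element `γ² z = γ / γ̄` are as
many as those of `GL(n, F)` for `z = (γ̄ γ)⁻¹`. -/
theorem ncard_twistedReal_unitary (hq : ∀ x : E, star x = x ^ q) {l : E} (hl : l ^ q ≠ l)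
    (hfix : ∀ x : E, star x = x ↔ x ∈ (algebraMap F E).range)
    {U : Subgroup (GL (Fin n) E)} (hU : ∀ g, g ∈ U ↔ star g * g = 1) {γ : Eˣ} {z : Fˣ}
    (h : star γ * γ * Units.map (algebraMap F E) z = 1) {w : U}
    (hw : (w : GL (Fin n) E) = Matrix.GeneralLinearGroup.scalar (Fin n)
      (γ ^ 2 * Units.map (algebraMap F E) z)) :
    ((twistedReal w).ncard : ℚ) = PowerSeries.coeff n (twistedRealSeries z) := by
  rw [coeff_twistedRealSeries, twistedReal_eq_conjClassesWith, twistedReal_eq_conjClassesWith]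
  have h1 := ncard_linear_eq (n := n) hq hl hfix z (R := fun _ => True) fun _ _ _ _ => trivial
  have h2 := ncard_unitary_eq hq hl hU (w := w) (by rw [hw]; exact scalar_mem_center _)
    (R := fun _ => True) fun _ _ _ _ => trivial
  simp only [and_true] at h1 h2
  rw [h1, h2, hw]
  exact_mod_cast (ncard_stable_frobGL_eq_ncard_stable_star_inv h).symm

theorem two_mul_ncard_realClasses_unitary [Fintype F] (hq : ∀ x : E, star x = x ^ q) {l : E}
    (hl : l ^ q ≠ l)
    (hfix : ∀ x : E, star x = x ↔ x ∈ (algebraMap F E).range)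
    {U : Subgroup (GL (Fin n) E)} (hU : ∀ g, g ∈ U ↔ star g * g = 1) (hn : n ≠ 0) :
    2 * ((realClasses (U ⧸ Subgroup.center U)).ncard : ℚ) =
      PowerSeries.coeff n (twistedRealSeries (1 : Fˣ)) +
        PowerSeries.coeff n (signedRealSeries F) := by
  have hinj := scalar_injective hn (K := E)
  have hN1 : PowerSeries.coeff n (twistedRealSeries (1 : Fˣ)) = ((realClasses U).ncard : ℚ) := by
    rw [realClasses_eq_twistedReal]
    exact (ncard_twistedReal_unitary hq hl hfix hU (γ := 1) (z := 1) (w := 1) (by simp)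
      (by simp)).symm
  have hl0 : l ≠ 0 := by
    rintro rfl
    rw [← hq, star_zero] at hl
    exact hl rfl
  have ht : star (star l * l⁻¹) * (star l * l⁻¹) = 1 := by
    have := star_ne_zero.mpr hl0
    rw [star_mul, star_star, star_inv₀]
    field_simp
  have ht1 : star l * l⁻¹ ≠ 1 := by
    intro h
    rw [mul_inv_eq_one₀ hl0, hq] at h
    exact hl h
  have hcen : ∀ u ∈ Subgroup.center U, ∃ ζ : Eˣ, star ζ * ζ = 1 ∧
      (u : GL (Fin n) E) = Matrix.GeneralLinearGroup.scalar (Fin n) ζ := fun u hu =>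
    exists_scalar_of_mem_center_unitary hU ht ht1 hn hu
  have hscal : ∀ ζ : Eˣ, star ζ * ζ = 1 → Matrix.GeneralLinearGroup.scalar (Fin n) ζ ∈ U := by
    intro ζ hζ
    rw [hU, star_scalar, ← map_mul, hζ, map_one]
  have hscal' : ∀ (ζ : Eˣ) (hζ : star ζ * ζ = 1), (⟨_, hscal ζ hζ⟩ : U) ∈ Subgroup.center U :=
    fun ζ hζ => Subgroup.mem_center_iff.mpr fun g =>
      Subtype.ext (Subgroup.mem_center_iff.mp (scalar_mem_center ζ) (g : GL (Fin n) E))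
  have hm1 : star (-1 : Eˣ) * -1 = 1 := Units.ext (by simp)
  set t : U := ⟨_, hscal (-1) hm1⟩ with ht_def
  have hsq : ∀ z ∈ Subgroup.center U, z ^ 2 = 1 → z = 1 ∨ z = t := by
    intro z hz hz2
    obtain ⟨a, ha, haz⟩ := hcen z hz
    have h2 : (z : GL (Fin n) E) ^ 2 = 1 := congrArg Subtype.val hz2
    rw [haz, ← map_pow, ← map_one (Matrix.GeneralLinearGroup.scalar (Fin n))] at h2
    rcases sq_eq_one_iff.mp (congrArg Units.val (hinj h2)) with h | h
    · left
      refine Subtype.ext ?_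
      rw [haz, show a = 1 from Units.ext h, map_one]
      rfl
    · right
      refine Subtype.ext ?_
      rw [haz, show a = -1 from Units.ext h]
  by_cases h : (-1 : F) = 1
  · have hE : (-1 : Eˣ) = 1 := Units.ext (by
      have := congrArg (algebraMap F E) h
      rwa [map_neg, map_one] at this)
    rw [signedRealSeries_eq_of_neg_one_eq_one h, hN1, ← two_mul]
    congr 2
    refine ncard_realClasses_quotient_center_of_forall_sq fun z hz hz2 => ?_
    rcases hsq z hz hz2 with h1 | h1
    · exact h1
    · rw [h1]
      refine Subtype.ext ?_
      change Matrix.GeneralLinearGroup.scalar (Fin n) (-1) = 1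
      rw [hE, map_one]
  · obtain ⟨a, ha⟩ := FiniteField.exists_nonsquare (F := F) fun h2 => h (neg_one_eq_one_iff.mpr h2)
    have ha0 : a ≠ 0 := by rintro rfl; exact ha (IsSquare.zero)
    have hns : ¬ IsSquare (Units.mk0 a ha0) := by
      rintro ⟨b, hb⟩
      exact ha ⟨b, congrArg Units.val hb⟩
    rw [hN1, signedRealSeries_eq_of_not_isSquare hns, coeff_twistedRealSeries]
    norm_cast
    refine two_mul_ncard_realClasses_quotient_center (t := t) (hscal' _ hm1) ?_ ?_ hsq ?_
    · intro h1
      have h2 : Matrix.GeneralLinearGroup.scalar (Fin n) (-1 : Eˣ) = 1 := congrArg Subtype.val h1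
      rw [← map_one (Matrix.GeneralLinearGroup.scalar (Fin n))] at h2
      have h3 : (-1 : E) = 1 := congrArg Units.val (hinj h2)
      refine h ((algebraMap F E).injective ?_)
      rw [map_neg, map_one, h3]
    · refine Subtype.ext ?_
      change Matrix.GeneralLinearGroup.scalar (Fin n) (-1 : Eˣ) ^ 2 = 1
      rw [← map_pow, neg_one_sq, map_one]
    · intro w hw hw2
      obtain ⟨ζ, hζ, hwζ⟩ := hcen w hw
      obtain ⟨γ, hγ⟩ := exists_mul_star_eq_of_star_mul_eq_one (l := l) (by rwa [hq]) hζ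
      -- `ζ = γ² z`, where `z = (γ̄γ)⁻¹` lies in the ground field
      obtain ⟨x, hx⟩ := (hfix ((star γ * γ : Eˣ) : E)⁻¹).mp (by
        rw [star_inv₀, Units.val_mul, Units.coe_star, star_mul, star_star])
      have hx0 : x ≠ 0 := by
        rintro rfl
        rw [map_zero, zero_eq_inv] at hx
        exact (star γ * γ).ne_zero hx.symm
      have hz : star γ * γ * Units.map (algebraMap F E) (Units.mk0 x hx0) = 1 := by
        refine Units.ext ?_
        rw [Units.val_mul, Units.val_one]
        change _ * algebraMap F E x = 1
        rw [hx, mul_inv_cancel₀ (Units.ne_zero _)]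
      have hζz : ζ = γ ^ 2 * Units.map (algebraMap F E) (Units.mk0 x hx0) := by
        rw [← mul_right_inj (star γ), mul_comm _ ζ, hγ, sq, ← mul_assoc, ← mul_assoc,
          mul_comm _ γ, mul_assoc, hz, mul_one]
      -- if `z = b²`, then `ζ` is the square of the norm-one element `γ b`
      have hzns : ¬ IsSquare (Units.mk0 x hx0) := by
        rintro ⟨b, hb⟩
        have hbfix : star (Units.map (algebraMap F E : F →* E) b) =
            Units.map (algebraMap F E : F →* E) b :=
          Units.ext ((hfix _).mpr ⟨b, rfl⟩)
        have hnorm : star (γ * Units.map (algebraMap F E : F →* E) b) *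
            (γ * Units.map (algebraMap F E : F →* E) b) = 1 := by
          rw [star_mul, hbfix, ← hz, hb, map_mul]
          exact by ac_rfl
        refine hw2 ⟨_, hscal _ hnorm⟩ (hscal' _ hnorm) (Subtype.ext ?_)
        change Matrix.GeneralLinearGroup.scalar (Fin n) _ ^ 2 = (w : GL (Fin n) E)
        rw [hwζ, hζz, ← map_pow, mul_pow, hb, ← sq, map_pow]
      have h1 := ncard_twistedReal_unitary hq hl hfix hU hz (by rw [hwζ, hζz])
      rw [← signedRealSeries_eq_of_not_isSquare hzns, signedRealSeries_eq_of_not_isSquare hns,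
        coeff_twistedRealSeries] at h1
      exact_mod_cast h1

theorem ncard_realClassesIn_specialLinear_eq_unitary (hq : ∀ x : E, star x = x ^ q) {l : E}
    (hl : l ^ q ≠ l) (hfix : ∀ x : E, star x = x ↔ x ∈ (algebraMap F E).range)
    {U : Subgroup (GL (Fin n) E)} (hU : ∀ g, g ∈ U ↔ star g * g = 1) :
    (realClassesIn (specialLinear n F)).ncard =
      (realClassesIn ((specialLinear n E).subgroupOf U)).ncard := by
  have hR : ∀ a b : GL (Fin n) E, IsConj a b → a ∈ specialLinear n E → b ∈ specialLinear n E := by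
    intro a b hab ha
    obtain ⟨x, rfl⟩ := isConj_iff.mp hab
    exact (MonoidHom.normal_ker _).conj_mem a ha x
  have h1 := ncard_linear_eq (n := n) hq hl hfix 1 hR
  have h2 := ncard_unitary_eq hq hl hU (w := 1) (one_mem _) hR
  simp only [map_one] at h1
  have hdet : ∀ g : GL (Fin n) F,
      Matrix.GeneralLinearGroup.map (algebraMap F E) g ∈ specialLinear n E ↔
        g ∈ specialLinear n F := by
    intro g
    change Matrix.GeneralLinearGroup.det _ = 1 ↔ Matrix.GeneralLinearGroup.det g = 1
    rw [Matrix.GeneralLinearGroup.map_det]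
    exact map_eq_one_iff _ (Units.map_injective (algebraMap F E).injective)
  rw [realClassesIn_eq_conjClassesWith, realClassesIn_eq_conjClassesWith]
  simp only [hdet] at h1
  rw [h1]
  refine Eq.trans ?_ h2.symm
  congr 2
  funext g
  refine propext (and_congr_right fun h => ?_)
  have h3 : IsConj g g⁻¹ := by simpa using h.1
  have h4 := isConj_star_frobGL g
  constructor
  · intro h5
    exact h3.trans (isConj_inv_inv (h5.trans h4.symm))
  · intro h5
    have h6 := isConj_inv_inv (h3.symm.trans h5)
    rw [inv_inv, inv_inv] at h6
    exact h6.trans h4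

end UnitaryCounts

/-! ### The quadratic extension of a finite field -/

section QuadraticExtension

variable (F E : Type*) [Field F] [Fintype F] [Field E] [Algebra F E]

theorem pow_card_eq_self_iff_mem_range {x : E} :
    x ^ Fintype.card F = x ↔ x ∈ (algebraMap F E).range := by
  classical
  constructor
  · intro hx
    have hq := Fintype.one_lt_card (α := F)
    have hP : (Polynomial.X ^ Fintype.card F - Polynomial.X : Polynomial E) ≠ 0 :=
      FiniteField.X_pow_card_sub_X_ne_zero E hq
    have hsub : Finset.univ.image (algebraMap F E) ⊆
        (Polynomial.X ^ Fintype.card F - Polynomial.X : Polynomial E).roots.toFinset := by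
      intro y hy
      obtain ⟨a, -, rfl⟩ := Finset.mem_image.mp hy
      rw [Multiset.mem_toFinset, Polynomial.mem_roots hP, Polynomial.IsRoot.def]
      simp [← map_pow, FiniteField.pow_card]
    have hcard : (Polynomial.X ^ Fintype.card F - Polynomial.X : Polynomial E).roots.toFinset.card ≤
        (Finset.univ.image (algebraMap F E)).card := by
      rw [Finset.card_image_of_injective _ (algebraMap F E).injective, Finset.card_univ]
      refine (Multiset.toFinset_card_le _).trans ((Polynomial.card_roots' _).trans_eq ?_)
      exact FiniteField.X_pow_card_sub_X_natDegree_eq E hq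
    have hmem : x ∈
        (Polynomial.X ^ Fintype.card F - Polynomial.X : Polynomial E).roots.toFinset := by
      rw [Multiset.mem_toFinset, Polynomial.mem_roots hP, Polynomial.IsRoot.def]
      simp [hx]
    rw [← Finset.eq_of_subset_of_card_le hsub hcard] at hmem
    obtain ⟨a, -, ha⟩ := Finset.mem_image.mp hmem
    exact ⟨a, ha⟩
  · rintro ⟨a, rfl⟩
    rw [← map_pow, FiniteField.pow_card]

variable {F E}

theorem exists_pow_card_ne_self (hE : Module.finrank F E = 2) :
    ∃ l : E, l ^ Fintype.card F ≠ l := by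
  by_contra! h
  have hsurj : Function.Surjective (algebraMap F E) := fun x =>
    (pow_card_eq_self_iff_mem_range F E).mp (h x)
  have h1 := LinearMap.finrank_le_finrank_of_surjective (f := Algebra.linearMap F E) hsurj
  rw [Module.finrank_self] at h1
  omega

/-- The field automorphism `x ↦ x ^ q` of a quadratic extension of a field with `q` elements,
as a star structure. -/
noncomputable abbrev quadraticStarRing (hE : Module.finrank F E = 2) : StarRing E where
  star x := x ^ Fintype.card F
  star_involutive x := by
    change (x ^ Fintype.card F) ^ Fintype.card F = x
    have : Module.Finite F E := Module.finite_of_finrank_pos (by omega)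
    have : Finite E := Module.finite_of_finite F
    have := Fintype.ofFinite E
    rw [← pow_mul, ← sq, ← hE, ← Module.card_eq_pow_finrank (K := F) (V := E),
      FiniteField.pow_card]
  star_mul x y := by
    change (x * y) ^ Fintype.card F = _
    rw [mul_pow, mul_comm]
  star_add x y := map_add (FiniteField.frobeniusAlgHom F E) x y

end QuadraticExtension

/-! ### Equality of the four counts and the generating function -/

theorem ncard_realClasses_of_subsingleton (G : Type*) [Group G] [Subsingleton G] :
    (realClasses G).ncard = 1 := by
  rw [Set.ncard_eq_one]
  refine ⟨1, Set.eq_singleton_iff_unique_mem.mpr ⟨fun g hg => ?_, fun c _ => ?_⟩⟩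
  · rwa [Subsingleton.elim g⁻¹ g]
  · obtain ⟨g, rfl⟩ := ConjClasses.exists_rep c
    rw [Subsingleton.elim g 1]
    rfl

theorem ncard_realClassesIn_of_subsingleton {G : Type*} [Group G] [Subsingleton G]
    (H : Subgroup G) : (realClassesIn H).ncard = 1 := by
  rw [← ncard_realClasses_of_subsingleton G]
  congr 1
  refine Set.ext fun c => ⟨fun h => h.1, fun h => ⟨h, fun g _ => ?_⟩⟩
  rw [Subsingleton.elim g 1]
  exact one_mem H

theorem theorem4p1 (q : ℕ) (_hq : IsPrimePow q)
    {F E : Type*} [Field F] [Fintype F] (hF : Fintype.card F = q)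
    [Field E] [Algebra F E] (hE : Module.finrank F E = 2) :
    (∀ n : ℕ,
      (realClasses (Matrix.ProjGenLinGroup (Fin n) F)).ncard
        = (realClassesIn (specialLinear n F)).ncard ∧
      (realClassesIn (specialLinear n F)).ncard
        = (realClasses (ProjFiniteUnitary n F E)).ncard ∧
      (realClasses (ProjFiniteUnitary n F E)).ncard
        = (realClassesIn (finiteSpecialUnitary n F E)).ncard) ∧
    Multipliable (fun i : ℕ =>
      (1 + PowerSeries.X ^ (i + 1)) ^ Nat.gcd (q - 1) 2 *
        (1 - PowerSeries.C (q : ℚ) * PowerSeries.X ^ (2 * (i + 1)))⁻¹) ∧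
    Multipliable (fun i : ℕ =>
      (1 + PowerSeries.X ^ (Nat.gcd (q - 1) 2 * (i + 1))) *
        (1 - PowerSeries.C (q : ℚ) * PowerSeries.X ^ (2 * (i + 1)))⁻¹) ∧
    PowerSeries.mk (fun n : ℕ =>
        ((realClasses (Matrix.ProjGenLinGroup (Fin n) F)).ncard : ℚ))
      = PowerSeries.C (1 / 2 : ℚ) *
        ((∏' i : ℕ, (1 + PowerSeries.X ^ (i + 1)) ^ Nat.gcd (q - 1) 2 *
            (1 - PowerSeries.C (q : ℚ) * PowerSeries.X ^ (2 * (i + 1)))⁻¹) +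
          ∏' i : ℕ, (1 + PowerSeries.X ^ (Nat.gcd (q - 1) 2 * (i + 1))) *
            (1 - PowerSeries.C (q : ℚ) * PowerSeries.X ^ (2 * (i + 1)))⁻¹) := by
  subst hF
  let _ : StarRing E := quadraticStarRing hE
  have : Module.Finite F E := Module.finite_of_finrank_pos (by omega)
  have : Finite E := Module.finite_of_finite F
  have hstar : ∀ x : E, star x = x ^ Fintype.card F := fun x => rfl
  obtain ⟨l, hl⟩ := exists_pow_card_ne_self (F := F) (E := E) hE
  have hfix : ∀ x : E, star x = x ↔ x ∈ (algebraMap F E).range := fun x =>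
    pow_card_eq_self_iff_mem_range F E
  have hU : ∀ (n : ℕ) (g : GL (Fin n) E), g ∈ finiteUnitary n F E ↔ star g * g = 1 := by
    intro n g
    rw [mul_eq_one_comm, Units.ext_iff]
    rfl
  have hSU : ∀ n, (realClassesIn (specialLinear n F)).ncard =
      (realClassesIn (finiteSpecialUnitary n F E)).ncard := fun n =>
    ncard_realClassesIn_specialLinear_eq_unitary hstar hl hfix (hU n)
  have hPGL : ∀ n, (realClasses (Matrix.ProjGenLinGroup (Fin n) F)).ncard =
      (realClassesIn (specialLinear n F)).ncard := by
    intro n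
    rcases eq_or_ne n 0 with rfl | hn
    · have : Subsingleton (Matrix.ProjGenLinGroup (Fin 0) F) :=
        (QuotientGroup.mk_surjective (s := Subgroup.center (GL (Fin 0) F))).subsingleton
      rw [ncard_realClasses_of_subsingleton, ncard_realClassesIn_of_subsingleton]
    · have h1 := two_mul_ncard_realClasses_projGenLinGroup (F := F) hn
      rw [← two_mul_ncard_realClassesIn_specialLinear] at h1
      exact_mod_cast mul_left_cancel₀ two_ne_zero h1
  have hPGU : ∀ n, (realClasses (ProjFiniteUnitary n F E)).ncard =
      (realClassesIn (specialLinear n F)).ncard := by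
    intro n
    rcases eq_or_ne n 0 with rfl | hn
    · have : Subsingleton (ProjFiniteUnitary 0 F E) :=
        (QuotientGroup.mk_surjective (s := Subgroup.center (finiteUnitary 0 F E))).subsingleton
      rw [ncard_realClasses_of_subsingleton, ncard_realClassesIn_of_subsingleton]
    · have h1 := two_mul_ncard_realClasses_unitary hstar hl hfix (hU n) hn
      rw [← two_mul_ncard_realClassesIn_specialLinear] at h1
      exact_mod_cast mul_left_cancel₀ two_ne_zero h1
  have h1 := hasProd_twistedRealSeries_of_isSquare (F := F) (α := 1) ⟨1, (mul_one 1).symm⟩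
  have h2 := hasProd_signedRealSeries (F := F)
  refine ⟨fun n => ⟨hPGL n, (hPGU n).symm, (hPGU n).trans (hSU n)⟩, h1.multipliable,
    h2.multipliable, ?_⟩
  rw [h1.tprod_eq, h2.tprod_eq]
  ext n
  rw [PowerSeries.coeff_mk, PowerSeries.coeff_C_mul, map_add, hPGL,
    ← two_mul_ncard_realClassesIn_specialLinear]
  ring
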